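/- Let $\mathbb R^4_1$ be Minkowski 4-space, $\mathbb R^4$ with $\langle v,w\rangle=-(v^1w^4+v^4w^1)+v^2w^2+v^3w^3$, $g_{ij}=\langle\epsilon_i,\epsilon_j\rangle$, and $\mathcal L_+=\{v:\langle v,v\rangle=0,\ \langle v,\epsilon_1+\epsilon_4\rangle<0\}$. For $x\in\mathbb R^4_1$, $v\in\mathcal L_+$ let $[x,v]$ be the isotropic line $x+\mathbb Rv$. A contact element $(p,n)\in\mathbb R^3\times S^2$ is identified with the isotropic line $[x(p),v(n)]$, where $x(p)=(p^1/\sqrt2,\,p^2,\,p^3,\,-p^1/\sqrt2)$ and $v(n)=(\frac{1+n^1}2,\frac{n^2}{\sqrt2},\frac{n^3}{\sqrt2},\frac{1-n^1}2)$; let $\Lambda$ be the space of these lines. Let $M$ be a connected (Hausdorff) smooth surface. A *Legendre immersion* $F=(f,n):M\to\Lambda$ is a pair of smooth maps $f:M\to\mathbb R^3$, $n:M\to S^2$ with $df\cdot n=0$ and $dn\cdot dn>0$. It is *nondegenerate* if the quadratic forms $df\cdot dn$ and $dn\cdot dn$ are linearly independent at every point. It is *L-minimal* if it is an extremal, with respect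 to compactly supported smooth variations through Legendre immersions, of the Weingarten functional $\int (H^2/K-1)\,dA$, that is, of $\int\big((\tfrac12\operatorname{tr}S)^2-\det S\big)\,dA_{III}$, where $S$ is $df\cdot dn$ relative to $III=dn\cdot dn$ (for an immersion $f$ the two integrands agree up to the sign of $K$). A *middle frame field* along $F$ on an open set $U\subset M$ consists of smooth maps $a_0,a_1,\dots,a_4:U\to\mathbb R^4_1$ such that $(a_1,\dots,a_4)$ is a positively oriented basis with $\langle a_i,a_j\rangle=g_{ij}$ and $a_1,a_4\in\mathcal L_+$, such that $[a_0,a_1]=F$, and such that for some smooth functions $p_1,p_2,p_3,q_1,q_2$ and 1-forms $\alpha_2,\alpha_3$ on $U$ $$da_0=\alpha_2a_2+\alpha_3a_3,\qquad da_1=(2q_2\alpha_2-2q_1\alpha_3)a_1+\alpha_2a_2-\alpha_3a_3,$$ $$da_2=(p_1\alpha_2+p_2\alpha_3)a_1+(q_1\alpha_2+q_2\alpha_3)a_3+\alpha_2a_4,\qquad da_3=(p_2\alpha_2+p_3\alpha_3)a_1-(q_1\alpha_2+q_2\alpha_3)a_2-\alpha_3a_4,$$ $$da_4=(p_1\alpha_2+p_2\alpha_3)a_2+(p_2\alpha_2+p_3\alpha_3)a_3-(2q_2\alpha_2-2q_1\alpha_3)a_4.$$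 For nondegenerate $F$ such frames exist near every point and $a_0$, $a_1$ do not depend on the choice; the *L-Gauss map* $\sigma_F:M\to\mathbb R^4_1$ is given locally by $\sigma_F=a_0$. A nondegenerate $F$ is *L-isothermic* if near every point there are local coordinates which diagonalize both $\langle da_0,da_0\rangle$ and $\langle da_0,da_1\rangle$ and are isothermal for $\langle da_0,da_0\rangle$. **Proposition 4.1.** Let $F:M\to\Lambda$ be a nondegenerate L-minimal Legendre immersion. Then $F$ is L-isothermic if and only if there are a point $O\in\mathbb R^4_1$ and a constant vector $v\neq0$ with $$\langle\sigma_F-O,v\rangle=0\quad\text{on } M .$$ In particular, if $F$ is L-isothermic, then $\sigma_F$ is a spacelike immersion with zero mean curvature into some hyperplane $P=\{x:\langle x-O,v\rangle=0\}$ that is spacelike, timelike or isotropic ($v$ timelike, spacelike or isotropic, respectively). Here $\sigma_F$ has zero mean curvature in $P$ if the trace, with respect to the induced metric, of its second fundamental form in the affine 3-space $P$ (the second derivative of $\sigma_F$ modulo the tangent plane) vanishes; this is the usual notion if $P$ is not isotropic. -/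

import Mathlib

open Set Topology MeasureTheory
open scoped Manifold ContDiff

namespace Laguerre

/-! ### Minkowski 4-space

The coordinates `0, 1, 2, 3` of `Mink` are the coordinates `1, 2, 3, 4` of the usual notation. -/

/-- Minkowski 4-space (as a vector space, which also serves as its own affine space). -/
abbrev Mink : Type := Fin 4 → ℝ

/-- Euclidean 3-space. -/
abbrev E3 : Type := EuclideanSpace ℝ (Fin 3)

/-- The Euclidean scalar product of `ℝ³`. -/
noncomputable def dot (x y : E3) : ℝ := inner ℝ x y

/-- The coordinate plane. -/
abbrev E2 : Type := EuclideanSpace ℝ (Fin 2)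

/-- The Lorentzian scalar product
`⟨v, w⟩ = -(v¹ w⁴ + v⁴ w¹) + v² w² + v³ w³`. -/
def mink (v w : Mink) : ℝ := -(v 0 * w 3 + v 3 * w 0) + v 1 * w 1 + v 2 * w 2

/-- The Gram matrix of the standard basis. -/
def gram (i j : Fin 4) : ℝ := mink (Pi.single i 1) (Pi.single j 1)

def IsSpacelikeVec (v : Mink) : Prop := 0 < mink v v

def IsTimelikeVec (v : Mink) : Prop := mink v v < 0

def IsIsotropicVec (v : Mink) : Prop := mink v v = 0 ∧ v ≠ 0

/-- The positive light cone; `![1, 0, 0, 1]` is `ε₁ + ε₄`. -/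
def posCone : Set Mink := {v | mink v v = 0 ∧ mink v ![1, 0, 0, 1] < 0}

/-- The hyperplane through `O` with normal vector `v` (a hyperplane when `v ≠ 0`). -/
def hyperplane (O v : Mink) : Set Mink := {x | mink (x - O) v = 0}

/-- `hyperplane O v` is spacelike when its normal vector is timelike. -/
def IsSpacelikeHyperplane (P : Set Mink) : Prop :=
  ∃ O v : Mink, IsTimelikeVec v ∧ P = hyperplane O v

/-- `hyperplane O v` is timelike when its normal vector is spacelike. -/
def IsTimelikeHyperplane (P : Set Mink) : Prop :=
  ∃ O v : Mink, IsSpacelikeVec v ∧ P = hyperplane O v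

/-- `hyperplane O v` is isotropic (degenerate) when its normal vector is isotropic. -/
def IsIsotropicHyperplane (P : Set Mink) : Prop :=
  ∃ O v : Mink, IsIsotropicVec v ∧ P = hyperplane O v

/-- The line through `x` with direction `v`; for `v` in the positive light cone this is the
time-oriented isotropic line `[x, v]`. -/
def line (x v : Mink) : Set Mink := {y | ∃ t : ℝ, y = x + t • v}

/-- The cyclographic model: the oriented sphere with center `p` and signed radius `r`. -/
noncomputable def sphereVec (p : E3) (r : ℝ) : Mink :=
  ![(r + p 0) / √2, p 1, p 2, (r - p 0) / √2]

/-- The isotropic normal vector of the oriented planes orthogonal to the unit vector `n`. -/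
noncomputable def planeVec (n : E3) : Mink :=
  ![(1 + n 0) / 2, n 1 / √2, n 2 / √2, (1 - n 0) / 2]

/-- The isotropic line that represents the oriented contact element `(p, n)`. -/
noncomputable def contactLine (p n : E3) : Set Mink := line (sphereVec p 0) (planeVec n)

/-! ### Partial derivatives in the coordinate plane -/

/-- The partial derivative in the `i`-th coordinate direction. -/
noncomputable def pd {V : Type*} [NormedAddCommGroup V] [NormedSpace ℝ V]
    (i : Fin 2) (u : E2 → V) (z : E2) : V :=
  fderiv ℝ u z (EuclideanSpace.single i 1)

/-- The coefficients, in the coordinates of the plane, of `⟨du, dw⟩`. -/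
noncomputable def minkCoeff (u w : E2 → Mink) (i j : Fin 2) (z : E2) : ℝ :=
  mink (pd i u z) (pd j w z)

/-- The coefficients, in the coordinates of the plane, of `du · dw`. -/
noncomputable def eucCoeff (u w : E2 → E3) (i j : Fin 2) (z : E2) : ℝ :=
  dot (pd i u z) (pd j w z)

/-- The density of the Weingarten functional `∫ (H² / K - 1) dA` in coordinates.

With `III = dn · dn` and `II = df · dn`, half the trace of `II` relative to `III` is `± H / K`, and
the determinant of `II` relative to `III` is `1 / K`. As `dA_III = |K| dA`, one has
`(H² / K - 1) dA = ± ((H / K)² - 1 / K) dA_III`, the sign being the sign of `K`. The right-hand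
side makes sense for all Legendre immersions with `dn · dn > 0`, also where `f` is
not an immersion. -/
noncomputable def weingartenDensity (f n : E2 → E3) (z : E2) : ℝ :=
  let third : Matrix (Fin 2) (Fin 2) ℝ := Matrix.of fun i j => eucCoeff n n i j z
  let second : Matrix (Fin 2) (Fin 2) ℝ := Matrix.of fun i j => eucCoeff f n i j z
  (((third⁻¹ * second).trace / 2) ^ 2 - (third⁻¹ * second).det) * √third.det

section Surface

variable (M : Type*) [TopologicalSpace M] [ChartedSpace E2 M]

/-- A Legendre immersion `F = (f, n)` of the surface `M` into the space `ℝ³ × S²` of oriented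
contact elements, with `dn · dn > 0` (so that `F` is automatically an immersion). -/
structure LegendreImmersion where
  f : M → E3
  n : M → E3
  smooth_f : ContMDiff (𝓡 2) 𝓘(ℝ, E3) ∞ f
  smooth_n : ContMDiff (𝓡 2) 𝓘(ℝ, E3) ∞ n
  norm_n : ∀ p, ‖n p‖ = 1
  /-- `df · n = 0` -/
  contact : ∀ (p : M) (X : TangentSpace (𝓡 2) p),
    dot (mfderiv (𝓡 2) 𝓘(ℝ, E3) f p X) (n p) = 0
  /-- `dn · dn > 0` -/
  third_pos : ∀ (p : M) (X : TangentSpace (𝓡 2) p), X ≠ 0 →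
    0 < dot (mfderiv (𝓡 2) 𝓘(ℝ, E3) n p X) (mfderiv (𝓡 2) 𝓘(ℝ, E3) n p X)

/-- A field of (candidates for) Laguerre frames: a position vector `x` (the `a₀` of the usual
notation) and vectors `a 0, a 1, a 2, a 3` (the `a₁, a₂, a₃, a₄` of the usual notation). -/
structure FrameField where
  x : M → Mink
  a : Fin 4 → M → Mink

variable {M}

namespace LegendreImmersion

variable (F : LegendreImmersion M)

/-- `F` is nondegenerate when the quadratic forms `df · dn` and `dn · dn` are linearly independent
at every point. -/
def Nondegenerate : Prop :=
  ∀ (p : M) (c d : ℝ),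
    (∀ X : TangentSpace (𝓡 2) p,
      c * dot (mfderiv (𝓡 2) 𝓘(ℝ, E3) F.f p X) (mfderiv (𝓡 2) 𝓘(ℝ, E3) F.n p X)
        + d * dot (mfderiv (𝓡 2) 𝓘(ℝ, E3) F.n p X) (mfderiv (𝓡 2) 𝓘(ℝ, E3) F.n p X) = 0) →
    c = 0 ∧ d = 0

/-- `A` is a smooth Laguerre frame field along `F` on the set `U`: at every point of `U` it is a
positively oriented basis with the Gram matrix of the standard basis, whose first and last vectors
lie in the positive light cone, and `[a₀, a₁] = F`. -/
structure IsFrameFieldOn (U : Set M) (A : FrameField M) : Prop where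
  smooth_x : ContMDiffOn (𝓡 2) 𝓘(ℝ, Mink) ∞ A.x U
  smooth_a : ∀ i, ContMDiffOn (𝓡 2) 𝓘(ℝ, Mink) ∞ (A.a i) U
  gram_eq : ∀ p ∈ U, ∀ i j, mink (A.a i p) (A.a j p) = gram i j
  oriented : ∀ p ∈ U, 0 < (Matrix.of fun i j => A.a i p j).det
  first_mem : ∀ p ∈ U, A.a 0 p ∈ posCone
  last_mem : ∀ p ∈ U, A.a 3 p ∈ posCone
  along : ∀ p ∈ U, line (A.x p) (A.a 0 p) = contactLine (F.f p) (F.n p)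

/-- `A` is a middle frame field along `F` on `U`. Here `α₂ = α₀²` and `α₃ = α₀³`, so that
`dx = α₂ a₂ + α₃ a₃`; the four equations for `da` are the columns of the Maurer-Cartan
form of a middle frame. The surface is oriented by `α₂ ∧ α₃`. -/
def IsMiddleFrameOn (U : Set M) (A : FrameField M) : Prop :=
  F.IsFrameFieldOn U A ∧
  ∃ p₁ p₂ p₃ q₁ q₂ : M → ℝ,
    ContMDiffOn (𝓡 2) 𝓘(ℝ, ℝ) ∞ p₁ U ∧ ContMDiffOn (𝓡 2) 𝓘(ℝ, ℝ) ∞ p₂ U ∧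
    ContMDiffOn (𝓡 2) 𝓘(ℝ, ℝ) ∞ p₃ U ∧ ContMDiffOn (𝓡 2) 𝓘(ℝ, ℝ) ∞ q₁ U ∧
    ContMDiffOn (𝓡 2) 𝓘(ℝ, ℝ) ∞ q₂ U ∧
    ∀ p ∈ U, ∀ X : TangentSpace (𝓡 2) p,
      let dx : Mink := mfderiv (𝓡 2) 𝓘(ℝ, Mink) A.x p X
      let da : Fin 4 → Mink := fun i => mfderiv (𝓡 2) 𝓘(ℝ, Mink) (A.a i) p X
      let α₂ : ℝ := mink dx (A.a 1 p)
      let α₃ : ℝ := mink dx (A.a 2 p)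
      dx = α₂ • A.a 1 p + α₃ • A.a 2 p ∧
      da 0 = (2 * q₂ p * α₂ - 2 * q₁ p * α₃) • A.a 0 p + α₂ • A.a 1 p - α₃ • A.a 2 p ∧
      da 1 = (p₁ p * α₂ + p₂ p * α₃) • A.a 0 p + (q₁ p * α₂ + q₂ p * α₃) • A.a 2 p
        + α₂ • A.a 3 p ∧
      da 2 = (p₂ p * α₂ + p₃ p * α₃) • A.a 0 p - (q₁ p * α₂ + q₂ p * α₃) • A.a 1 p
        - α₃ • A.a 3 p ∧
      da 3 = (p₁ p * α₂ + p₂ p * α₃) • A.a 1 p + (p₂ p * α₂ + p₃ p * α₃) • A.a 2 p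
        - (2 * q₂ p * α₂ - 2 * q₁ p * α₃) • A.a 3 p

/-- The L-Gauss map of `F`: the position vector of a middle frame field defined near the point.
When `F` is nondegenerate, such frame fields exist near every point and their position vectors
agree, so that the choice is no choice. -/
noncomputable def lGaussMap (p : M) : Mink :=
  Classical.epsilon fun y : Mink =>
    ∃ (U : Set M) (A : FrameField M), IsOpen U ∧ p ∈ U ∧ F.IsMiddleFrameOn U A ∧ A.x p = y

/-- `F` is L-isothermic when near every point there are smooth local coordinates that diagonalize
simultaneously `⟨da₀, da₀⟩` and `⟨da₀, da₁⟩`, for a middle frame field `(a₀; a₁, …, a₄)`, and are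
isothermal with respect to `⟨da₀, da₀⟩`. -/
def IsLIsothermic : Prop :=
  ∀ p : M, ∃ e ∈ IsManifold.maximalAtlas (𝓡 2) ∞ M, p ∈ e.source ∧
    ∃ A : FrameField M, F.IsMiddleFrameOn e.source A ∧
      ∀ z ∈ e.target,
        minkCoeff (A.x ∘ e.symm) (A.x ∘ e.symm) 0 0 z
          = minkCoeff (A.x ∘ e.symm) (A.x ∘ e.symm) 1 1 z ∧
        minkCoeff (A.x ∘ e.symm) (A.x ∘ e.symm) 0 1 z = 0 ∧
        minkCoeff (A.x ∘ e.symm) (A.a 0 ∘ e.symm) 0 1 z = 0 ∧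
        minkCoeff (A.x ∘ e.symm) (A.a 0 ∘ e.symm) 1 0 z = 0

/-- `G` is a smooth variation of `F` through Legendre immersions, for parameters in `(-ε, ε)`,
which leaves `F` unchanged outside `K`. -/
structure IsVariation (K : Set M) (ε : ℝ) (G : ℝ → LegendreImmersion M) : Prop where
  eps_pos : 0 < ε
  smooth_f : ContMDiffOn (𝓘(ℝ, ℝ).prod (𝓡 2)) 𝓘(ℝ, E3) ∞
    (fun x : ℝ × M => (G x.1).f x.2) (Ioo (-ε) ε ×ˢ univ)
  smooth_n : ContMDiffOn (𝓘(ℝ, ℝ).prod (𝓡 2)) 𝓘(ℝ, E3) ∞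
    (fun x : ℝ × M => (G x.1).n x.2) (Ioo (-ε) ε ×ˢ univ)
  zero : G 0 = F
  outside : ∀ t ∈ Ioo (-ε) ε, ∀ p ∉ K, (G t).f p = F.f p ∧ (G t).n p = F.n p

/-- `F` is L-minimal when it is an extremal of the Weingarten functional: the functional is
stationary along all variations of `F` through Legendre immersions that are supported in
a compact subset of a coordinate domain. -/
def IsLMinimal : Prop :=
  ∀ e ∈ IsManifold.maximalAtlas (𝓡 2) ∞ M, ∀ K : Set M, IsCompact K → K ⊆ e.source →
    ∀ (ε : ℝ) (G : ℝ → LegendreImmersion M), F.IsVariation K ε G →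
      HasDerivAt
        (fun t : ℝ => ∫ z in e '' K,
          weingartenDensity ((G t).f ∘ e.symm) ((G t).n ∘ e.symm) z) 0 0

end LegendreImmersion

/-- `σ` is a smooth spacelike immersion. -/
def IsSpacelikeImmersion (σ : M → Mink) : Prop :=
  ContMDiff (𝓡 2) 𝓘(ℝ, Mink) ∞ σ ∧
  ∀ (p : M) (X : TangentSpace (𝓡 2) p), X ≠ 0 →
    0 < mink (mfderiv (𝓡 2) 𝓘(ℝ, Mink) σ p X) (mfderiv (𝓡 2) 𝓘(ℝ, Mink) σ p X)

/-- `σ` is a spacelike immersion into the hyperplane `P` with zero mean curvature in `P`.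

The second fundamental form of `σ` as a surface in the affine 3-space `P` is the second derivative
of `σ`, which takes values in the direction of `P`, modulo the tangent plane of `σ`; the mean
curvature vanishes when its trace with respect to the induced metric `g` does. If `P` is
not degenerate, the quotient is the normal line of `σ` in `P` and this is the usual
notion; the quotient makes sense in an isotropic `P` as well. The trace is written in local
coordinates, multiplied by `det g`. -/
structure HasZeroMeanCurvatureIn (P : Set Mink) (σ : M → Mink) : Prop where
  mem : ∀ p, σ p ∈ P
  spacelike : IsSpacelikeImmersion σ
  trace_eq_zero : ∀ e ∈ IsManifold.maximalAtlas (𝓡 2) ∞ M, ∀ z ∈ e.target,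
    let s : E2 → Mink := σ ∘ e.symm
    minkCoeff s s 1 1 z • pd 0 (pd 0 s) z - (2 * minkCoeff s s 0 1 z) • pd 0 (pd 1 s) z
        + minkCoeff s s 0 0 z • pd 1 (pd 1 s) z
      ∈ Submodule.span ℝ {pd 0 s z, pd 1 s z}

end Surface

end Laguerre

/-! The proof works with one real function. Near each point of `M` a stereographic coordinate
`z = x + i y` of the normal vector is a coordinate of the surface (`exists_isStereoChart`), because
`dn · dn > 0`. The isotropic directions are then the points of a null paraboloid
`N = c₀ + x c₁ + y c₂ + |z|² c₃`, and the Legendre immersion is determined by its support function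
`s = ⟨f, N⟩` (`support`), where `f` stands for the point sphere. Write `a = s_xx - s_yy` and
`b = 2 s_xy`, so that `a - i b = 4 ∂_z² s`; nondegeneracy says that `a - i b` has no zeros
(`hess_ne_zero`).

*The L-Gauss map.* Every middle frame has the position vector `Σ = middlePos c s`, the point of the
isotropic line with `⟨Σ, c₃⟩ = Δs / 4` (`eq_middlePos_of_isMiddleFrameOn`), and a square root of
`a + i b` gives a middle frame over `Σ` (`exists_isMiddleFrameOn`). Hence `σ_F = Σ`
(`lGaussMap_eq`). The map `Σ` is conformal in `z`, with metric `(a² + b²) / 8`.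

*L-minimality.* The Weingarten density is `(a² + b²) / 8` (`weingartenDensity_eq`). The variations
that fix the normal vector change `s` by an arbitrary function of compact support, so `s` is
biharmonic for an L-minimal immersion (`biharmonic_support`).

*From L-isothermic to a hyperplane.* Let `w` be one of two L-isothermic coordinates. They are
conformal for `Σ`, so `w` is harmonic in `z`, and since they diagonalize `⟨da₀, da₁⟩`,
`a - i b = l (2 ∂_z w)²` with `l` real. As `∂_z w` is holomorphic, biharmonicity of `s` gives
`∂_z̄² l = 0`. Therefore `l = ⟨N, v⟩` for the constant vector `v = middlePos c l`, and `⟨dΣ, v⟩ = 0`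
follows (`exists_orthogonal_of_harmonic`, `exists_orthogonal_of_isothermic`). A vector orthogonal to
`dΣ` on an open set is determined by its product with `N` at one point
(`eq_zero_of_orthogonal_middlePos`), so it is unique up to a factor and continues over the connected
surface (`exists_hyperplane_of_isLIsothermic`).

*From a hyperplane to L-isothermic.* If `⟨dΣ, v⟩ = 0` with `v ≠ 0`, then `⟨N, v⟩` has no zeros and
`(a - i b) / ⟨N, v⟩` is holomorphic. A primitive of its square root is an L-isothermic coordinate
(`exists_holomorphic_root`, `exists_holomorphic_primitive`, `isLIsothermic_of_hyperplane`).

*Mean curvature.* `ΔΣ` is a multiple of `(Δ² s) N` (`laplacian_middlePos`), so for an L-minimal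
immersion `Σ` is conformal and harmonic in `z`, and its mean curvature in the hyperplane vanishes.
In other coordinates the trace of the second derivative acquires only tangential terms
(`trace_comp_mem_span`).
-/

namespace Laguerre

/-! ### The Lorentzian product -/

lemma mink_comm (v w : Mink) : mink v w = mink w v := by simp only [mink]; ring

lemma mink_add_left (u v w : Mink) : mink (u + v) w = mink u w + mink v w := by
  simp only [mink, Pi.add_apply]; ring

lemma mink_add_right (u v w : Mink) : mink u (v + w) = mink u v + mink u w := by
  simp only [mink, Pi.add_apply]; ring

lemma mink_sub_left (u v w : Mink) : mink (u - v) w = mink u w - mink v w := by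
  simp only [mink, Pi.sub_apply]; ring

lemma mink_sub_right (u v w : Mink) : mink u (v - w) = mink u v - mink u w := by
  simp only [mink, Pi.sub_apply]; ring

lemma mink_neg_left (v w : Mink) : mink (-v) w = -mink v w := by
  simp only [mink, Pi.neg_apply]; ring

lemma mink_neg_right (v w : Mink) : mink v (-w) = -mink v w := by
  simp only [mink, Pi.neg_apply]; ring

lemma mink_smul_left (t : ℝ) (v w : Mink) : mink (t • v) w = t * mink v w := by
  simp only [mink, Pi.smul_apply, smul_eq_mul]; ring

lemma mink_smul_right (t : ℝ) (v w : Mink) : mink v (t • w) = t * mink v w := by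
  simp only [mink, Pi.smul_apply, smul_eq_mul]; ring

lemma mink_zero_left (w : Mink) : mink 0 w = 0 := by simp [mink]

lemma mink_zero_right (w : Mink) : mink w 0 = 0 := by simp [mink]

/-- A null vector that has a negative product with a vector of the positive light cone lies in the
positive light cone. -/
lemma mem_posCone_of_mink_neg {v w : Mink} (hw : w ∈ posCone) (hv : mink v v = 0)
    (h : mink v w < 0) : v ∈ posCone := by
  obtain ⟨hw0, hw1⟩ := hw
  refine ⟨hv, ?_⟩
  simp only [mink, Matrix.cons_val] at *
  by_contra hcon
  have hs : v 0 + v 3 ≤ 0 := by linarith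
  have hs' : 0 < w 0 + w 3 := by linarith
  have e1 : 0 ≤ v 0 * v 3 := by nlinarith [sq_nonneg (v 1), sq_nonneg (v 2)]
  have e2 : 0 ≤ w 0 * w 3 := by nlinarith [sq_nonneg (w 1), sq_nonneg (w 2)]
  have v0 : v 0 ≤ 0 := by nlinarith
  have v3 : v 3 ≤ 0 := by nlinarith
  have w0 : 0 ≤ w 0 := by nlinarith
  have w3 : 0 ≤ w 3 := by nlinarith
  have k1 : 0 ≤ -(v 0 * w 3 + v 3 * w 0) := by nlinarith
  have k2 : (v 1 * w 1 + v 2 * w 2) ^ 2 ≤ (-(v 0 * w 3 + v 3 * w 0)) ^ 2 := by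
    have a1 : v 1 ^ 2 + v 2 ^ 2 = 2 * (v 0 * v 3) := by linarith
    have a2 : w 1 ^ 2 + w 2 ^ 2 = 2 * (w 0 * w 3) := by linarith
    have a3 : (v 1 * w 1 + v 2 * w 2) ^ 2 ≤ (v 1 ^ 2 + v 2 ^ 2) * (w 1 ^ 2 + w 2 ^ 2) := by
      nlinarith [sq_nonneg (v 1 * w 2 - v 2 * w 1)]
    rw [a1, a2] at a3
    nlinarith [sq_nonneg (v 0 * w 3 - v 3 * w 0)]
  have := neg_le_of_abs_le (abs_le_of_sq_le_sq k2 k1)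
  linarith

/-! ### Calculus in the coordinate plane -/

section Calculus

variable {V : Type*} [NormedAddCommGroup V] [NormedSpace ℝ V]

lemma fderiv_eq_pd (u : E2 → V) (z ξ : E2) :
    fderiv ℝ u z ξ = ξ 0 • pd 0 u z + ξ 1 • pd 1 u z := by
  have h : ξ = ξ 0 • EuclideanSpace.single (0 : Fin 2) (1 : ℝ)
      + ξ 1 • EuclideanSpace.single (1 : Fin 2) (1 : ℝ) := by
    ext i; fin_cases i <;> simp
  conv_lhs => rw [h]
  simp only [map_add, map_smul, pd]

lemma pd_eq_of_hasFDerivAt {u : E2 → V} {u' : E2 →L[ℝ] V} {z : E2} (h : HasFDerivAt u u' z)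
    (i : Fin 2) : pd i u z = u' (EuclideanSpace.single i 1) := by
  rw [pd, h.fderiv]

lemma pd_congr {u w : E2 → V} {z : E2} (h : u =ᶠ[𝓝 z] w) (i : Fin 2) : pd i u z = pd i w z := by
  rw [pd, pd, h.fderiv_eq]

lemma pd_congr_on {Ω : Set E2} (hΩ : IsOpen Ω) {u w : E2 → V} (h : EqOn u w Ω) {z : E2}
    (hz : z ∈ Ω) (i : Fin 2) : pd i u z = pd i w z :=
  pd_congr (h.eventuallyEq_of_mem (hΩ.mem_nhds hz)) i

lemma pd_const (v : V) (i : Fin 2) (z : E2) : pd i (fun _ => v) z = 0 := by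
  simp [pd]

lemma pd_add {u w : E2 → V} {z : E2} (hu : DifferentiableAt ℝ u z) (hw : DifferentiableAt ℝ w z)
    (i : Fin 2) : pd i (fun y => u y + w y) z = pd i u z + pd i w z := by
  rw [pd_eq_of_hasFDerivAt (hu.hasFDerivAt.fun_add hw.hasFDerivAt)]; rfl

lemma pd_sub {u w : E2 → V} {z : E2} (hu : DifferentiableAt ℝ u z) (hw : DifferentiableAt ℝ w z)
    (i : Fin 2) : pd i (fun y => u y - w y) z = pd i u z - pd i w z := by
  rw [pd_eq_of_hasFDerivAt (hu.hasFDerivAt.fun_sub hw.hasFDerivAt)]; rfl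

lemma pd_neg (u : E2 → V) (z : E2) (i : Fin 2) : pd i (fun y => -u y) z = -pd i u z := by
  simp [pd, fderiv_fun_neg]

lemma pd_smul {t : E2 → ℝ} {u : E2 → V} {z : E2} (ht : DifferentiableAt ℝ t z)
    (hu : DifferentiableAt ℝ u z) (i : Fin 2) :
    pd i (fun y => t y • u y) z = pd i t z • u z + t z • pd i u z := by
  rw [pd_eq_of_hasFDerivAt (ht.hasFDerivAt.fun_smul hu.hasFDerivAt)]
  simp [pd, add_comm]

lemma pd_mul {A : Type*} [NormedCommRing A] [NormedAlgebra ℝ A] {t u : E2 → A} {z : E2}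
    (ht : DifferentiableAt ℝ t z)
    (hu : DifferentiableAt ℝ u z) (i : Fin 2) :
    pd i (fun y => t y * u y) z = pd i t z * u z + t z * pd i u z := by
  rw [pd_eq_of_hasFDerivAt (ht.hasFDerivAt.fun_mul hu.hasFDerivAt)]
  simp [pd]; ring

lemma pd_const_mul {u : E2 → ℝ} {z : E2} (hu : DifferentiableAt ℝ u z) (k : ℝ) (i : Fin 2) :
    pd i (fun y => k * u y) z = k * pd i u z := by
  rw [pd_mul (by fun_prop) hu, pd_const]; ring

lemma pd_div_const {u : E2 → ℝ} {z : E2} (hu : DifferentiableAt ℝ u z) (k : ℝ) (i : Fin 2) :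
    pd i (fun y => u y / k) z = pd i u z / k := by
  simp only [div_eq_inv_mul]
  exact pd_const_mul hu _ i

lemma differentiableAt_coord (i : Fin 2) (z : E2) : DifferentiableAt ℝ (fun y : E2 => y i) z :=
  (EuclideanSpace.proj i : E2 →L[ℝ] ℝ).differentiableAt

lemma pd_coord (i j : Fin 2) (z : E2) : pd i (fun y : E2 => y j) z = if j = i then 1 else 0 := by
  have h : HasFDerivAt (fun y : E2 => y j) (EuclideanSpace.proj j : E2 →L[ℝ] ℝ) z :=
    (EuclideanSpace.proj j : E2 →L[ℝ] ℝ).hasFDerivAt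
  rw [pd_eq_of_hasFDerivAt h]
  simp

lemma pd_clm {W : Type*} [NormedAddCommGroup W] [NormedSpace ℝ W] (T : V →L[ℝ] W) {u : E2 → V}
    {z : E2} (hu : DifferentiableAt ℝ u z) (i : Fin 2) :
    pd i (fun y => T (u y)) z = T (pd i u z) := by
  rw [pd_eq_of_hasFDerivAt (u := fun y => T (u y)) (T.hasFDerivAt.comp z hu.hasFDerivAt)]; rfl

lemma pd_comp {W : E2 → E2} {u : E2 → V} {z : E2} (hu : DifferentiableAt ℝ u (W z))
    (hW : DifferentiableAt ℝ W z) (i : Fin 2) :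
    pd i (u ∘ W) z = (pd i W z) 0 • pd 0 u (W z) + (pd i W z) 1 • pd 1 u (W z) := by
  rw [pd_eq_of_hasFDerivAt (hu.hasFDerivAt.comp z hW.hasFDerivAt), ← fderiv_eq_pd]; rfl

lemma contDiffOn_pd {Ω : Set E2} (hΩ : IsOpen Ω) {u : E2 → V} (hu : ContDiffOn ℝ ∞ u Ω)
    (i : Fin 2) : ContDiffOn ℝ ∞ (pd i u) Ω := by
  have h := hu.fderiv_of_isOpen hΩ (m := ∞) (by simp)
  exact h.clm_apply contDiffOn_const

lemma pd_comm {Ω : Set E2} (hΩ : IsOpen Ω) {u : E2 → V} (hu : ContDiffOn ℝ ∞ u Ω) {z : E2}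
    (hz : z ∈ Ω) (i j : Fin 2) : pd i (pd j u) z = pd j (pd i u) z := by
  have hu' : ContDiffAt ℝ ∞ u z := hu.contDiffAt (hΩ.mem_nhds hz)
  have hd : DifferentiableAt ℝ (fderiv ℝ u) z :=
    (hu'.fderiv_right (m := 1) (by norm_cast)).differentiableAt (by simp)
  have key : ∀ a b : Fin 2, pd a (pd b u) z =
      fderiv ℝ (fderiv ℝ u) z (EuclideanSpace.single a 1) (EuclideanSpace.single b 1) := by
    intro a b
    have h := hd.hasFDerivAt.clm_apply
      (hasFDerivAt_const (EuclideanSpace.single b (1 : ℝ) : E2) z)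
    rw [pd_eq_of_hasFDerivAt (u := pd b u) h]
    simp
  rw [key, key]
  exact (hu'.isSymmSndFDerivAt (by simp; norm_cast)).eq _ _

lemma _root_.ContDiffOn.diffAt {Ω : Set E2} {u : E2 → V} (hu : ContDiffOn ℝ ∞ u Ω)
    (hΩ : IsOpen Ω) {z : E2} (hz : z ∈ Ω) : DifferentiableAt ℝ u z :=
  (hu.contDiffAt (hΩ.mem_nhds hz)).differentiableAt (by simp)

end Calculus

/-- `mink` as a continuous bilinear map. -/
noncomputable def minkL : Mink →L[ℝ] Mink →L[ℝ] ℝ :=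
  LinearMap.toContinuousLinearMap
    ((LinearMap.toContinuousLinearMap : (Mink →ₗ[ℝ] ℝ) ≃ₗ[ℝ] (Mink →L[ℝ] ℝ)).toLinearMap ∘ₗ
      LinearMap.mk₂ ℝ mink mink_add_left mink_smul_left mink_add_right mink_smul_right)

lemma minkL_apply (v w : Mink) : minkL v w = mink v w := rfl

lemma pd_mink {u w : E2 → Mink} {z : E2} (hu : DifferentiableAt ℝ u z)
    (hw : DifferentiableAt ℝ w z) (i : Fin 2) :
    pd i (fun y => mink (u y) (w y)) z = mink (pd i u z) (w z) + mink (u z) (pd i w z) := by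
  have h := (minkL.hasFDerivAt.comp z hu.hasFDerivAt).clm_apply hw.hasFDerivAt
  have h' : HasFDerivAt (fun y => mink (u y) (w y)) _ z := h
  rw [pd_eq_of_hasFDerivAt h']
  simp [pd, minkL_apply, add_comm]

lemma _root_.ContDiffOn.mink {Ω : Set E2} {u w : E2 → Mink} (hu : ContDiffOn ℝ ∞ u Ω)
    (hw : ContDiffOn ℝ ∞ w Ω) : ContDiffOn ℝ ∞ (fun y => Laguerre.mink (u y) (w y)) Ω :=
  (minkL.contDiff.comp_contDiffOn hu).clm_apply hw

/-! ### Null bases and the paraboloid of isotropic directions -/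

/-- A positively oriented basis `c₀, c₁, c₂, c₃` of Minkowski space in which `c₀, c₃` are null
vectors of the positive light cone with `⟨c₀, c₃⟩ = -1`, and `c₁, c₂` are orthogonal spacelike
vectors of square `2` orthogonal to `c₀, c₃`. -/
structure IsNullBasis (c : Fin 4 → Mink) : Prop where
  c00 : mink (c 0) (c 0) = 0
  c01 : mink (c 0) (c 1) = 0
  c02 : mink (c 0) (c 2) = 0
  c03 : mink (c 0) (c 3) = -1
  c11 : mink (c 1) (c 1) = 2
  c12 : mink (c 1) (c 2) = 0
  c13 : mink (c 1) (c 3) = 0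
  c22 : mink (c 2) (c 2) = 2
  c23 : mink (c 2) (c 3) = 0
  c33 : mink (c 3) (c 3) = 0
  time : ∀ i, mink (c i) ![1, 0, 0, 1] = ![-1, 0, 0, -1] i
  expand : ∀ v, v = -mink v (c 3) • c 0 + (mink v (c 1) / 2) • c 1 + (mink v (c 2) / 2) • c 2
    - mink v (c 0) • c 3
  det_eq : (Matrix.of fun i j => c i j).det = 2

/-- The null vector `c₀ + x c₁ + y c₂ + (x² + y²) c₃`. -/
noncomputable def nulPt (c : Fin 4 → Mink) (z : E2) : Mink :=
  c 0 + z 0 • c 1 + z 1 • c 2 + (z 0 ^ 2 + z 1 ^ 2) • c 3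

/-- The derivative of `nulPt` in the first coordinate. -/
noncomputable def nulX (c : Fin 4 → Mink) (z : E2) : Mink := c 1 + (2 * z 0) • c 3

/-- The derivative of `nulPt` in the second coordinate. -/
noncomputable def nulY (c : Fin 4 → Mink) (z : E2) : Mink := c 2 + (2 * z 1) • c 3

namespace IsNullBasis

variable {c : Fin 4 → Mink} (hc : IsNullBasis c)

include hc

lemma mink_combination (a₀ a₁ a₂ a₃ b₀ b₁ b₂ b₃ : ℝ) :
    mink (a₀ • c 0 + a₁ • c 1 + a₂ • c 2 + a₃ • c 3) (b₀ • c 0 + b₁ • c 1 + b₂ • c 2 + b₃ • c 3)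
      = -(a₀ * b₃ + a₃ * b₀) + 2 * (a₁ * b₁) + 2 * (a₂ * b₂) := by
  simp only [mink_add_left, mink_add_right, mink_smul_left, mink_smul_right,
    hc.c00, hc.c01, hc.c02, hc.c03, hc.c11, hc.c12, hc.c13, hc.c22, hc.c23, hc.c33,
    mink_comm (c 1) (c 0), mink_comm (c 2) (c 0), mink_comm (c 3) (c 0), mink_comm (c 2) (c 1),
    mink_comm (c 3) (c 1), mink_comm (c 3) (c 2)]
  ring

/-- The determinant of four vectors given by their coefficients in a null basis. -/
lemma det_combination (A : Matrix (Fin 4) (Fin 4) ℝ) :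
    (Matrix.of fun i j => (∑ k, A i k • c k) j).det = 2 * A.det := by
  have h : (Matrix.of fun i j => (∑ k, A i k • c k) j) = A * (Matrix.of fun i j => c i j) := by
    ext i j
    simp [Matrix.mul_apply]
  rw [h, Matrix.det_mul, hc.det_eq, mul_comm]

/-- The expansion of a vector in the point of the null paraboloid, its two derivatives and `c₃`,
which have the same Gram matrix as the null basis itself. -/
lemma expand_moved (v : Mink) (z : E2) :
    v = -mink v (c 3) • nulPt c z + (mink v (nulX c z) / 2) • nulX c z
      + (mink v (nulY c z) / 2) • nulY c z - mink v (nulPt c z) • c 3 := by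
  have h := hc.expand v
  simp only [nulPt, nulX, nulY, mink_add_right, mink_smul_right]
  refine h.trans ?_
  module

variable (z : E2)

set_option linter.unusedSimpArgs false

lemma mink_pp : mink (nulPt c z) (nulPt c z) = 0 := by
  have h := hc.mink_combination 1 (z 0) (z 1) (z 0 ^ 2 + z 1 ^ 2)
    1 (z 0) (z 1) (z 0 ^ 2 + z 1 ^ 2)
  simp only [zero_smul, one_smul, zero_add, add_zero] at h
  simp only [nulPt]
  linear_combination h

lemma mink_px : mink (nulPt c z) (nulX c z) = 0 := by
  have h := hc.mink_combination 1 (z 0) (z 1) (z 0 ^ 2 + z 1 ^ 2)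
    0 1 0 (2 * z 0)
  simp only [zero_smul, one_smul, zero_add, add_zero] at h
  simp only [nulPt, nulX]
  linear_combination h

lemma mink_py : mink (nulPt c z) (nulY c z) = 0 := by
  have h := hc.mink_combination 1 (z 0) (z 1) (z 0 ^ 2 + z 1 ^ 2)
    0 0 1 (2 * z 1)
  simp only [zero_smul, one_smul, zero_add, add_zero] at h
  simp only [nulPt, nulY]
  linear_combination h

lemma mink_pz : mink (nulPt c z) (c 3) = -1 := by
  have h := hc.mink_combination 1 (z 0) (z 1) (z 0 ^ 2 + z 1 ^ 2)
    0 0 0 1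
  simp only [zero_smul, one_smul, zero_add, add_zero] at h
  rw [nulPt, h]; ring

lemma mink_xp : mink (nulX c z) (nulPt c z) = 0 :=
  (mink_comm _ _).trans (hc.mink_px z)

lemma mink_xx : mink (nulX c z) (nulX c z) = 2 := by
  have h := hc.mink_combination 0 1 0 (2 * z 0)
    0 1 0 (2 * z 0)
  simp only [zero_smul, one_smul, zero_add, add_zero] at h
  simp only [nulX]
  linear_combination h

lemma mink_xy : mink (nulX c z) (nulY c z) = 0 := by
  have h := hc.mink_combination 0 1 0 (2 * z 0)
    0 0 1 (2 * z 1)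
  simp only [zero_smul, one_smul, zero_add, add_zero] at h
  simp only [nulX, nulY]
  linear_combination h

lemma mink_xz : mink (nulX c z) (c 3) = 0 := by
  have h := hc.mink_combination 0 1 0 (2 * z 0)
    0 0 0 1
  simp only [zero_smul, one_smul, zero_add, add_zero] at h
  rw [nulX, h]; ring

lemma mink_yp : mink (nulY c z) (nulPt c z) = 0 :=
  (mink_comm _ _).trans (hc.mink_py z)

lemma mink_yx : mink (nulY c z) (nulX c z) = 0 :=
  (mink_comm _ _).trans (hc.mink_xy z)

lemma mink_yy : mink (nulY c z) (nulY c z) = 2 := by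
  have h := hc.mink_combination 0 0 1 (2 * z 1)
    0 0 1 (2 * z 1)
  simp only [zero_smul, one_smul, zero_add, add_zero] at h
  simp only [nulY]
  linear_combination h

lemma mink_yz : mink (nulY c z) (c 3) = 0 := by
  have h := hc.mink_combination 0 0 1 (2 * z 1)
    0 0 0 1
  simp only [zero_smul, one_smul, zero_add, add_zero] at h
  rw [nulY, h]; ring

lemma mink_zp : mink (c 3) (nulPt c z) = -1 :=
  (mink_comm _ _).trans (hc.mink_pz z)

lemma mink_zx : mink (c 3) (nulX c z) = 0 :=
  (mink_comm _ _).trans (hc.mink_xz z)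

lemma mink_zy : mink (c 3) (nulY c z) = 0 :=
  (mink_comm _ _).trans (hc.mink_yz z)

end IsNullBasis

/-! ### The middle position determined by a support function -/

lemma contDiff_coord (i : Fin 2) : ContDiff ℝ ∞ (fun z : E2 => z i) :=
  (EuclideanSpace.proj i : E2 →L[ℝ] ℝ).contDiff

lemma contDiff_nulPt (c : Fin 4 → Mink) : ContDiff ℝ ∞ (nulPt c) := by
  have h0 := contDiff_coord 0
  have h1 := contDiff_coord 1
  unfold nulPt
  fun_prop

lemma contDiff_nulX (c : Fin 4 → Mink) : ContDiff ℝ ∞ (nulX c) := by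
  have h0 := contDiff_coord 0
  unfold nulX
  fun_prop

lemma contDiff_nulY (c : Fin 4 → Mink) : ContDiff ℝ ∞ (nulY c) := by
  have h1 := contDiff_coord 1
  unfold nulY
  fun_prop

lemma differentiableAt_nulPt (c : Fin 4 → Mink) (z : E2) : DifferentiableAt ℝ (nulPt c) z :=
  (contDiff_nulPt c).differentiable (by simp) z

lemma differentiableAt_nulX (c : Fin 4 → Mink) (z : E2) : DifferentiableAt ℝ (nulX c) z :=
  (contDiff_nulX c).differentiable (by simp) z

lemma differentiableAt_nulY (c : Fin 4 → Mink) (z : E2) : DifferentiableAt ℝ (nulY c) z :=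
  (contDiff_nulY c).differentiable (by simp) z

lemma pd_nulX (c : Fin 4 → Mink) (i : Fin 2) (z : E2) :
    pd i (nulX c) z = (if i = 0 then 2 else 0 : ℝ) • c 3 := by
  have h0 := differentiableAt_coord 0 z
  unfold nulX
  rw [pd_add (by fun_prop) (by fun_prop), pd_smul (by fun_prop) (by fun_prop), pd_const, pd_const,
    pd_const_mul h0, pd_coord]
  fin_cases i <;> simp

lemma pd_nulY (c : Fin 4 → Mink) (i : Fin 2) (z : E2) :
    pd i (nulY c) z = (if i = 1 then 2 else 0 : ℝ) • c 3 := by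
  have h0 := differentiableAt_coord 1 z
  unfold nulY
  rw [pd_add (by fun_prop) (by fun_prop), pd_smul (by fun_prop) (by fun_prop), pd_const, pd_const,
    pd_const_mul h0, pd_coord]
  fin_cases i <;> simp

lemma pd_nulPt (c : Fin 4 → Mink) (i : Fin 2) (z : E2) :
    pd i (nulPt c) z = if i = 0 then nulX c z else nulY c z := by
  have h0 := differentiableAt_coord 0 z
  have h1 := differentiableAt_coord 1 z
  unfold nulPt
  simp only [pow_two]
  rw [pd_add (by fun_prop) (by fun_prop), pd_add (by fun_prop) (by fun_prop),
    pd_add (by fun_prop) (by fun_prop), pd_smul (by fun_prop) (by fun_prop),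
    pd_smul (by fun_prop) (by fun_prop), pd_smul (by fun_prop) (by fun_prop), pd_const, pd_const,
    pd_const, pd_const, pd_add (by fun_prop) (by fun_prop), pd_mul h0 h0, pd_mul h1 h1,
    pd_coord, pd_coord]
  fin_cases i <;> simp [nulX, nulY] <;> module

lemma pd_zero_nulPt (c : Fin 4 → Mink) (z : E2) : pd 0 (nulPt c) z = nulX c z := by
  simp [pd_nulPt]

lemma pd_one_nulPt (c : Fin 4 → Mink) (z : E2) : pd 1 (nulPt c) z = nulY c z := by
  simp [pd_nulPt]

lemma pd_zero_nulX (c : Fin 4 → Mink) (z : E2) : pd 0 (nulX c) z = (2 : ℝ) • c 3 := by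
  simp [pd_nulX]

lemma pd_one_nulX (c : Fin 4 → Mink) (z : E2) : pd 1 (nulX c) z = 0 := by
  simp [pd_nulX]

lemma pd_zero_nulY (c : Fin 4 → Mink) (z : E2) : pd 0 (nulY c) z = 0 := by
  simp [pd_nulY]

lemma pd_one_nulY (c : Fin 4 → Mink) (z : E2) : pd 1 (nulY c) z = (2 : ℝ) • c 3 := by
  simp [pd_nulY]

/-- `s_xx - s_yy`, the real part of `4 ∂_z² s`. -/
noncomputable def hessDiff (s : E2 → ℝ) (z : E2) : ℝ := pd 0 (pd 0 s) z - pd 1 (pd 1 s) z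

/-- `2 s_xy`, minus the imaginary part of `4 ∂_z² s`. -/
noncomputable def hessMix (s : E2 → ℝ) (z : E2) : ℝ := 2 * pd 0 (pd 1 s) z

/-- A quarter of the Laplacian. -/
noncomputable def quarterLap (s : E2 → ℝ) (z : E2) : ℝ := (pd 0 (pd 0 s) z + pd 1 (pd 1 s) z) / 4

/-- The point `Σ` with `⟨Σ, N⟩ = s`, `⟨Σ, N_x⟩ = s_x`, `⟨Σ, N_y⟩ = s_y`, `⟨Σ, c₃⟩ = Δs / 4`, where
`N` is the point of the null paraboloid. When `s` is the support function of a Legendre immersion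
in a stereographic coordinate, this is the centre and radius of the middle sphere. -/
noncomputable def middlePos (c : Fin 4 → Mink) (s : E2 → ℝ) (z : E2) : Mink :=
  -quarterLap s z • nulPt c z + (pd 0 s z / 2) • nulX c z + (pd 1 s z / 2) • nulY c z - s z • c 3

section

variable {Ω : Set E2} (hΩ : IsOpen Ω) {s : E2 → ℝ} (hs : ContDiffOn ℝ ∞ s Ω)

include hΩ hs

lemma contDiffOn_hessDiff : ContDiffOn ℝ ∞ (hessDiff s) Ω :=
  (contDiffOn_pd hΩ (contDiffOn_pd hΩ hs 0) 0).sub (contDiffOn_pd hΩ (contDiffOn_pd hΩ hs 1) 1)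

lemma contDiffOn_hessMix : ContDiffOn ℝ ∞ (hessMix s) Ω :=
  contDiffOn_const.mul (contDiffOn_pd hΩ (contDiffOn_pd hΩ hs 1) 0)

lemma contDiffOn_quarterLap : ContDiffOn ℝ ∞ (quarterLap s) Ω :=
  ((contDiffOn_pd hΩ (contDiffOn_pd hΩ hs 0) 0).add
    (contDiffOn_pd hΩ (contDiffOn_pd hΩ hs 1) 1)).div_const 4

lemma contDiffOn_middlePos (c : Fin 4 → Mink) : ContDiffOn ℝ ∞ (middlePos c s) Ω := by
  have h0 := contDiffOn_pd hΩ hs 0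
  have h1 := contDiffOn_pd hΩ hs 1
  exact (((contDiffOn_quarterLap hΩ hs).neg.smul (contDiff_nulPt c).contDiffOn).add
    ((h0.div_const 2).smul (contDiff_nulX c).contDiffOn)).add
    ((h1.div_const 2).smul (contDiff_nulY c).contDiffOn) |>.sub (hs.smul contDiffOn_const)

variable {z : E2} (hz : z ∈ Ω)

include hz

lemma pd_hessDiff (i : Fin 2) :
    pd i (hessDiff s) z = pd i (pd 0 (pd 0 s)) z - pd i (pd 1 (pd 1 s)) z :=
  pd_sub ((contDiffOn_pd hΩ (contDiffOn_pd hΩ hs 0) 0).diffAt hΩ hz)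
    ((contDiffOn_pd hΩ (contDiffOn_pd hΩ hs 1) 1).diffAt hΩ hz) i

lemma pd_hessMix (i : Fin 2) : pd i (hessMix s) z = 2 * pd i (pd 0 (pd 1 s)) z :=
  pd_const_mul ((contDiffOn_pd hΩ (contDiffOn_pd hΩ hs 1) 0).diffAt hΩ hz) 2 i

lemma pd_quarterLap (i : Fin 2) :
    pd i (quarterLap s) z = (pd i (pd 0 (pd 0 s)) z + pd i (pd 1 (pd 1 s)) z) / 4 := by
  have h0 := (contDiffOn_pd hΩ (contDiffOn_pd hΩ hs 0) 0).diffAt hΩ hz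
  have h1 := (contDiffOn_pd hΩ (contDiffOn_pd hΩ hs 1) 1).diffAt hΩ hz
  unfold quarterLap
  rw [pd_div_const (h0.fun_add h1), pd_add h0 h1]

lemma pd_swap (i j : Fin 2) : pd i (pd j s) z = pd j (pd i s) z := pd_comm hΩ hs hz i j

/-- The mixed third derivative does not depend on the order. -/
lemma pd_third_swap (i j k : Fin 2) : pd i (pd j (pd k s)) z = pd i (pd k (pd j s)) z :=
  pd_congr_on hΩ (fun _ hy => pd_comm hΩ hs hy j k) hz i

lemma pd_zero_quarterLap :
    pd 0 (quarterLap s) z = (pd 0 (hessDiff s) z + pd 1 (hessMix s) z) / 4 := by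
  have e : pd 1 (pd 0 (pd 1 s)) z = pd 0 (pd 1 (pd 1 s)) z :=
    pd_comm hΩ (contDiffOn_pd hΩ hs 1) hz 1 0
  rw [pd_quarterLap hΩ hs hz, pd_hessDiff hΩ hs hz, pd_hessMix hΩ hs hz, e]
  ring

lemma pd_one_quarterLap :
    pd 1 (quarterLap s) z = (pd 0 (hessMix s) z - pd 1 (hessDiff s) z) / 4 := by
  have e : pd 0 (pd 0 (pd 1 s)) z = pd 1 (pd 0 (pd 0 s)) z := by
    rw [pd_third_swap hΩ hs hz, pd_comm hΩ (contDiffOn_pd hΩ hs 0) hz 0 1]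
  rw [pd_quarterLap hΩ hs hz, pd_hessDiff hΩ hs hz, pd_hessMix hΩ hs hz, e]
  ring

/-- The biharmonic operator `Δ²` is the sum of the squares of the two components of `4 ∂_z²`. -/
lemma laplacian_quarterLap :
    pd 0 (pd 0 (quarterLap s)) z + pd 1 (pd 1 (quarterLap s)) z
      = (hessDiff (hessDiff s) z + hessMix (hessMix s) z) / 4 := by
  have ha := contDiffOn_hessDiff hΩ hs
  have hb := contDiffOn_hessMix hΩ hs
  have da := fun i => (contDiffOn_pd hΩ ha i).diffAt hΩ hz
  have db := fun i => (contDiffOn_pd hΩ hb i).diffAt hΩ hz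
  have e0 : pd 0 (pd 0 (quarterLap s)) z
      = (pd 0 (pd 0 (hessDiff s)) z + pd 0 (pd 1 (hessMix s)) z) / 4 := by
    rw [pd_congr_on hΩ (fun y hy => pd_zero_quarterLap hΩ hs hy) hz,
      pd_div_const ((da 0).fun_add (db 1)), pd_add (da 0) (db 1)]
  have e1 : pd 1 (pd 1 (quarterLap s)) z
      = (pd 1 (pd 0 (hessMix s)) z - pd 1 (pd 1 (hessDiff s)) z) / 4 := by
    rw [pd_congr_on hΩ (fun y hy => pd_one_quarterLap hΩ hs hy) hz,
      pd_div_const ((db 0).fun_sub (da 1)), pd_sub (db 0) (da 1)]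
  rw [e0, e1, pd_comm hΩ hb hz 1 0]
  simp only [hessDiff, hessMix]
  ring

lemma pd_middlePos (c : Fin 4 → Mink) (i : Fin 2) :
    pd i (middlePos c s) z = -pd i (quarterLap s) z • nulPt c z
      - quarterLap s z • pd i (nulPt c) z + (pd i (pd 0 s) z / 2) • nulX c z
      + (pd 0 s z / 2) • pd i (nulX c) z + (pd i (pd 1 s) z / 2) • nulY c z
      + (pd 1 s z / 2) • pd i (nulY c) z - pd i s z • c 3 := by
  have hD := (contDiffOn_quarterLap hΩ hs).diffAt hΩ hz
  have h0 := (contDiffOn_pd hΩ hs 0).diffAt hΩ hz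
  have h1 := (contDiffOn_pd hΩ hs 1).diffAt hΩ hz
  have hs' := hs.diffAt hΩ hz
  have hN := differentiableAt_nulPt c z
  have hX := differentiableAt_nulX c z
  have hY := differentiableAt_nulY c z
  unfold middlePos
  rw [pd_sub (by fun_prop) (by fun_prop), pd_add (by fun_prop) (by fun_prop),
    pd_add (by fun_prop) (by fun_prop), pd_smul (by fun_prop) hN, pd_smul (by fun_prop) hX,
    pd_smul (by fun_prop) hY, pd_smul hs' (by fun_prop), pd_const, pd_neg, pd_div_const h0,
    pd_div_const h1]
  module

lemma pd_zero_middlePos (c : Fin 4 → Mink) :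
    pd 0 (middlePos c s) z = -pd 0 (quarterLap s) z • nulPt c z
      + (hessDiff s z / 4) • nulX c z + (hessMix s z / 4) • nulY c z := by
  rw [pd_middlePos hΩ hs hz, pd_zero_nulPt, pd_zero_nulX, pd_zero_nulY]
  simp only [hessDiff, hessMix, quarterLap]
  module

lemma pd_one_middlePos (c : Fin 4 → Mink) :
    pd 1 (middlePos c s) z = -pd 1 (quarterLap s) z • nulPt c z
      + (hessMix s z / 4) • nulX c z - (hessDiff s z / 4) • nulY c z := by
  rw [pd_middlePos hΩ hs hz, pd_one_nulPt, pd_one_nulX, pd_one_nulY, pd_swap hΩ hs hz 1 0]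
  simp only [hessDiff, hessMix, quarterLap]
  module

/-- The Laplacian of the middle position is isotropic; it vanishes when `s` is biharmonic. -/
lemma laplacian_middlePos (c : Fin 4 → Mink) :
    pd 0 (pd 0 (middlePos c s)) z + pd 1 (pd 1 (middlePos c s)) z
      = -((hessDiff (hessDiff s) z + hessMix (hessMix s) z) / 4) • nulPt c z := by
  have ha := (contDiffOn_hessDiff hΩ hs).diffAt hΩ hz
  have hb := (contDiffOn_hessMix hΩ hs).diffAt hΩ hz
  have hD := fun i => (contDiffOn_pd hΩ (contDiffOn_quarterLap hΩ hs) i).diffAt hΩ hz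
  have hD0 := hD 0
  have hD1 := hD 1
  have hN := differentiableAt_nulPt c z
  have hX := differentiableAt_nulX c z
  have hY := differentiableAt_nulY c z
  have e0 : pd 0 (pd 0 (middlePos c s)) z = -pd 0 (pd 0 (quarterLap s)) z • nulPt c z
      - pd 0 (quarterLap s) z • nulX c z + (pd 0 (hessDiff s) z / 4) • nulX c z
      + (hessDiff s z / 4) • ((2 : ℝ) • c 3) + (pd 0 (hessMix s) z / 4) • nulY c z := by
    rw [pd_congr_on hΩ (fun y hy => pd_zero_middlePos hΩ hs hy c) hz,
      pd_add (by fun_prop) (by fun_prop), pd_add (by fun_prop) (by fun_prop),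
      pd_smul (by fun_prop) hN, pd_smul (by fun_prop) hX, pd_smul (by fun_prop) hY, pd_neg,
      pd_div_const ha, pd_div_const hb, pd_zero_nulPt, pd_zero_nulX, pd_zero_nulY]
    module
  have e1 : pd 1 (pd 1 (middlePos c s)) z = -pd 1 (pd 1 (quarterLap s)) z • nulPt c z
      - pd 1 (quarterLap s) z • nulY c z + (pd 1 (hessMix s) z / 4) • nulX c z
      - (pd 1 (hessDiff s) z / 4) • nulY c z - (hessDiff s z / 4) • ((2 : ℝ) • c 3) := by
    rw [pd_congr_on hΩ (fun y hy => pd_one_middlePos hΩ hs hy c) hz,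
      pd_sub (by fun_prop) (by fun_prop), pd_add (by fun_prop) (by fun_prop),
      pd_smul (by fun_prop) hN, pd_smul (by fun_prop) hX, pd_smul (by fun_prop) hY, pd_neg,
      pd_div_const ha, pd_div_const hb, pd_one_nulPt, pd_one_nulX, pd_one_nulY]
    module
  rw [← laplacian_quarterLap hΩ hs hz, e0, e1, pd_zero_quarterLap hΩ hs hz,
    pd_one_quarterLap hΩ hs hz]
  module

end

section Pairings

variable {c : Fin 4 → Mink} (hc : IsNullBasis c) (s : E2 → ℝ) (z : E2)

include hc

lemma mink_middlePos_nulPt : mink (middlePos c s z) (nulPt c z) = s z := by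
  simp only [middlePos, mink_add_left, mink_sub_left, mink_smul_left, hc.mink_pp, hc.mink_xp,
    hc.mink_yp, hc.mink_zp]
  ring

lemma mink_middlePos_nulX : mink (middlePos c s z) (nulX c z) = pd 0 s z := by
  simp only [middlePos, mink_add_left, mink_sub_left, mink_smul_left, hc.mink_px, hc.mink_xx,
    hc.mink_yx, hc.mink_zx]
  ring

lemma mink_middlePos_nulY : mink (middlePos c s z) (nulY c z) = pd 1 s z := by
  simp only [middlePos, mink_add_left, mink_sub_left, mink_smul_left, hc.mink_py, hc.mink_xy,
    hc.mink_yy, hc.mink_zy]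
  ring

variable {s z}

lemma eq_middlePos {v : Mink} (h : mink v (nulPt c z) = s z) (h0 : mink v (nulX c z) = pd 0 s z)
    (h1 : mink v (nulY c z) = pd 1 s z) (h3 : mink v (c 3) = quarterLap s z) :
    v = middlePos c s z := by
  rw [hc.expand_moved v z, h, h0, h1, h3, middlePos]

lemma eq_zero_of_pairings {v : Mink} (h : mink v (nulPt c z) = 0) (h0 : mink v (nulX c z) = 0)
    (h1 : mink v (nulY c z) = 0) (h3 : mink v (c 3) = 0) : v = 0 := by
  rw [hc.expand_moved v z, h, h0, h1, h3]
  simp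

end Pairings

/-! ### Charts of a surface -/

section Charts

variable {M : Type*} [TopologicalSpace M] [ChartedSpace E2 M]
  {V : Type*} [NormedAddCommGroup V] [NormedSpace ℝ V]

lemma contDiffOn_chart {e : OpenPartialHomeomorph M E2}
    (he : e ∈ IsManifold.maximalAtlas (𝓡 2) ∞ M) {u : M → V} {U : Set M}
    (hu : ContMDiffOn (𝓡 2) 𝓘(ℝ, V) ∞ u U) :
    ContDiffOn ℝ ∞ (u ∘ e.symm) (e.target ∩ e.symm ⁻¹' U) := by
  rw [← contMDiffOn_iff_contDiffOn]
  exact hu.comp ((contMDiffOn_symm_of_mem_maximalAtlas he).mono inter_subset_left)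
    (fun z hz => hz.2)

lemma contMDiffOn_of_chart {e : OpenPartialHomeomorph M E2}
    (he : e ∈ IsManifold.maximalAtlas (𝓡 2) ∞ M) {u : M → V} {w : E2 → V} {U : Set M} {Ω : Set E2}
    (hw : ContDiffOn ℝ ∞ w Ω) (hU : U ⊆ e.source) (hΩ : MapsTo e U Ω)
    (h : ∀ q ∈ U, u q = w (e q)) :
    ContMDiffOn (𝓡 2) 𝓘(ℝ, V) ∞ u U := by
  have h1 : ContMDiffOn (𝓡 2) 𝓘(ℝ, V) ∞ (w ∘ e) U :=
    (contMDiffOn_iff_contDiffOn.2 hw).comp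
      ((contMDiffOn_of_mem_maximalAtlas he).mono hU) hΩ
  exact h1.congr h

lemma mdifferentiable_of_mem_maximalAtlas {e : OpenPartialHomeomorph M E2}
    (he : e ∈ IsManifold.maximalAtlas (𝓡 2) ∞ M) : e.MDifferentiable (𝓡 2) (𝓡 2) :=
  ⟨(contMDiffOn_of_mem_maximalAtlas he).mdifferentiableOn (by simp),
    (contMDiffOn_symm_of_mem_maximalAtlas he).mdifferentiableOn (by simp)⟩

/-- The differential of a chart, with values in the coordinate plane. -/
noncomputable def chartDeriv (e : OpenPartialHomeomorph M E2) (p : M) (X : TangentSpace (𝓡 2) p) :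
    E2 :=
  mfderiv (𝓡 2) (𝓡 2) e p X

lemma chartDeriv_bijective {e : OpenPartialHomeomorph M E2}
    (he : e ∈ IsManifold.maximalAtlas (𝓡 2) ∞ M) {p : M} (hp : p ∈ e.source) :
    Function.Bijective (chartDeriv e p) :=
  (mdifferentiable_of_mem_maximalAtlas he).mfderiv_bijective hp

lemma chartDeriv_eq_zero_iff {e : OpenPartialHomeomorph M E2}
    (he : e ∈ IsManifold.maximalAtlas (𝓡 2) ∞ M) {p : M} (hp : p ∈ e.source)
    (X : TangentSpace (𝓡 2) p) : chartDeriv e p X = 0 ↔ X = 0 := by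
  have h0 : chartDeriv e p 0 = 0 := map_zero (mfderiv (𝓡 2) (𝓡 2) e p)
  exact ⟨fun h => (chartDeriv_bijective he hp).1 (h.trans h0.symm), fun h => h ▸ h0⟩

lemma mfderiv_eq_fderiv_of_chart {e : OpenPartialHomeomorph M E2}
    (he : e ∈ IsManifold.maximalAtlas (𝓡 2) ∞ M) {p : M} (hp : p ∈ e.source) {u : M → V}
    {w : E2 → V} (h : u =ᶠ[𝓝 p] w ∘ e) (hw : DifferentiableAt ℝ w (e p))
    (X : TangentSpace (𝓡 2) p) :
    mfderiv (𝓡 2) 𝓘(ℝ, V) u p X = fderiv ℝ w (e p) (chartDeriv e p X) := by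
  have h1 : mfderiv (𝓡 2) 𝓘(ℝ, V) u p = mfderiv (𝓡 2) 𝓘(ℝ, V) (w ∘ e) p := h.mfderiv_eq
  have h2 := mfderiv_comp (I := 𝓡 2) (I' := 𝓡 2) (I'' := 𝓘(ℝ, V)) p hw.mdifferentiableAt
    ((mdifferentiable_of_mem_maximalAtlas he).mdifferentiableAt hp)
  rw [h1, h2, mfderiv_eq_fderiv]
  rfl

lemma mfderiv_eq_fderiv_chart {e : OpenPartialHomeomorph M E2}
    (he : e ∈ IsManifold.maximalAtlas (𝓡 2) ∞ M) {p : M} (hp : p ∈ e.source) {u : M → V}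
    (hu : DifferentiableAt ℝ (u ∘ e.symm) (e p)) (X : TangentSpace (𝓡 2) p) :
    mfderiv (𝓡 2) 𝓘(ℝ, V) u p X = fderiv ℝ (u ∘ e.symm) (e p) (chartDeriv e p X) := by
  refine mfderiv_eq_fderiv_of_chart he hp ?_ hu X
  filter_upwards [e.open_source.mem_nhds hp] with q hq
  simp [e.left_inv hq]

lemma mem_contDiffGroupoid_of_contDiffOn {φ : OpenPartialHomeomorph E2 E2}
    (h : ContDiffOn ℝ ∞ φ φ.source) (h' : ContDiffOn ℝ ∞ φ.symm φ.target) :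
    φ ∈ contDiffGroupoid ∞ (𝓡 2) := by
  rw [contDiffGroupoid, mem_groupoid_of_pregroupoid]
  simp only [contDiffPregroupoid]
  simpa using ⟨h, h'⟩

lemma trans_mem_maximalAtlas {e : OpenPartialHomeomorph M E2}
    (he : e ∈ IsManifold.maximalAtlas (𝓡 2) ∞ M) {φ : OpenPartialHomeomorph E2 E2}
    (hφ : φ ∈ contDiffGroupoid ∞ (𝓡 2)) :
    e.trans φ ∈ IsManifold.maximalAtlas (𝓡 2) ∞ M := by
  intro e' he'
  obtain ⟨h1, h2⟩ := he e' he'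
  constructor
  · rw [OpenPartialHomeomorph.trans_symm_eq_symm_trans_symm, OpenPartialHomeomorph.trans_assoc]
    exact (contDiffGroupoid ∞ (𝓡 2)).trans ((contDiffGroupoid ∞ (𝓡 2)).symm hφ) h1
  · rw [← OpenPartialHomeomorph.trans_assoc]
    exact (contDiffGroupoid ∞ (𝓡 2)).trans h2 hφ

/-- The inverse function theorem in a chart: a smooth map of the coordinate plane whose derivative
at a point is injective gives a new chart near that point. -/
lemma exists_chart_of_injective_fderiv {e : OpenPartialHomeomorph M E2}
    (he : e ∈ IsManifold.maximalAtlas (𝓡 2) ∞ M) {p : M} (hp : p ∈ e.source) {W : E2 → E2}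
    {Ω : Set E2} (hΩ : IsOpen Ω) (hW : ContDiffOn ℝ ∞ W Ω) (hpΩ : e p ∈ Ω)
    (hinj : ∀ ξ, fderiv ℝ W (e p) ξ = 0 → ξ = 0) {U : Set M} (hU : IsOpen U) (hpU : p ∈ U) :
    ∃ e' ∈ IsManifold.maximalAtlas (𝓡 2) ∞ M, p ∈ e'.source ∧
      e'.source ⊆ e.source ∩ U ∧ (∀ q ∈ e'.source, e q ∈ Ω) ∧ ∀ q ∈ e'.source, e' q = W (e q) := by
  have hWp : ContDiffAt ℝ ∞ W (e p) := hW.contDiffAt (hΩ.mem_nhds hpΩ)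
  let L : E2 ≃L[ℝ] E2 := (LinearEquiv.ofInjectiveEndo (fderiv ℝ W (e p)).toLinearMap
    ((injective_iff_map_eq_zero _).2 hinj)).toContinuousLinearEquiv
  have hL : (L : E2 →L[ℝ] E2) = fderiv ℝ W (e p) := by ext1; rfl
  have hd : HasFDerivAt W (L : E2 →L[ℝ] E2) (e p) := by
    rw [hL]; exact (hWp.differentiableAt (by simp)).hasFDerivAt
  let φ₀ := hWp.toOpenPartialHomeomorph W hd (by simp)
  have hφ₀ : ∀ z, φ₀ z = W z := fun z => rfl
  set Ω' : Set E2 := {z | z ∈ Ω ∧ fderiv ℝ W z ∈ range ((↑) : (E2 ≃L[ℝ] E2) → E2 →L[ℝ] E2)} with hΩ'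
  have hΩ'o : IsOpen Ω' :=
    (hW.continuousOn_fderiv_of_isOpen hΩ (by simp)).isOpen_inter_preimage hΩ
      ContinuousLinearEquiv.isOpen
  let φ := φ₀.restrOpen Ω' hΩ'o
  have hφ : ∀ z, φ z = W z := fun z => rfl
  have hsrc : φ.source ⊆ Ω' := fun z hz => hz.2
  have g : φ ∈ contDiffGroupoid ∞ (𝓡 2) := by
    refine mem_contDiffGroupoid_of_contDiffOn (hW.mono fun z hz => (hsrc hz).1) ?_
    intro w hw
    have hz := φ.map_target hw
    obtain ⟨h1, L', hL'⟩ := hsrc hz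
    refine (φ.contDiffAt_symm (f₀' := L') hw ?_
      (hW.contDiffAt (hΩ.mem_nhds h1))).contDiffWithinAt
    rw [hL']
    exact (hW.diffAt hΩ h1).hasFDerivAt
  have hpφ : e p ∈ φ.source :=
    ⟨hWp.mem_toOpenPartialHomeomorph_source hd (by simp), hpΩ, L, hL⟩
  have : Nonempty M := ⟨p⟩
  refine ⟨(e.trans φ).restr U, restr_mem_maximalAtlas _ (trans_mem_maximalAtlas he g) hU, ?_, ?_,
    ?_, ?_⟩
  · rw [OpenPartialHomeomorph.restr_source' _ _ hU]
    exact ⟨by simpa using ⟨hp, hpφ⟩, hpU⟩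
  · rw [OpenPartialHomeomorph.restr_source' _ _ hU, OpenPartialHomeomorph.trans_source]
    exact fun q hq => ⟨hq.1.1, hq.2⟩
  · rw [OpenPartialHomeomorph.restr_source' _ _ hU, OpenPartialHomeomorph.trans_source]
    exact fun q hq => (hsrc hq.1.2).1
  · intro q hq
    rfl

end Charts

/-! ### Stereographic charts -/

lemma dot_eq_sum (x y : E3) : dot x y = x 0 * y 0 + x 1 * y 1 + x 2 * y 2 := by
  simp [dot, PiLp.inner_apply, Fin.sum_univ_three, mul_comm]

/-- The linear map that sends a point of space to the sphere of radius zero centred there. -/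
noncomputable def centerL : E3 →L[ℝ] Mink :=
  LinearMap.toContinuousLinearMap
    { toFun := fun p => sphereVec p 0
      map_add' := by
        intro p q
        ext i
        fin_cases i <;> simp [sphereVec] <;> ring
      map_smul' := by
        intro t p
        ext i
        fin_cases i <;> simp [sphereVec] <;> ring }

lemma centerL_apply (p : E3) : centerL p = sphereVec p 0 := rfl

lemma mink_centerL (x y : E3) : mink (centerL x) (centerL y) = dot x y := by
  have h : (√2 : ℝ) ^ 2 = 2 := Real.sq_sqrt (by norm_num)
  simp only [centerL_apply, sphereVec, mink, dot_eq_sum, Matrix.cons_val]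
  field_simp
  rw [h]
  ring

lemma planeVec_eq (n : E3) :
    planeVec n = (1 / 2 : ℝ) • (![1, 0, 0, 1] : Mink) + (1 / √2) • centerL n := by
  have h : (√2 : ℝ) ^ 2 = 2 := Real.sq_sqrt (by norm_num)
  ext i
  fin_cases i <;> simp [planeVec, centerL_apply, sphereVec] <;> field_simp <;> rw [h] <;> ring

lemma mink_centerL_planeVec (x n : E3) : mink (centerL x) (planeVec n) = dot x n / √2 := by
  rw [planeVec_eq, mink_add_right, mink_smul_right, mink_smul_right, mink_centerL]
  simp [mink, centerL_apply, sphereVec]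
  ring

lemma isNullBasis_standard :
    IsNullBasis ![![1, 0, 0, 0], ![0, √2, 0, 0], ![0, 0, √2, 0], ![0, 0, 0, 1]] := by
  have h : (√2 : ℝ) * √2 = 2 := Real.mul_self_sqrt (by norm_num)
  constructor <;> try simp [mink, h]
  · intro i; fin_cases i <;> simp
  · intro v
    ext i
    fin_cases i <;> simp <;> linear_combination (-(1 / 2) * v _) * h
  · simp [Matrix.det_succ_row_zero, Fin.sum_univ_succ, h]

lemma isNullBasis_rotated :
    IsNullBasis ![![0, 0, 0, 1], ![0, √2, 0, 0], ![0, 0, -√2, 0], ![1, 0, 0, 0]] := by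
  have h : (√2 : ℝ) * √2 = 2 := Real.mul_self_sqrt (by norm_num)
  constructor <;> try simp [mink, h]
  · intro i; fin_cases i <;> simp
  · intro v
    ext i
    fin_cases i <;> simp <;> linear_combination (-(1 / 2) * v _) * h
  · simp [Matrix.det_succ_row_zero, Fin.sum_univ_succ, Fin.succAbove, h]
    norm_num

/-- Stereographic projection of the unit sphere from a pole different from `n₀`, in which the
isotropic vectors `planeVec n` run through the null paraboloid. -/
lemma exists_stereographic (n₀ : E3) :
    ∃ (c : Fin 4 → Mink) (ζ : E3 → E2) (Ω : Set E3), IsNullBasis c ∧ IsOpen Ω ∧ n₀ ∈ Ω ∧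
      ContDiffOn ℝ ∞ ζ Ω ∧ ∀ n ∈ Ω, ‖n‖ = 1 →
        planeVec n = (1 + ζ n 0 ^ 2 + ζ n 1 ^ 2)⁻¹ • nulPt c (ζ n) := by
  have h2 : (√2 : ℝ) ^ 2 = 2 := Real.sq_sqrt (by norm_num)
  have hcoord : ∀ i : Fin 3, ContDiff ℝ ∞ (fun n : E3 => n i) := fun i =>
    (EuclideanSpace.proj i : E3 →L[ℝ] ℝ).contDiff
  have hsum : ∀ n : E3, ‖n‖ = 1 → n 0 ^ 2 + n 1 ^ 2 + n 2 ^ 2 = 1 := by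
    intro n hn
    have := EuclideanSpace.real_norm_sq_eq n
    rw [hn, Fin.sum_univ_three] at this
    linarith
  have aux : ∀ (n : E3) (τ : ℝ), ‖n‖ = 1 → (τ = 1 ∨ τ = -1) → 0 < 1 + τ * n 0 →
      (1 + (n 1 / (1 + τ * n 0)) ^ 2 + (τ * n 2 / (1 + τ * n 0)) ^ 2)⁻¹ = (1 + τ * n 0) / 2 ∧
      (1 + τ * n 0) / 2 * ((n 1 / (1 + τ * n 0)) ^ 2 + (τ * n 2 / (1 + τ * n 0)) ^ 2)
        = (1 - τ * n 0) / 2 := by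
    intro n τ hn hτ hpos
    have hs := hsum n hn
    have hτ2 : τ ^ 2 = 1 := by rcases hτ with h | h <;> rw [h] <;> norm_num
    have e : (n 1 / (1 + τ * n 0)) ^ 2 + (τ * n 2 / (1 + τ * n 0)) ^ 2
        = (1 - τ * n 0) / (1 + τ * n 0) := by
      field_simp
      linear_combination hs + (n 2 ^ 2 + n 0 ^ 2) * hτ2
    constructor
    · rw [add_assoc, e]
      field_simp
      ring
    · rw [e]
      field_simp
  have hopen : ∀ τ : ℝ, IsOpen {n : E3 | 0 < 1 + τ * n 0} := fun τ =>
    isOpen_lt continuous_const (continuous_const.add (continuous_const.mul (hcoord 0).continuous))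
  have hsm : ∀ τ : ℝ, ContDiffOn ℝ ∞
      (fun n : E3 => (!₂[n 1 / (1 + τ * n 0), τ * n 2 / (1 + τ * n 0)] : E2))
      {n : E3 | 0 < 1 + τ * n 0} := by
    intro τ
    have hden : ContDiffOn ℝ ∞ (fun n : E3 => 1 + τ * n 0) {n : E3 | 0 < 1 + τ * n 0} :=
      (contDiff_const.add (contDiff_const.mul (hcoord 0))).contDiffOn
    rw [contDiffOn_piLp]
    intro i
    fin_cases i
    · exact (hcoord 1).contDiffOn.div hden fun n hn => ne_of_gt hn
    · exact (contDiff_const.mul (hcoord 2)).contDiffOn.div hden fun n hn => ne_of_gt hn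
  by_cases h : 0 < 1 + 1 * n₀ 0
  · refine ⟨_, fun n => !₂[n 1 / (1 + 1 * n 0), 1 * n 2 / (1 + 1 * n 0)],
      {n : E3 | 0 < 1 + 1 * n 0}, isNullBasis_standard, hopen 1, h, hsm 1, ?_⟩
    intro n hnΩ hn
    obtain ⟨e1, e2⟩ := aux n 1 hn (Or.inl rfl) hnΩ
    have hnΩ' : (1 + 1 * n 0) ≠ 0 := ne_of_gt hnΩ
    have key : (1 + (!₂[n 1 / (1 + 1 * n 0), 1 * n 2 / (1 + 1 * n 0)] : E2) 0 ^ 2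
        + (!₂[n 1 / (1 + 1 * n 0), 1 * n 2 / (1 + 1 * n 0)] : E2) 1 ^ 2)⁻¹
        = (1 + 1 * n 0) / 2 := e1
    rw [key]
    ext i
    fin_cases i
    · simp [planeVec, nulPt]
    · simp only [planeVec, nulPt]
      simp
      field_simp [show (1 + n 0) ≠ 0 by simpa using hnΩ']
      rw [h2]
    · simp only [planeVec, nulPt]
      simp
      field_simp [show (1 + n 0) ≠ 0 by simpa using hnΩ']
      rw [h2]
    · simp only [planeVec, nulPt]
      simp at e2 ⊢
      rw [e2]
  · have h' : 0 < 1 + (-1) * n₀ 0 := by linarith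
    refine ⟨_, fun n => !₂[n 1 / (1 + (-1) * n 0), (-1) * n 2 / (1 + (-1) * n 0)],
      {n : E3 | 0 < 1 + (-1) * n 0}, isNullBasis_rotated, hopen (-1), h', hsm (-1), ?_⟩
    intro n hnΩ hn
    obtain ⟨e1, e2⟩ := aux n (-1) hn (Or.inr rfl) hnΩ
    have hnΩ' : (1 + (-1) * n 0) ≠ 0 := ne_of_gt hnΩ
    have key : (1 + (!₂[n 1 / (1 + (-1) * n 0), (-1) * n 2 / (1 + (-1) * n 0)] : E2) 0 ^ 2
        + (!₂[n 1 / (1 + (-1) * n 0), (-1) * n 2 / (1 + (-1) * n 0)] : E2) 1 ^ 2)⁻¹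
        = (1 + (-1) * n 0) / 2 := e1
    rw [key]
    have hne : (1 + -n 0) ≠ 0 := by simpa using hnΩ'
    ext i
    fin_cases i
    · simp only [planeVec, nulPt]
      simp at e2 ⊢
      rw [e2]
    · simp only [planeVec, nulPt]
      simp
      field_simp
      rw [h2]
    · simp only [planeVec, nulPt]
      simp
      field_simp
      rw [h2]
    · simp [planeVec, nulPt]
      ring

section

variable {M : Type*} [TopologicalSpace M] [ChartedSpace E2 M]

/-- A chart whose coordinate is a stereographic coordinate of the normal vector of `F`: the
isotropic vector of the tangent plane is proportional to the point of the null paraboloid. -/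
structure IsStereoChart (F : LegendreImmersion M) (c : Fin 4 → Mink)
    (e : OpenPartialHomeomorph M E2) : Prop where
  mem_atlas : e ∈ IsManifold.maximalAtlas (𝓡 2) ∞ M
  basis : IsNullBasis c
  plane_eq : ∀ z ∈ e.target,
    planeVec (F.n (e.symm z)) = (1 + z 0 ^ 2 + z 1 ^ 2)⁻¹ • nulPt c z

lemma one_add_sq_pos (z : E2) : 0 < 1 + z 0 ^ 2 + z 1 ^ 2 := by positivity

lemma contDiff_one_add_sq : ContDiff ℝ ∞ (fun z : E2 => 1 + z 0 ^ 2 + z 1 ^ 2) :=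
  (contDiff_const.add ((contDiff_coord 0).pow 2)).add ((contDiff_coord 1).pow 2)

variable (F : LegendreImmersion M)

lemma contDiffOn_f {e : OpenPartialHomeomorph M E2}
    (he : e ∈ IsManifold.maximalAtlas (𝓡 2) ∞ M) : ContDiffOn ℝ ∞ (F.f ∘ e.symm) e.target := by
  simpa using contDiffOn_chart he (contMDiffOn_univ.2 F.smooth_f)

lemma contDiffOn_n {e : OpenPartialHomeomorph M E2}
    (he : e ∈ IsManifold.maximalAtlas (𝓡 2) ∞ M) : ContDiffOn ℝ ∞ (F.n ∘ e.symm) e.target := by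
  simpa using contDiffOn_chart he (contMDiffOn_univ.2 F.smooth_n)

lemma exists_isStereoChart [IsManifold (𝓡 2) ∞ M] (p : M) :
    ∃ c e, IsStereoChart F c e ∧ p ∈ e.source := by
  obtain ⟨c, ζ, Ω, hc, hΩ, hnΩ, hζ, hplane⟩ := exists_stereographic (F.n p)
  let e₀ := chartAt E2 p
  have he₀ : e₀ ∈ IsManifold.maximalAtlas (𝓡 2) ∞ M := IsManifold.chart_mem_maximalAtlas p
  have hp₀ : p ∈ e₀.source := mem_chart_source E2 p
  have hn := contDiffOn_n F he₀
  set Ω' : Set E2 := e₀.target ∩ (F.n ∘ e₀.symm) ⁻¹' Ω with hΩ'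
  have hΩ'o : IsOpen Ω' := hn.continuousOn.isOpen_inter_preimage e₀.open_target hΩ
  have hpΩ' : e₀ p ∈ Ω' := ⟨e₀.map_source hp₀, by simpa [e₀.left_inv hp₀] using hnΩ⟩
  have hW : ContDiffOn ℝ ∞ (ζ ∘ (F.n ∘ e₀.symm)) Ω' :=
    hζ.comp (hn.mono inter_subset_left) fun z hz => hz.2
  have hg : ContDiff ℝ ∞ (fun z : E2 => (1 + z 0 ^ 2 + z 1 ^ 2)⁻¹ • nulPt c z) :=
    (contDiff_one_add_sq.inv fun z => (one_add_sq_pos z).ne').smul (contDiff_nulPt c)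
  obtain ⟨e, he, hpe, hsub, hmem, heq⟩ := exists_chart_of_injective_fderiv he₀ hp₀ hΩ'o hW hpΩ'
    (by
      intro ξ hξ
      by_contra hne
      obtain ⟨X, hX⟩ := (chartDeriv_bijective he₀ hp₀).2 ξ
      have hX0 : X ≠ 0 := fun h => hne (hX ▸ (chartDeriv_eq_zero_iff he₀ hp₀ X).2 h)
      have hnd : DifferentiableAt ℝ (F.n ∘ e₀.symm) (e₀ p) :=
        hn.diffAt e₀.open_target (e₀.map_source hp₀)
      have hpos := F.third_pos p X hX0
      rw [mfderiv_eq_fderiv_chart he₀ hp₀ hnd, hX, ← mink_centerL] at hpos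
      have e1 : (fun z => planeVec ((F.n ∘ e₀.symm) z)) =ᶠ[𝓝 (e₀ p)]
          (fun z : E2 => (1 + z 0 ^ 2 + z 1 ^ 2)⁻¹ • nulPt c z) ∘ (ζ ∘ (F.n ∘ e₀.symm)) := by
        filter_upwards [hΩ'o.mem_nhds hpΩ'] with z hz
        exact hplane _ hz.2 (F.norm_n _)
      have e2 := e1.fderiv_eq (𝕜 := ℝ)
      rw [fderiv_comp _ (hg.differentiable (by simp) _) (hW.diffAt hΩ'o hpΩ')] at e2
      have e3 : HasFDerivAt (fun z => planeVec ((F.n ∘ e₀.symm) z))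
          ((1 / √2 : ℝ) • centerL.comp (fderiv ℝ (F.n ∘ e₀.symm) (e₀ p))) (e₀ p) := by
        have h0 : HasFDerivAt (fun z => centerL ((F.n ∘ e₀.symm) z))
            (centerL.comp (fderiv ℝ (F.n ∘ e₀.symm) (e₀ p))) (e₀ p) :=
          centerL.hasFDerivAt.comp (e₀ p) hnd.hasFDerivAt
        have := (h0.const_smul (1 / √2 : ℝ)).const_add ((1 / 2 : ℝ) • (![1, 0, 0, 1] : Mink))
        refine this.congr_of_eventuallyEq (Filter.Eventually.of_forall fun z => ?_)
        simp [planeVec_eq]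
      rw [e3.fderiv] at e2
      have e4 := congrArg (fun T => T ξ) e2
      simp only [_root_.smul_apply, ContinuousLinearMap.comp_apply, hξ, map_zero]
        at e4
      have e5 : centerL (fderiv ℝ (F.n ∘ e₀.symm) (e₀ p) ξ) = 0 :=
        (smul_eq_zero_iff_right (by positivity : (1 / √2 : ℝ) ≠ 0)).1 e4
      rw [e5, mink_zero_left] at hpos
      exact lt_irrefl _ hpos) isOpen_univ (mem_univ p)
  refine ⟨c, e, ⟨he, hc, ?_⟩, hpe⟩
  intro z hz
  have hq : e.symm z ∈ e.source := e.map_target hz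
  have h1 := heq _ hq
  rw [e.right_inv hz] at h1
  have h2 := hmem _ hq
  have h3 : (F.n ∘ e₀.symm) (e₀ (e.symm z)) = F.n (e.symm z) := by
    simp [e₀.left_inv (hsub hq).1]
  have h4 := hplane _ h2.2 (F.norm_n _)
  simp only [Function.comp_apply] at h1 h3 h4
  rw [← h1, h3] at h4
  exact h4

end

/-! ### The support function and the Weingarten density -/

section

variable {M : Type*} [TopologicalSpace M] [ChartedSpace E2 M]

/-- The support function of `F` in a stereographic chart, scaled so that it is the product of the
point sphere with the point of the null paraboloid. -/
noncomputable def support (F : LegendreImmersion M) (c : Fin 4 → Mink)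
    (e : OpenPartialHomeomorph M E2) (z : E2) : ℝ :=
  mink (centerL (F.f (e.symm z))) (nulPt c z)

namespace IsStereoChart

variable {F : LegendreImmersion M} {c : Fin 4 → Mink} {e : OpenPartialHomeomorph M E2}
  (h : IsStereoChart F c e)

include h

lemma contDiffOn_center : ContDiffOn ℝ ∞ (fun z => centerL (F.f (e.symm z))) e.target :=
  centerL.contDiff.comp_contDiffOn (contDiffOn_f F h.mem_atlas)

lemma contDiffOn_support : ContDiffOn ℝ ∞ (support F c e) e.target :=
  h.contDiffOn_center.mink (contDiff_nulPt c).contDiffOn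

variable {z : E2} (hz : z ∈ e.target)

include hz

lemma dot_normal (x : E3) :
    dot x (F.n (e.symm z)) = √2 * ((1 + z 0 ^ 2 + z 1 ^ 2)⁻¹ * mink (centerL x) (nulPt c z)) := by
  have h2 : (√2 : ℝ) ≠ 0 := by positivity
  have := mink_centerL_planeVec x (F.n (e.symm z))
  rw [h.plane_eq z hz, mink_smul_right] at this
  rw [this]
  field_simp

lemma exists_chartDeriv (ξ : E2) : ∃ X : TangentSpace (𝓡 2) (e.symm z),
    mfderiv (𝓡 2) 𝓘(ℝ, E3) F.f (e.symm z) X = fderiv ℝ (F.f ∘ e.symm) z ξ ∧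
    mfderiv (𝓡 2) 𝓘(ℝ, E3) F.n (e.symm z) X = fderiv ℝ (F.n ∘ e.symm) z ξ := by
  have hq := e.map_target hz
  have hez := e.right_inv hz
  obtain ⟨X, hX⟩ := (chartDeriv_bijective h.mem_atlas hq).2 ξ
  refine ⟨X, ?_, ?_⟩
  · rw [mfderiv_eq_fderiv_chart h.mem_atlas hq (by
      rw [hez]; exact (contDiffOn_f F h.mem_atlas).diffAt e.open_target hz), hX, hez]
  · rw [mfderiv_eq_fderiv_chart h.mem_atlas hq (by
      rw [hez]; exact (contDiffOn_n F h.mem_atlas).diffAt e.open_target hz), hX, hez]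

lemma mink_pd_center_nulPt (i : Fin 2) :
    mink (centerL (pd i (F.f ∘ e.symm) z)) (nulPt c z) = 0 := by
  obtain ⟨X, hX, -⟩ := h.exists_chartDeriv hz (EuclideanSpace.single i 1)
  have h1 := F.contact (e.symm z) X
  rw [hX, h.dot_normal hz] at h1
  have h2 : (√2 : ℝ) ≠ 0 := by positivity
  have h3 : (1 + z 0 ^ 2 + z 1 ^ 2)⁻¹ ≠ 0 := inv_ne_zero (one_add_sq_pos z).ne'
  exact (mul_eq_zero.1 ((mul_eq_zero.1 h1).resolve_left h2)).resolve_left h3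

lemma pd_center (i : Fin 2) :
    pd i (fun y => centerL (F.f (e.symm y))) z = centerL (pd i (F.f ∘ e.symm) z) :=
  pd_clm centerL ((contDiffOn_f F h.mem_atlas).diffAt e.open_target hz) i

lemma pd_support (i : Fin 2) :
    pd i (support F c e) z = mink (centerL (F.f (e.symm z))) (pd i (nulPt c) z) := by
  unfold support
  rw [pd_mink (h.contDiffOn_center.diffAt e.open_target hz) (differentiableAt_nulPt c z),
    h.pd_center hz, h.mink_pd_center_nulPt hz, zero_add]

lemma mink_pd_center_nulX (i : Fin 2) :
    mink (centerL (pd i (F.f ∘ e.symm) z)) (nulX c z)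
      = pd i (pd 0 (support F c e)) z
        - (if i = 0 then 2 else 0) * mink (centerL (F.f (e.symm z))) (c 3) := by
  rw [pd_congr_on e.open_target (fun y hy => h.pd_support hy 0) hz]
  simp only [pd_zero_nulPt]
  rw [pd_mink (h.contDiffOn_center.diffAt e.open_target hz) (differentiableAt_nulX c z),
    h.pd_center hz, pd_nulX, mink_smul_right]
  ring

lemma mink_pd_center_nulY (i : Fin 2) :
    mink (centerL (pd i (F.f ∘ e.symm) z)) (nulY c z)
      = pd i (pd 1 (support F c e)) z
        - (if i = 1 then 2 else 0) * mink (centerL (F.f (e.symm z))) (c 3) := by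
  rw [pd_congr_on e.open_target (fun y hy => h.pd_support hy 1) hz]
  simp only [pd_one_nulPt]
  rw [pd_mink (h.contDiffOn_center.diffAt e.open_target hz) (differentiableAt_nulY c z),
    h.pd_center hz, pd_nulY, mink_smul_right]
  ring

lemma centerL_pd_normal (i : Fin 2) : ∃ t : ℝ, centerL (pd i (F.n ∘ e.symm) z)
    = √2 • (t • nulPt c z + (1 + z 0 ^ 2 + z 1 ^ 2)⁻¹ • pd i (nulPt c) z) := by
  have h2 : (√2 : ℝ) ≠ 0 := by positivity
  have hm : DifferentiableAt ℝ (fun y : E2 => (1 + y 0 ^ 2 + y 1 ^ 2)⁻¹) z :=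
    (contDiff_one_add_sq.inv fun y => (one_add_sq_pos y).ne').differentiable (by simp) z
  have hn := (contDiffOn_n F h.mem_atlas).diffAt e.open_target hz
  have hcn : DifferentiableAt ℝ (fun y => centerL (F.n (e.symm y))) z :=
    centerL.differentiableAt.comp z hn
  refine ⟨pd i (fun y : E2 => (1 + y 0 ^ 2 + y 1 ^ 2)⁻¹) z, ?_⟩
  rw [← pd_smul hm (differentiableAt_nulPt c z),
    ← pd_congr_on e.open_target (fun y hy => h.plane_eq y hy) hz]
  simp only [planeVec_eq]
  have e1 : pd i (fun y => (1 / 2 : ℝ) • (![1, 0, 0, 1] : Mink)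
      + (1 / √2 : ℝ) • centerL (F.n (e.symm y))) z
      = (1 / √2 : ℝ) • centerL (pd i (F.n ∘ e.symm) z) := by
    rw [pd_add (by fun_prop) ((differentiableAt_const (1 / √2 : ℝ)).fun_smul hcn), pd_const,
      pd_smul (t := fun _ => (1 / √2 : ℝ)) (by fun_prop) hcn, pd_const, zero_smul, zero_add,
      zero_add]
    congr 1
    exact pd_clm centerL hn i
  rw [e1, smul_smul, mul_one_div_cancel h2, one_smul]

lemma eucCoeff_third (i j : Fin 2) : eucCoeff (F.n ∘ e.symm) (F.n ∘ e.symm) i j z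
    = if i = j then 4 * ((1 + z 0 ^ 2 + z 1 ^ 2)⁻¹) ^ 2 else 0 := by
  have h2 : (√2 : ℝ) * √2 = 2 := Real.mul_self_sqrt (by norm_num)
  obtain ⟨t, ht⟩ := h.centerL_pd_normal hz i
  obtain ⟨t', ht'⟩ := h.centerL_pd_normal hz j
  rw [eucCoeff, ← mink_centerL, ht, ht']
  have hc := h.basis
  generalize (1 + z 0 ^ 2 + z 1 ^ 2)⁻¹ = k
  fin_cases i <;> fin_cases j <;>
  simp [pd_zero_nulPt, pd_one_nulPt, mink_add_left, mink_add_right, mink_smul_left,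
    mink_smul_right, hc.mink_pp, hc.mink_px, hc.mink_py, hc.mink_xp, hc.mink_yp, hc.mink_xx,
    hc.mink_yy, hc.mink_xy, hc.mink_yx] <;>
  linear_combination (2 * k ^ 2) * h2

lemma eucCoeff_second (i j : Fin 2) : eucCoeff (F.f ∘ e.symm) (F.n ∘ e.symm) i j z
    = √2 * (1 + z 0 ^ 2 + z 1 ^ 2)⁻¹ * (pd i (pd j (support F c e)) z
      - if i = j then 2 * mink (centerL (F.f (e.symm z))) (c 3) else 0) := by
  obtain ⟨t', ht'⟩ := h.centerL_pd_normal hz j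
  rw [eucCoeff, ← mink_centerL, ht', mink_smul_right, mink_add_right, mink_smul_right,
    mink_smul_right, h.mink_pd_center_nulPt hz, pd_nulPt]
  fin_cases i <;> fin_cases j <;>
  simp [h.mink_pd_center_nulX hz, h.mink_pd_center_nulY hz] <;> ring

/-- In a stereographic chart the Weingarten density is the squared norm of `∂_z²` of the support
function, up to a constant. -/
lemma weingartenDensity_eq : weingartenDensity (F.f ∘ e.symm) (F.n ∘ e.symm) z
    = (hessDiff (support F c e) z ^ 2 + hessMix (support F c e) z ^ 2) / 8 := by
  have h2 : (√2 : ℝ) ^ 2 = 2 := Real.sq_sqrt (by norm_num)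
  have hm := one_add_sq_pos z
  set m := 1 + z 0 ^ 2 + z 1 ^ 2
  set κ := mink (centerL (F.f (e.symm z))) (c 3)
  have hthird : (Matrix.of fun i j => eucCoeff (F.n ∘ e.symm) (F.n ∘ e.symm) i j z)
      = (4 * (m⁻¹) ^ 2) • (1 : Matrix (Fin 2) (Fin 2) ℝ) := by
    ext i j
    rw [Matrix.of_apply, h.eucCoeff_third hz, Matrix.smul_apply, Matrix.one_apply]
    simp [m]
  have hk : 4 * (m⁻¹) ^ 2 ≠ 0 := by positivity
  have hinv : ((4 * (m⁻¹) ^ 2) • (1 : Matrix (Fin 2) (Fin 2) ℝ))⁻¹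
      = (4 * (m⁻¹) ^ 2)⁻¹ • (1 : Matrix (Fin 2) (Fin 2) ℝ) := by
    refine Matrix.inv_eq_left_inv ?_
    rw [Matrix.smul_mul, Matrix.one_mul, smul_smul, inv_mul_cancel₀ hk, one_smul]
  have hdet : ((4 * (m⁻¹) ^ 2) • (1 : Matrix (Fin 2) (Fin 2) ℝ)).det = (4 * (m⁻¹) ^ 2) ^ 2 := by
    simp
  have hswap := pd_comm e.open_target h.contDiffOn_support hz 1 0
  simp only [weingartenDensity]
  rw [hthird, hinv, hdet, Real.sqrt_sq (by positivity), Matrix.smul_mul, Matrix.one_mul,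
    Matrix.trace_smul, Matrix.det_smul, Matrix.trace_fin_two, Matrix.det_fin_two]
  simp only [Matrix.of_apply, h.eucCoeff_second hz, hessDiff, hessMix, hswap]
  simp
  field_simp
  rw [h2]
  ring

lemma hess_ne_zero (hF : F.Nondegenerate) :
    0 < hessDiff (support F c e) z ^ 2 + hessMix (support F c e) z ^ 2 := by
  by_contra hcon
  have ha : hessDiff (support F c e) z = 0 := by
    nlinarith [sq_nonneg (hessDiff (support F c e) z), sq_nonneg (hessMix (support F c e) z)]
  have hb : hessMix (support F c e) z = 0 := by
    nlinarith [sq_nonneg (hessDiff (support F c e) z), sq_nonneg (hessMix (support F c e) z)]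
  have hswap := pd_comm e.open_target h.contDiffOn_support hz 1 0
  have hq := e.map_target hz
  have hez := e.right_inv hz
  have hm := one_add_sq_pos z
  set m := 1 + z 0 ^ 2 + z 1 ^ 2 with hmdef
  set κ := mink (centerL (F.f (e.symm z))) (c 3) with hκ
  have hb' : pd 0 (pd 1 (support F c e)) z = 0 := by simpa [hessMix] using hb
  have ha' : pd 1 (pd 1 (support F c e)) z = pd 0 (pd 0 (support F c e)) z := by
    simp only [hessDiff] at ha; linarith
  set A := pd 0 (pd 0 (support F c e)) z - 2 * κ with hA
  have h2 := (hF (e.symm z) 1 (-(√2 * m⁻¹ * A) / (4 * (m⁻¹) ^ 2)) ?_).1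
  · exact one_ne_zero h2
  · intro X
    rw [mfderiv_eq_fderiv_chart h.mem_atlas hq (by
        rw [hez]; exact (contDiffOn_f F h.mem_atlas).diffAt e.open_target hz),
      mfderiv_eq_fderiv_chart h.mem_atlas hq (by
        rw [hez]; exact (contDiffOn_n F h.mem_atlas).diffAt e.open_target hz), hez,
      fderiv_eq_pd, fderiv_eq_pd]
    set ξ := chartDeriv e (e.symm z) X
    have t := fun i j => h.eucCoeff_third hz i j
    have u := fun i j => h.eucCoeff_second hz i j
    simp only [eucCoeff, ← mink_centerL, ← hmdef, ← hκ] at t u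
    have t00 := t 0 0
    have t01 := t 0 1
    have t10 := t 1 0
    have t11 := t 1 1
    have u00 := u 0 0
    have u01 := u 0 1
    have u10 := u 1 0
    have u11 := u 1 1
    simp [hb', ha', hswap, ← hA] at t00 t01 t10 t11 u00 u01 u10 u11
    simp only [← mink_centerL, map_add, map_smul, mink_add_left, mink_add_right, mink_smul_left,
      mink_smul_right, t00, t01, t10, t11, u00, u01, u10, u11]
    field_simp
    ring

end IsStereoChart

end

/-! ### The Euler–Lagrange equation -/

section Plane

lemma eqOn_pd {V : Type*} [NormedAddCommGroup V] [NormedSpace ℝ V] {Ω : Set E2} (hΩ : IsOpen Ω)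
    {u w : E2 → V} (h : EqOn u w Ω) (i : Fin 2) : EqOn (pd i u) (pd i w) Ω :=
  fun _ hz => pd_congr_on hΩ h hz i

lemma eqOn_hessDiff {Ω : Set E2} (hΩ : IsOpen Ω) {u w : E2 → ℝ} (h : EqOn u w Ω) :
    EqOn (hessDiff u) (hessDiff w) Ω := by
  intro z hz
  simp only [hessDiff, eqOn_pd hΩ (eqOn_pd hΩ h _) _ hz]

lemma eqOn_hessMix {Ω : Set E2} (hΩ : IsOpen Ω) {u w : E2 → ℝ} (h : EqOn u w Ω) :
    EqOn (hessMix u) (hessMix w) Ω := by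
  intro z hz
  simp only [hessMix, eqOn_pd hΩ (eqOn_pd hΩ h _) _ hz]

lemma contDiff_pd {V : Type*} [NormedAddCommGroup V] [NormedSpace ℝ V] {u : E2 → V}
    (hu : ContDiff ℝ ∞ u) (i : Fin 2) : ContDiff ℝ ∞ (pd i u) :=
  contDiffOn_univ.1 (contDiffOn_pd isOpen_univ hu.contDiffOn i)

lemma tsupport_pd_subset {V : Type*} [NormedAddCommGroup V] [NormedSpace ℝ V] (u : E2 → V)
    (i : Fin 2) : tsupport (pd i u) ⊆ tsupport u :=
  tsupport_fderiv_apply_subset ℝ (EuclideanSpace.single i 1)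

/-- Integration by parts in the plane. -/
lemma integral_mul_pd {A φ : E2 → ℝ} (hA : ContDiff ℝ ∞ A) (hφ : ContDiff ℝ ∞ φ)
    (hc : HasCompactSupport φ) (i : Fin 2) : ∫ z, A z * pd i φ z = -∫ z, pd i A z * φ z := by
  have hc' : HasCompactSupport (pd i φ) := hc.mono' ((subset_tsupport _).trans
    (tsupport_pd_subset φ i))
  have h1 : Integrable (fun z => pd i A z * φ z) :=
    ((contDiff_pd hA i).continuous.mul hφ.continuous).integrable_of_hasCompactSupport hc.mul_left
  have h2 : Integrable (fun z => A z * pd i φ z) :=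
    (hA.continuous.mul (contDiff_pd hφ i).continuous).integrable_of_hasCompactSupport hc'.mul_left
  have h3 : Integrable (fun z => A z * φ z) :=
    (hA.continuous.mul hφ.continuous).integrable_of_hasCompactSupport hc.mul_left
  exact integral_mul_fderiv_eq_neg_fderiv_mul_of_integrable h1 h2 h3
    (fun z _ => hA.differentiable (by simp) z) (fun z _ => hφ.differentiable (by simp) z)

lemma integral_mul_pd_pd {A φ : E2 → ℝ} (hA : ContDiff ℝ ∞ A) (hφ : ContDiff ℝ ∞ φ)
    (hc : HasCompactSupport φ) (i j : Fin 2) :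
    ∫ z, A z * pd i (pd j φ) z = ∫ z, pd i (pd j A) z * φ z := by
  have hc' : HasCompactSupport (pd j φ) := hc.mono' ((subset_tsupport _).trans
    (tsupport_pd_subset φ j))
  rw [integral_mul_pd hA (contDiff_pd hφ j) hc' i, integral_mul_pd (contDiff_pd hA i) hφ hc j,
    neg_neg]
  congr 1
  ext z
  rw [pd_comm isOpen_univ hA.contDiffOn (mem_univ z) i j]

lemma integrable_mul_pd_pd {A φ : E2 → ℝ} (hA : ContDiff ℝ ∞ A) (hφ : ContDiff ℝ ∞ φ)
    (hc : HasCompactSupport φ) (i j : Fin 2) : Integrable (fun z => A z * pd i (pd j φ) z) := by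
  have hc' : HasCompactSupport (pd i (pd j φ)) := hc.mono' ((subset_tsupport _).trans
    ((tsupport_pd_subset _ i).trans (tsupport_pd_subset φ j)))
  exact (hA.continuous.mul (contDiff_pd (contDiff_pd hφ j) i).continuous)
    |>.integrable_of_hasCompactSupport hc'.mul_left

lemma integrable_pd_pd_mul {A φ : E2 → ℝ} (hA : ContDiff ℝ ∞ A) (hφ : ContDiff ℝ ∞ φ)
    (hc : HasCompactSupport φ) (i j : Fin 2) : Integrable (fun z => pd i (pd j A) z * φ z) :=
  ((contDiff_pd (contDiff_pd hA j) i).continuous.mul hφ.continuous)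
    |>.integrable_of_hasCompactSupport hc.mul_left

lemma integral_hess_mul_hess {A B φ : E2 → ℝ} (hA : ContDiff ℝ ∞ A) (hB : ContDiff ℝ ∞ B)
    (hφ : ContDiff ℝ ∞ φ) (hc : HasCompactSupport φ) :
    ∫ z, (A z * hessDiff φ z + B z * hessMix φ z)
      = ∫ z, (hessDiff A z + hessMix B z) * φ z := by
  have e1 : ∀ z, A z * hessDiff φ z + B z * hessMix φ z
      = (A z * pd 0 (pd 0 φ) z - A z * pd 1 (pd 1 φ) z) + 2 * (B z * pd 0 (pd 1 φ) z) := by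
    intro z; simp only [hessDiff, hessMix]; ring
  have e2 : ∀ z, (hessDiff A z + hessMix B z) * φ z
      = (pd 0 (pd 0 A) z * φ z - pd 1 (pd 1 A) z * φ z) + 2 * (pd 0 (pd 1 B) z * φ z) := by
    intro z; simp only [hessDiff, hessMix]; ring
  simp only [e1, e2]
  have i1 := fun i j => integrable_mul_pd_pd hA hφ hc i j
  have i2 := fun i j => integrable_mul_pd_pd hB hφ hc i j
  have j1 := fun i j => integrable_pd_pd_mul hA hφ hc i j
  have j2 := fun i j => integrable_pd_pd_mul hB hφ hc i j
  have k1 : Integrable (fun z => A z * pd 0 (pd 0 φ) z - A z * pd 1 (pd 1 φ) z) :=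
    (i1 0 0).sub (i1 1 1)
  have k2 : Integrable (fun z => pd 0 (pd 0 A) z * φ z - pd 1 (pd 1 A) z * φ z) :=
    (j1 0 0).sub (j1 1 1)
  rw [integral_add k1 ((i2 0 1).const_mul 2), integral_sub (i1 0 0) (i1 1 1),
    integral_const_mul, integral_add k2 ((j2 0 1).const_mul 2),
    integral_sub (j1 0 0) (j1 1 1), integral_const_mul, integral_mul_pd_pd hA hφ hc,
    integral_mul_pd_pd hA hφ hc, integral_mul_pd_pd hB hφ hc]

/-- The fundamental lemma of the calculus of variations for the functional `∫ |∂_z² s|²`. -/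
lemma biharmonic_of_forall_integral_eq_zero {Ω : Set E2} (hΩ : IsOpen Ω) {s : E2 → ℝ}
    (hs : ContDiffOn ℝ ∞ s Ω)
    (h : ∀ K : Set E2, IsCompact K → K ⊆ Ω → ∀ φ : E2 → ℝ, ContDiff ℝ ∞ φ → tsupport φ ⊆ K →
      ∫ z in K, (hessDiff s z * hessDiff φ z + hessMix s z * hessMix φ z) = 0)
    {z₀ : E2} (hz₀ : z₀ ∈ Ω) : hessDiff (hessDiff s) z₀ + hessMix (hessMix s) z₀ = 0 := by
  obtain ⟨ρ, hρ, hball⟩ := Metric.nhds_basis_closedBall.mem_iff.1 (hΩ.mem_nhds hz₀)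
  -- a globally smooth function that agrees with `s` near `z₀`
  let χ : ContDiffBump z₀ := ⟨ρ / 4, ρ / 2, by linarith, by linarith⟩
  set S : E2 → ℝ := fun z => χ z * s z with hSdef
  have hS : ContDiff ℝ ∞ S := by
    rw [contDiff_iff_contDiffAt]
    intro z
    by_cases hz : z ∈ Metric.ball z₀ ρ
    · exact (χ.contDiff.contDiffAt).mul
        (hs.contDiffAt (hΩ.mem_nhds (hball (Metric.ball_subset_closedBall hz))))
    · have hz' : z ∉ tsupport χ := by
        rw [χ.tsupport_eq]
        intro hz'
        have : dist z z₀ ≤ ρ / 2 := hz'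
        exact hz (lt_of_le_of_lt this (by linarith))
      have h0 : S =ᶠ[𝓝 z] fun _ => 0 := by
        filter_upwards [notMem_tsupport_iff_eventuallyEq.1 hz'] with y hy
        simp [S, hy]
      exact contDiffAt_const.congr_of_eventuallyEq h0
  set U := Metric.ball z₀ (ρ / 4) with hU
  have hUo : IsOpen U := Metric.isOpen_ball
  have hUΩ : U ⊆ Ω := fun z hz => hball
    (Metric.ball_subset_closedBall (Metric.ball_subset_ball (by linarith) hz))
  have hSs : EqOn S s U := by
    intro z hz
    simp [S, χ.one_of_mem_closedBall (Metric.ball_subset_closedBall hz)]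
  have hA : ContDiff ℝ ∞ (hessDiff S) :=
    contDiffOn_univ.1 (contDiffOn_hessDiff isOpen_univ hS.contDiffOn)
  have hB : ContDiff ℝ ∞ (hessMix S) :=
    contDiffOn_univ.1 (contDiffOn_hessMix isOpen_univ hS.contDiffOn)
  set g : E2 → ℝ := fun z => hessDiff (hessDiff S) z + hessMix (hessMix S) z with hg
  have hgc : Continuous g := by
    have h1 : ContDiff ℝ ∞ (hessDiff (hessDiff S)) :=
      contDiffOn_univ.1 (contDiffOn_hessDiff isOpen_univ hA.contDiffOn)
    have h2 : ContDiff ℝ ∞ (hessMix (hessMix S)) :=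
      contDiffOn_univ.1 (contDiffOn_hessMix isOpen_univ hB.contDiffOn)
    exact h1.continuous.add h2.continuous
  have hae : ∀ᵐ z, z ∈ U → g z = 0 := by
    refine hUo.ae_eq_zero_of_integral_contDiff_smul_eq_zero
      (hgc.locallyIntegrable.locallyIntegrableOn U) ?_
    intro φ hφ hφc hφU
    have hφK : tsupport φ ⊆ Metric.closedBall z₀ ρ := hφU.trans
      (Metric.ball_subset_closedBall.trans (Metric.closedBall_subset_closedBall (by linarith)))
    have e0 := h _ (isCompact_closedBall z₀ ρ) hball φ hφ hφK
    have hz0 : ∀ i j : Fin 2, ∀ z, z ∉ tsupport φ → pd i (pd j φ) z = 0 := by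
      intro i j z hz
      exact image_eq_zero_of_notMem_tsupport fun hz' =>
        hz (tsupport_pd_subset φ j (tsupport_pd_subset _ i hz'))
    have hvan : ∀ z, z ∉ tsupport φ → hessDiff φ z = 0 ∧ hessMix φ z = 0 := by
      intro z hz
      simp [hessDiff, hessMix, hz0 _ _ z hz]
    have e1 : ∫ z in Metric.closedBall z₀ ρ,
        (hessDiff s z * hessDiff φ z + hessMix s z * hessMix φ z)
        = ∫ z, (hessDiff S z * hessDiff φ z + hessMix S z * hessMix φ z) := by
      rw [setIntegral_eq_integral_of_forall_compl_eq_zero]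
      · congr 1
        ext z
        by_cases hz : z ∈ tsupport φ
        · rw [eqOn_hessDiff hUo hSs (hφU hz), eqOn_hessMix hUo hSs (hφU hz)]
        · simp [hvan z hz]
      · intro z hz
        simp [hvan z fun hz' => hz (hφK hz')]
    rw [e1, integral_hess_mul_hess hA hB hφ hφc] at e0
    simpa [hg, mul_comm] using e0
  have hres : EqOn g (fun _ => 0) U := by
    refine Measure.eqOn_open_of_ae_eq (μ := volume) ?_ hUo hgc.continuousOn continuousOn_const
    exact (ae_restrict_iff' hUo.measurableSet).2 hae
  have hzU : z₀ ∈ U := Metric.mem_ball_self (by linarith)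
  have := hres hzU
  simp only [hg] at this
  rw [eqOn_hessDiff hUo (eqOn_hessDiff hUo hSs) hzU, eqOn_hessMix hUo (eqOn_hessMix hUo hSs) hzU]
    at this
  exact this

end Plane

/-! ### Variations with fixed normal vector -/

section Field

/-- The vector of Minkowski space orthogonal to `ε₁ + ε₄` whose products with the point of the null
paraboloid and its derivatives are `ψ` and the derivatives of `ψ`. -/
noncomputable def liftedField (c : Fin 4 → Mink) (ψ : E2 → ℝ) (z : E2) : Mink :=
  ((ψ z - z 0 * pd 0 ψ z - z 1 * pd 1 ψ z) * (1 + z 0 ^ 2 + z 1 ^ 2)⁻¹) • nulPt c z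
    + (pd 0 ψ z / 2) • nulX c z + (pd 1 ψ z / 2) • nulY c z - ψ z • c 3

/-- The variational field in space that changes the support function by `ψ` and keeps the normal
vector. -/
noncomputable def variationField (c : Fin 4 → Mink) (ψ : E2 → ℝ) (z : E2) : E3 :=
  !₂[√2 * liftedField c ψ z 0, liftedField c ψ z 1, liftedField c ψ z 2]

variable {c : Fin 4 → Mink} {ψ : E2 → ℝ}

lemma contDiff_liftedField (hψ : ContDiff ℝ ∞ ψ) : ContDiff ℝ ∞ (liftedField c ψ) := by
  have h0 := contDiff_pd hψ 0
  have h1 := contDiff_pd hψ 1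
  have hm := contDiff_one_add_sq.inv fun z => (one_add_sq_pos z).ne'
  have hx := contDiff_coord 0
  have hy := contDiff_coord 1
  have hN := contDiff_nulPt c
  have hX := contDiff_nulX c
  have hY := contDiff_nulY c
  have hk : ContDiff ℝ ∞ (fun z : E2 =>
      (ψ z - z 0 * pd 0 ψ z - z 1 * pd 1 ψ z) * (1 + z 0 ^ 2 + z 1 ^ 2)⁻¹) :=
    ((hψ.sub (hx.mul h0)).sub (hy.mul h1)).mul hm
  exact (((hk.smul hN).add ((h0.div_const 2).smul hX)).add ((h1.div_const 2).smul hY)).sub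
    (hψ.smul contDiff_const)

lemma contDiff_variationField (hψ : ContDiff ℝ ∞ ψ) : ContDiff ℝ ∞ (variationField c ψ) := by
  have h := contDiff_pi.1 (contDiff_liftedField (c := c) hψ)
  unfold variationField
  rw [contDiff_piLp]
  intro i
  fin_cases i
  · exact contDiff_const.mul (h 0)
  · exact h 1
  · exact h 2

lemma variationField_eq_zero {z : E2} (hz : z ∉ tsupport ψ) : variationField c ψ z = 0 := by
  have h : ∀ i, pd i ψ z = 0 := fun i =>
    image_eq_zero_of_notMem_tsupport fun h => hz (tsupport_pd_subset ψ i h)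
  have h0 : ψ z = 0 := image_eq_zero_of_notMem_tsupport hz
  have hl : liftedField c ψ z = 0 := by simp [liftedField, h, h0]
  ext i
  fin_cases i <;> simp [variationField, hl]

variable (hc : IsNullBasis c)

include hc

lemma centerL_variationField (z : E2) : centerL (variationField c ψ z) = liftedField c ψ z := by
  have h2 : (√2 : ℝ) ≠ 0 := by positivity
  have hm := (one_add_sq_pos z).ne'
  have ht : mink (liftedField c ψ z) ![1, 0, 0, 1] = 0 := by
    simp only [liftedField, nulPt, nulX, nulY, mink_add_left, mink_sub_left, mink_smul_left,
      hc.time, Matrix.cons_val]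
    field_simp
    ring
  have h3 : liftedField c ψ z 3 = -liftedField c ψ z 0 := by
    simp only [mink, Matrix.cons_val] at ht
    linarith
  ext i
  fin_cases i
  · simp [centerL_apply, sphereVec, variationField]
  · simp [centerL_apply, sphereVec, variationField]
  · simp [centerL_apply, sphereVec, variationField]
  · simp [centerL_apply, sphereVec, variationField, h3]
    field_simp

lemma mink_liftedField_nulPt (z : E2) : mink (liftedField c ψ z) (nulPt c z) = ψ z := by
  simp only [liftedField, mink_add_left, mink_sub_left, mink_smul_left, hc.mink_pp, hc.mink_xp,
    hc.mink_yp, hc.mink_zp]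
  ring

lemma mink_liftedField_pd_nulPt (i : Fin 2) (z : E2) :
    mink (liftedField c ψ z) (pd i (nulPt c) z) = pd i ψ z := by
  rw [pd_nulPt]
  fin_cases i <;>
  simp [liftedField, mink_add_left, mink_sub_left, mink_smul_left, hc.mink_px, hc.mink_xx,
    hc.mink_yx, hc.mink_zx, hc.mink_py, hc.mink_xy, hc.mink_yy, hc.mink_zy]

lemma mink_pd_variationField (hψ : ContDiff ℝ ∞ ψ) (i : Fin 2) (z : E2) :
    mink (centerL (pd i (variationField c ψ) z)) (nulPt c z) = 0 := by
  have hV : DifferentiableAt ℝ (variationField c ψ) z :=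
    (contDiff_variationField hψ).differentiable (by simp) z
  have hL : DifferentiableAt ℝ (liftedField c ψ) z :=
    (contDiff_liftedField hψ).differentiable (by simp) z
  have e1 : pd i (liftedField c ψ) z = centerL (pd i (variationField c ψ) z) := by
    rw [← pd_clm centerL hV]
    simp only [centerL_variationField hc]
  have e2 := pd_mink hL (differentiableAt_nulPt c z) i
  simp only [mink_liftedField_nulPt hc, mink_liftedField_pd_nulPt hc] at e2
  rw [← e1]
  have e3 : pd i (fun y => ψ y) z = pd i ψ z := rfl
  rw [e3] at e2
  linarith

end Field

section

variable {M : Type*} [TopologicalSpace M] [ChartedSpace E2 M]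
  {F : LegendreImmersion M} {c : Fin 4 → Mink} {e : OpenPartialHomeomorph M E2} {ψ : E2 → ℝ}

open Classical in
/-- The variational field on the surface, extended by zero to the complement of the chart. -/
noncomputable def surfaceField (c : Fin 4 → Mink) (e : OpenPartialHomeomorph M E2) (ψ : E2 → ℝ)
    (q : M) : E3 :=
  if q ∈ e.source then variationField c ψ (e q) else 0

omit [ChartedSpace E2 M] in
lemma surfaceField_of_mem {q : M} (hq : q ∈ e.source) :
    surfaceField c e ψ q = variationField c ψ (e q) := if_pos hq

omit [ChartedSpace E2 M] in
lemma surfaceField_symm {z : E2} (hz : z ∈ e.target) :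
    surfaceField c e ψ (e.symm z) = variationField c ψ z := by
  rw [surfaceField_of_mem (e.map_target hz), e.right_inv hz]

omit [ChartedSpace E2 M] in
lemma surfaceField_eq_zero {K : Set E2} (hK : tsupport ψ ⊆ K) {q : M} (hq : q ∉ e.symm '' K) :
    surfaceField c e ψ q = 0 := by
  by_cases hs : q ∈ e.source
  · rw [surfaceField_of_mem hs]
    exact variationField_eq_zero fun h => hq ⟨e q, hK h, e.left_inv hs⟩
  · exact if_neg hs

omit [ChartedSpace E2 M] in
lemma isCompact_symm_image {K : Set E2} (hK : IsCompact K) (hKe : K ⊆ e.target) :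
    IsCompact (e.symm '' K) :=
  hK.image_of_continuousOn (e.symm.continuousOn.mono hKe)

variable [T2Space M]

omit [ChartedSpace E2 M] in
lemma surfaceField_eventually_eq_zero {K : Set E2} (hK : IsCompact K) (hKe : K ⊆ e.target)
    (hψK : tsupport ψ ⊆ K) {q : M} (hq : q ∉ e.source) :
    ∀ᶠ p in 𝓝 q, surfaceField c e ψ p = 0 := by
  have hcl : IsClosed (e.symm '' K) := (isCompact_symm_image hK hKe).isClosed
  have hq' : q ∉ e.symm '' K := by
    rintro ⟨z, hz, rfl⟩
    exact hq (e.map_target (hKe hz))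
  filter_upwards [hcl.isOpen_compl.mem_nhds hq'] with p hp
  exact surfaceField_eq_zero hψK hp

lemma contMDiff_surfaceField (he : e ∈ IsManifold.maximalAtlas (𝓡 2) ∞ M) (hψ : ContDiff ℝ ∞ ψ)
    {K : Set E2} (hK : IsCompact K) (hKe : K ⊆ e.target) (hψK : tsupport ψ ⊆ K) :
    ContMDiff (𝓡 2) 𝓘(ℝ, E3) ∞ (surfaceField c e ψ) := by
  intro q
  by_cases hq : q ∈ e.source
  · have h1 : ContMDiffOn (𝓡 2) 𝓘(ℝ, E3) ∞ (surfaceField c e ψ) e.source :=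
      contMDiffOn_of_chart he (contDiff_variationField hψ).contDiffOn subset_rfl
        (mapsTo_univ _ _) fun p hp => surfaceField_of_mem hp
    exact h1.contMDiffAt (e.open_source.mem_nhds hq)
  · exact contMDiffAt_const.congr_of_eventuallyEq (surfaceField_eventually_eq_zero hK hKe hψK hq)

/-- The variation of `F` with fixed normal vector whose support function is `s + t ψ`. -/
noncomputable def IsStereoChart.variation (h : IsStereoChart F c e) (hψ : ContDiff ℝ ∞ ψ)
    {K : Set E2} (hK : IsCompact K) (hKe : K ⊆ e.target) (hψK : tsupport ψ ⊆ K) (t : ℝ) :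
    LegendreImmersion M where
  f := fun q => F.f q + t • surfaceField c e ψ q
  n := F.n
  smooth_f := by
    have h1 := contMDiff_surfaceField (c := c) h.mem_atlas hψ hK hKe hψK
    have h2 : ContMDiff (𝓡 2) 𝓘(ℝ, ℝ) ∞ (fun _ : M => t) := contMDiff_const
    exact F.smooth_f.add (h2.smul h1)
  smooth_n := F.smooth_n
  norm_n := F.norm_n
  contact := by
    intro p X
    by_cases hp : p ∈ e.source
    · set z := e p with hz
      have hzt : z ∈ e.target := e.map_source hp
      have hpz : e.symm z = p := e.left_inv hp
      have hf := (contDiffOn_f F h.mem_atlas).diffAt e.open_target hzt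
      have hV : DifferentiableAt ℝ (variationField c ψ) z :=
        (contDiff_variationField hψ).differentiable (by simp) z
      have hsum : DifferentiableAt ℝ
          (fun y => (F.f ∘ e.symm) y + t • variationField c ψ y) z :=
        hf.fun_add (hV.fun_const_smul t)
      rw [mfderiv_eq_fderiv_of_chart h.mem_atlas hp
        (w := fun y => (F.f ∘ e.symm) y + t • variationField c ψ y) (by
          filter_upwards [e.open_source.mem_nhds hp] with q hq
          simp [surfaceField_of_mem hq, e.left_inv hq]) hsum, ← hpz, h.dot_normal hzt]
      rw [fderiv_eq_pd, hpz, ← hz]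
      have e1 : ∀ i, mink (centerL (pd i (fun y => (F.f ∘ e.symm) y + t • variationField c ψ y) z))
          (nulPt c z) = 0 := by
        intro i
        rw [pd_add hf (hV.fun_const_smul t), pd_smul (t := fun _ => t) (by fun_prop) hV, pd_const]
        simp [mink_add_left, mink_smul_left, h.mink_pd_center_nulPt hzt,
          mink_pd_variationField h.basis hψ]
      rw [map_add, map_smul, map_smul, mink_add_left, mink_smul_left, mink_smul_left, e1, e1]
      ring
    · have e1 : (fun q => F.f q + t • surfaceField c e ψ q) =ᶠ[𝓝 p] F.f := by
        filter_upwards [surfaceField_eventually_eq_zero (c := c) hK hKe hψK hp] with q hq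
        simp [hq]
      rw [e1.mfderiv_eq]
      exact F.contact p X
  third_pos := F.third_pos

namespace IsStereoChart

variable (h : IsStereoChart F c e) (hψ : ContDiff ℝ ∞ ψ)
    {K : Set E2} (hK : IsCompact K) (hKe : K ⊆ e.target) (hψK : tsupport ψ ⊆ K)

lemma isVariation_variation :
    F.IsVariation (e.symm '' K) 1 (h.variation hψ hK hKe hψK) where
  eps_pos := one_pos
  smooth_f := by
    have h1 := contMDiff_surfaceField (c := c) h.mem_atlas hψ hK hKe hψK
    have h2 : ContMDiff (𝓘(ℝ, ℝ).prod (𝓡 2)) 𝓘(ℝ, ℝ) ∞ (fun x : ℝ × M => x.1) := contMDiff_fst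
    have h3 : ContMDiff (𝓘(ℝ, ℝ).prod (𝓡 2)) (𝓡 2) ∞ (fun x : ℝ × M => x.2) := contMDiff_snd
    exact ((F.smooth_f.comp h3).add (h2.smul (h1.comp h3))).contMDiffOn
  smooth_n := by
    have h3 : ContMDiff (𝓘(ℝ, ℝ).prod (𝓡 2)) (𝓡 2) ∞ (fun x : ℝ × M => x.2) := contMDiff_snd
    exact (F.smooth_n.comp h3).contMDiffOn
  zero := by
    cases F
    simp [variation]
  outside := by
    intro t _ p hp
    simp [variation, surfaceField_eq_zero hψK hp]

lemma variation_isStereoChart (t : ℝ) : IsStereoChart (h.variation hψ hK hKe hψK t) c e :=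
  ⟨h.mem_atlas, h.basis, h.plane_eq⟩

lemma support_variation (t : ℝ) :
    EqOn (support (h.variation hψ hK hKe hψK t) c e) (fun z => support F c e z + t * ψ z)
      e.target := by
  intro z hz
  simp only [support, variation, map_add, map_smul, mink_add_left, mink_smul_left,
    surfaceField_symm hz, centerL_variationField h.basis, mink_liftedField_nulPt h.basis]

include h in
/-- The Euler–Lagrange equation of the Weingarten functional: the support function of an L-minimal
Legendre immersion is biharmonic in a stereographic coordinate. -/
lemma biharmonic_support (hmin : F.IsLMinimal) {z : E2} (hz : z ∈ e.target) :
    hessDiff (hessDiff (support F c e)) z + hessMix (hessMix (support F c e)) z = 0 := by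
  have hs := h.contDiffOn_support
  refine biharmonic_of_forall_integral_eq_zero e.open_target hs ?_ hz
  intro K hK hKe φ hφ hφK
  have hderiv := hmin e h.mem_atlas (e.symm '' K) (isCompact_symm_image hK hKe)
    (by rintro _ ⟨y, hy, rfl⟩; exact e.map_target (hKe hy)) 1 _
    (h.isVariation_variation hφ hK hKe hφK)
  have himg : e '' (e.symm '' K) = K := by
    rw [image_image]
    exact (image_congr fun y hy => e.right_inv (hKe hy)).trans (image_id' K)
  rw [himg] at hderiv
  set s := support F c e with hsdef
  have hφ' := hφ.contDiffOn (s := e.target)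
  have ca := (contDiffOn_hessDiff e.open_target hs).continuousOn.mono hKe
  have cb := (contDiffOn_hessMix e.open_target hs).continuousOn.mono hKe
  have ca' := (contDiffOn_hessDiff e.open_target hφ').continuousOn.mono hKe
  have cb' := (contDiffOn_hessMix e.open_target hφ').continuousOn.mono hKe
  set P := ∫ y in K, (hessDiff s y ^ 2 + hessMix s y ^ 2) / 8 with hP
  set Q := ∫ y in K, (hessDiff s y * hessDiff φ y + hessMix s y * hessMix φ y) with hQ
  set R := ∫ y in K, (hessDiff φ y ^ 2 + hessMix φ y ^ 2) / 8 with hR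
  have i1 : IntegrableOn (fun y => (hessDiff s y ^ 2 + hessMix s y ^ 2) / 8) K :=
    (((ca.pow 2).add (cb.pow 2)).div_const 8).integrableOn_compact hK
  have i2 : IntegrableOn (fun y => hessDiff s y * hessDiff φ y + hessMix s y * hessMix φ y) K :=
    ((ca.mul ca').add (cb.mul cb')).integrableOn_compact hK
  have i3 : IntegrableOn (fun y => (hessDiff φ y ^ 2 + hessMix φ y ^ 2) / 8) K :=
    (((ca'.pow 2).add (cb'.pow 2)).div_const 8).integrableOn_compact hK
  have hpoly : ∀ t : ℝ, ∫ y in K, weingartenDensity ((h.variation hφ hK hKe hφK t).f ∘ e.symm)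
      ((h.variation hφ hK hKe hφK t).n ∘ e.symm) y = P + t * (Q / 4) + t ^ 2 * R := by
    intro t
    have e1 : ∀ y ∈ K, weingartenDensity ((h.variation hφ hK hKe hφK t).f ∘ e.symm)
        ((h.variation hφ hK hKe hφK t).n ∘ e.symm) y
        = (hessDiff s y ^ 2 + hessMix s y ^ 2) / 8
          + (t / 4) * (hessDiff s y * hessDiff φ y + hessMix s y * hessMix φ y)
          + t ^ 2 * ((hessDiff φ y ^ 2 + hessMix φ y ^ 2) / 8) := by
      intro y hy
      have hlin : ∀ i j, ∀ w ∈ e.target, pd i (pd j (fun x => s x + t * φ x)) w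
          = pd i (pd j s) w + t * pd i (pd j φ) w := by
        have k1 : ∀ {u w : E2 → ℝ}, ContDiffOn ℝ ∞ u e.target → ContDiffOn ℝ ∞ w e.target →
            ∀ i, EqOn (pd i fun x => u x + t * w x) (fun x => pd i u x + t * pd i w x)
              e.target := by
          intro u w hu hw i x hx
          have du := hu.diffAt e.open_target hx
          have dw := hw.diffAt e.open_target hx
          show pd i (fun x => u x + t * w x) x = _
          rw [pd_add du (by fun_prop), pd_const_mul dw]
        intro i j w hw
        rw [eqOn_pd e.open_target (k1 hs hφ' j) i hw]
        exact k1 (contDiffOn_pd e.open_target hs j) (contDiffOn_pd e.open_target hφ' j) i hw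
      rw [(h.variation_isStereoChart hφ hK hKe hφK t).weingartenDensity_eq (hKe hy),
        eqOn_hessDiff e.open_target (h.support_variation hφ hK hKe hφK t) (hKe hy),
        eqOn_hessMix e.open_target (h.support_variation hφ hK hKe hφK t) (hKe hy)]
      simp only [hessDiff, hessMix]
      rw [hlin 0 0 y (hKe hy), hlin 1 1 y (hKe hy), hlin 0 1 y (hKe hy)]
      ring
    rw [setIntegral_congr_fun hK.measurableSet e1]
    have i12 : IntegrableOn (fun y => (hessDiff s y ^ 2 + hessMix s y ^ 2) / 8
          + (t / 4) * (hessDiff s y * hessDiff φ y + hessMix s y * hessMix φ y)) K :=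
      i1.add (i2.const_mul (t / 4))
    rw [integral_add i12 (i3.const_mul (t ^ 2)), integral_add i1 (i2.const_mul (t / 4)),
      integral_const_mul, integral_const_mul]
    ring
  simp only [hpoly] at hderiv
  have hd : HasDerivAt (fun t : ℝ => P + t * (Q / 4) + t ^ 2 * R) (Q / 4) 0 := by
    have := (((hasDerivAt_id (0 : ℝ)).mul_const (Q / 4)).const_add P).fun_add
      ((hasDerivAt_pow 2 (0 : ℝ)).mul_const R)
    simpa using this
  have := hd.unique hderiv
  linarith

end IsStereoChart

end

/-! ### Structure equations of frames in the plane -/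

lemma gram_values : gram 0 0 = 0 ∧ gram 0 1 = 0 ∧ gram 0 2 = 0 ∧ gram 0 3 = -1 ∧ gram 1 1 = 1 ∧
    gram 1 2 = 0 ∧ gram 1 3 = 0 ∧ gram 2 2 = 1 ∧ gram 2 3 = 0 ∧ gram 3 3 = 0 := by
  simp [gram, mink]

lemma gram_comm (i j : Fin 4) : gram i j = gram j i := mink_comm _ _

/-- The expansion of a vector in a Laguerre frame. -/
lemma expand_frame {a : Fin 4 → Mink} (hg : ∀ i j, mink (a i) (a j) = gram i j)
    (hdet : (Matrix.of fun i j => a i j).det ≠ 0) (v : Mink) :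
    v = -mink v (a 3) • a 0 + mink v (a 1) • a 1 + mink v (a 2) • a 2 - mink v (a 0) • a 3 := by
  obtain ⟨g00, g01, g02, g03, g11, g12, g13, g22, g23, g33⟩ := gram_values
  set w := v - (-mink v (a 3) • a 0 + mink v (a 1) • a 1 + mink v (a 2) • a 2 - mink v (a 0) • a 3)
    with hw
  have hp : ∀ i, mink (a i) w = 0 := by
    intro i
    fin_cases i <;>
    simp [-neg_smul, hw, mink_sub_right, mink_add_right, mink_smul_right, hg, gram_comm 1 0,
      gram_comm 2 0, gram_comm 3 0, gram_comm 2 1, gram_comm 3 1, gram_comm 3 2, g00, g01, g02, g03,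
      g11, g12, g13, g22, g23, g33, mink_comm v]
  have h0 : Matrix.mulVec (Matrix.of fun i j => a i j) ![-w 3, w 1, w 2, -w 0] = 0 := by
    ext i
    have := hp i
    simp only [mink] at this
    simp [Matrix.mulVec, dotProduct, Fin.sum_univ_four]
    linarith
  have h1 := Matrix.eq_zero_of_mulVec_eq_zero hdet h0
  have h2 : w = 0 := by
    ext i
    have k0 := congrFun h1 0
    have k1 := congrFun h1 1
    have k2 := congrFun h1 2
    have k3 := congrFun h1 3
    simp at k0 k1 k2 k3
    fin_cases i <;> simp [k0, k1, k2, k3]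
  exact sub_eq_zero.1 h2

/-- If `⟨du, w⟩ = 0`, then `⟨du ∧ dw⟩ = 0`, by the symmetry of second derivatives. -/
lemma mink_pd_swap {Ω : Set E2} (hΩ : IsOpen Ω) {u w : E2 → Mink} (hu : ContDiffOn ℝ ∞ u Ω)
    (hw : ContDiffOn ℝ ∞ w Ω) (h : ∀ i, ∀ z ∈ Ω, mink (pd i u z) (w z) = 0) {z : E2} (hz : z ∈ Ω) :
    mink (pd 0 u z) (pd 1 w z) = mink (pd 1 u z) (pd 0 w z) := by
  have key : ∀ i j : Fin 2, mink (pd j (pd i u) z) (w z) + mink (pd i u z) (pd j w z) = 0 := by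
    intro i j
    rw [← pd_mink ((contDiffOn_pd hΩ hu i).diffAt hΩ hz) (hw.diffAt hΩ hz) j,
      pd_congr_on hΩ (h i) hz, pd_const]
  have h1 := key 0 1
  have h2 := key 1 0
  rw [pd_comm hΩ hu hz 1 0] at h1
  linarith

/-- A Laguerre frame field on an open subset of the coordinate plane. -/
structure IsPlaneFrame (Ω : Set E2) (x : E2 → Mink) (a : Fin 4 → E2 → Mink) : Prop where
  smooth_x : ContDiffOn ℝ ∞ x Ω
  smooth_a : ∀ i, ContDiffOn ℝ ∞ (a i) Ω
  gram_eq : ∀ z ∈ Ω, ∀ i j, mink (a i z) (a j z) = gram i j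
  oriented : ∀ z ∈ Ω, 0 < (Matrix.of fun i j => a i z j).det

/-- A frame field that satisfies the equations of a middle frame for `dx` and `da₁` (in the usual
numbering) satisfies all of them: the form of `da₂`, `da₃`, `da₄` and the relations between the
coefficients follow from the Gram matrix and from the symmetry of second derivatives. -/
lemma IsPlaneFrame.exists_structure_functions {Ω : Set E2} (hΩ : IsOpen Ω) {x : E2 → Mink}
    {a : Fin 4 → E2 → Mink} (h : IsPlaneFrame Ω x a)
    (hx0 : ∀ i, ∀ z ∈ Ω, mink (pd i x z) (a 0 z) = 0)
    (hx3 : ∀ i, ∀ z ∈ Ω, mink (pd i x z) (a 3 z) = 0)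
    (h01 : ∀ i, ∀ z ∈ Ω, mink (pd i (a 0) z) (a 1 z) = mink (pd i x z) (a 1 z))
    (h02 : ∀ i, ∀ z ∈ Ω, mink (pd i (a 0) z) (a 2 z) = -mink (pd i x z) (a 2 z))
    (hdet : ∀ z ∈ Ω, mink (pd 0 x z) (a 1 z) * mink (pd 1 x z) (a 2 z)
      - mink (pd 1 x z) (a 1 z) * mink (pd 0 x z) (a 2 z) ≠ 0) :
    ∃ p₁ p₂ p₃ q₁ q₂ : E2 → ℝ, ContDiffOn ℝ ∞ p₁ Ω ∧ ContDiffOn ℝ ∞ p₂ Ω ∧ ContDiffOn ℝ ∞ p₃ Ω ∧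
      ContDiffOn ℝ ∞ q₁ Ω ∧ ContDiffOn ℝ ∞ q₂ Ω ∧ ∀ z ∈ Ω, ∀ i : Fin 2,
      let α : ℝ := mink (pd i x z) (a 1 z)
      let β : ℝ := mink (pd i x z) (a 2 z)
      pd i x z = α • a 1 z + β • a 2 z ∧
      pd i (a 0) z = (2 * q₂ z * α - 2 * q₁ z * β) • a 0 z + α • a 1 z - β • a 2 z ∧
      pd i (a 1) z = (p₁ z * α + p₂ z * β) • a 0 z + (q₁ z * α + q₂ z * β) • a 2 z + α • a 3 z ∧
      pd i (a 2) z = (p₂ z * α + p₃ z * β) • a 0 z - (q₁ z * α + q₂ z * β) • a 1 z - β • a 3 z ∧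
      pd i (a 3) z = (p₁ z * α + p₂ z * β) • a 1 z + (p₂ z * α + p₃ z * β) • a 2 z
        - (2 * q₂ z * α - 2 * q₁ z * β) • a 3 z := by
  obtain ⟨g00, g01, g02, g03, g11, g12, g13, g22, g23, g33⟩ := gram_values
  have sx := fun i => contDiffOn_pd hΩ h.smooth_x i
  have sa := fun k i => contDiffOn_pd hΩ (h.smooth_a k) i
  -- the coefficients of `α₂`, `α₃`, `⟨da₂, a₃⟩`, `-⟨da₂, a₄⟩`, `-⟨da₃, a₄⟩`
  let α : Fin 2 → E2 → ℝ := fun i z => mink (pd i x z) (a 1 z)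
  let β : Fin 2 → E2 → ℝ := fun i z => mink (pd i x z) (a 2 z)
  let η : Fin 2 → E2 → ℝ := fun i z => mink (pd i (a 1) z) (a 2 z)
  let π : Fin 2 → E2 → ℝ := fun i z => -mink (pd i (a 1) z) (a 3 z)
  let π' : Fin 2 → E2 → ℝ := fun i z => -mink (pd i (a 2) z) (a 3 z)
  have sα : ∀ i, ContDiffOn ℝ ∞ (α i) Ω := fun i => (sx i).mink (h.smooth_a 1)
  have sβ : ∀ i, ContDiffOn ℝ ∞ (β i) Ω := fun i => (sx i).mink (h.smooth_a 2)
  have sη : ∀ i, ContDiffOn ℝ ∞ (η i) Ω := fun i => (sa 1 i).mink (h.smooth_a 2)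
  have sπ : ∀ i, ContDiffOn ℝ ∞ (π i) Ω := fun i => ((sa 1 i).mink (h.smooth_a 3)).neg
  have sπ' : ∀ i, ContDiffOn ℝ ∞ (π' i) Ω := fun i => ((sa 2 i).mink (h.smooth_a 3)).neg
  have sδ : ContDiffOn ℝ ∞ (fun z => α 0 z * β 1 z - α 1 z * β 0 z) Ω :=
    ((sα 0).mul (sβ 1)).sub ((sα 1).mul (sβ 0))
  refine ⟨fun z => (π 0 z * β 1 z - π 1 z * β 0 z) / (α 0 z * β 1 z - α 1 z * β 0 z),
    fun z => (α 0 z * π 1 z - α 1 z * π 0 z) / (α 0 z * β 1 z - α 1 z * β 0 z),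
    fun z => (α 0 z * π' 1 z - α 1 z * π' 0 z) / (α 0 z * β 1 z - α 1 z * β 0 z),
    fun z => (η 0 z * β 1 z - η 1 z * β 0 z) / (α 0 z * β 1 z - α 1 z * β 0 z),
    fun z => (α 0 z * η 1 z - α 1 z * η 0 z) / (α 0 z * β 1 z - α 1 z * β 0 z),
    (((sπ 0).mul (sβ 1)).sub ((sπ 1).mul (sβ 0))).div sδ hdet,
    (((sα 0).mul (sπ 1)).sub ((sα 1).mul (sπ 0))).div sδ hdet,
    (((sα 0).mul (sπ' 1)).sub ((sα 1).mul (sπ' 0))).div sδ hdet,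
    (((sη 0).mul (sβ 1)).sub ((sη 1).mul (sβ 0))).div sδ hdet,
    (((sα 0).mul (sη 1)).sub ((sα 1).mul (sη 0))).div sδ hdet, ?_⟩
  intro z hz
  have hδ : α 0 z * β 1 z - α 1 z * β 0 z ≠ 0 := hdet z hz
  set δ := α 0 z * β 1 z - α 1 z * β 0 z with hδdef
  have exp := expand_frame (h.gram_eq z hz) (h.oriented z hz).ne'
  -- skew-symmetry of the connection form
  have skew : ∀ i k l, mink (pd i (a k) z) (a l z) + mink (pd i (a l) z) (a k z) = 0 := by
    intro i k l
    rw [mink_comm (pd i (a l) z), ← pd_mink ((h.smooth_a k).diffAt hΩ hz)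
      ((h.smooth_a l).diffAt hΩ hz), pd_congr_on hΩ (fun y hy => h.gram_eq y hy k l) hz, pd_const]
  have diag : ∀ i k, mink (pd i (a k) z) (a k z) = 0 := by
    intro i k; have := skew i k k; linarith
  have ex : ∀ i, pd i x z = α i z • a 1 z + β i z • a 2 z := by
    intro i
    have := exp (pd i x z)
    rw [hx0 i z hz, hx3 i z hz] at this
    simpa using this
  let τ : Fin 2 → ℝ := fun i => -mink (pd i (a 0) z) (a 3 z)
  have e0 : ∀ i, pd i (a 0) z = τ i • a 0 z + α i z • a 1 z - β i z • a 2 z := by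
    intro i
    have := exp (pd i (a 0) z)
    rw [h01 i z hz, h02 i z hz, diag i 0] at this
    refine this.trans ?_
    simp only [τ, α, β]
    module
  have v10 : ∀ i, mink (pd i (a 1) z) (a 0 z) = -α i z := by
    intro i; have := skew i 1 0; rw [h01 i z hz] at this
    simp only [α]; linarith
  have v20 : ∀ i, mink (pd i (a 2) z) (a 0 z) = β i z := by
    intro i; have := skew i 2 0; rw [h02 i z hz] at this
    simp only [β]; linarith
  have v21 : ∀ i, mink (pd i (a 2) z) (a 1 z) = -η i z := by
    intro i; have := skew i 2 1
    simp only [η]; linarith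
  have v30 : ∀ i, mink (pd i (a 3) z) (a 0 z) = τ i := by
    intro i; have := skew i 3 0
    simp only [τ]; linarith
  have v31 : ∀ i, mink (pd i (a 3) z) (a 1 z) = π i z := by
    intro i; have := skew i 3 1
    simp only [π]; linarith
  have v32 : ∀ i, mink (pd i (a 3) z) (a 2 z) = π' i z := by
    intro i; have := skew i 3 2
    simp only [π']; linarith
  have e1 : ∀ i, pd i (a 1) z = π i z • a 0 z + η i z • a 2 z + α i z • a 3 z := by
    intro i
    have := exp (pd i (a 1) z)
    rw [diag i 1, v10 i] at this
    refine this.trans ?_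
    simp only [π, η]
    module
  have e2 : ∀ i, pd i (a 2) z = π' i z • a 0 z - η i z • a 1 z - β i z • a 3 z := by
    intro i
    have := exp (pd i (a 2) z)
    rw [diag i 2, v20 i, v21 i] at this
    refine this.trans ?_
    simp only [π']
    module
  have e3 : ∀ i, pd i (a 3) z = π i z • a 1 z + π' i z • a 2 z - τ i • a 3 z := by
    intro i
    have := exp (pd i (a 3) z)
    rw [diag i 3, v30 i, v31 i, v32 i] at this
    refine this.trans ?_
    module
  -- the integrability conditions
  have I : α 0 z * π 1 z + β 0 z * π' 1 z = α 1 z * π 0 z + β 1 z * π' 0 z := by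
    have := mink_pd_swap hΩ h.smooth_x (h.smooth_a 3) hx3 hz
    rw [ex 0, ex 1] at this
    simp only [mink_add_left, mink_smul_left, mink_comm (a 1 z), mink_comm (a 2 z), v31, v32]
      at this
    exact this
  have dx := fun {y} (hy : y ∈ Ω) => h.smooth_x.diffAt hΩ hy
  have d0 := fun {y} (hy : y ∈ Ω) => (h.smooth_a 0).diffAt hΩ hy
  have II : -(τ 0 * -α 1 z) + 2 * (β 0 z * η 1 z)
      = -(τ 1 * -α 0 z) + 2 * (β 1 z * η 0 z) := by
    have key := mink_pd_swap hΩ (u := fun y => x y - a 0 y) (h.smooth_x.sub (h.smooth_a 0))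
      (h.smooth_a 1) (by
        intro i y hy
        rw [pd_sub (dx hy) (d0 hy), mink_sub_left, h01 i y hy, sub_self]) hz
    rw [pd_sub (dx hz) (d0 hz), pd_sub (dx hz) (d0 hz), ex 0, ex 1, e0 0, e0 1] at key
    simp only [mink_sub_left, mink_add_left, mink_smul_left, mink_comm (a 0 z), mink_comm (a 1 z),
      mink_comm (a 2 z), v10, diag] at key
    simp only [η]
    linarith
  have III : τ 0 * β 1 z - 2 * (α 0 z * η 1 z) = τ 1 * β 0 z - 2 * (α 1 z * η 0 z) := by
    have key := mink_pd_swap hΩ (u := fun y => x y + a 0 y) (h.smooth_x.add (h.smooth_a 0))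
      (h.smooth_a 2) (by
        intro i y hy
        rw [pd_add (dx hy) (d0 hy), mink_add_left, h02 i y hy, add_neg_cancel]) hz
    rw [pd_add (dx hz) (d0 hz), pd_add (dx hz) (d0 hz), ex 0, ex 1, e0 0, e0 1] at key
    simp only [mink_sub_left, mink_add_left, mink_smul_left, mink_comm (a 0 z), mink_comm (a 1 z),
      mink_comm (a 2 z), v20, v21, diag] at key
    linarith
  intro i
  have Eη : (η 0 z * β 1 z - η 1 z * β 0 z) / δ * α i z
      + (α 0 z * η 1 z - α 1 z * η 0 z) / δ * β i z = η i z := by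
    rw [div_mul_eq_mul_div, div_mul_eq_mul_div, ← add_div, div_eq_iff hδ, hδdef]
    fin_cases i <;> simp <;> ring
  have Eπ : (π 0 z * β 1 z - π 1 z * β 0 z) / δ * α i z
      + (α 0 z * π 1 z - α 1 z * π 0 z) / δ * β i z = π i z := by
    rw [div_mul_eq_mul_div, div_mul_eq_mul_div, ← add_div, div_eq_iff hδ, hδdef]
    fin_cases i <;> simp <;> ring
  have Eπ' : (α 0 z * π 1 z - α 1 z * π 0 z) / δ * α i z
      + (α 0 z * π' 1 z - α 1 z * π' 0 z) / δ * β i z = π' i z := by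
    rw [div_mul_eq_mul_div, div_mul_eq_mul_div, ← add_div, div_eq_iff hδ, hδdef]
    fin_cases i <;> simp
    · linear_combination α 0 z * I
    · linear_combination α 1 z * I
  have Eτ : 2 * ((α 0 z * η 1 z - α 1 z * η 0 z) / δ) * α i z
      - 2 * ((η 0 z * β 1 z - η 1 z * β 0 z) / δ) * β i z = τ i := by
    rw [mul_div_assoc', mul_div_assoc', div_mul_eq_mul_div, div_mul_eq_mul_div, ← sub_div,
      div_eq_iff hδ, hδdef]
    fin_cases i <;> simp
    · linear_combination β 0 z * II - α 0 z * III
    · linear_combination β 1 z * II - α 1 z * III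
  simp only [α, β, π, π', η, δ] at *
  refine ⟨ex i, ?_, ?_, ?_, ?_⟩
  · rw [Eτ]; exact e0 i
  · rw [Eπ, Eη]; exact e1 i
  · rw [Eπ', Eη]; exact e2 i
  · rw [Eπ, Eπ', Eτ]; exact e3 i

/-! ### Square roots of directions and null frames -/

/-- A smooth square root of the direction of a nonvanishing complex function `a + i b`, near
a point. -/
lemma exists_half_angle {Ω : Set E2} (hΩ : IsOpen Ω) {a b : E2 → ℝ} (ha : ContDiffOn ℝ ∞ a Ω)
    (hb : ContDiffOn ℝ ∞ b Ω) {z₀ : E2} (hz₀ : z₀ ∈ Ω) (hne : 0 < a z₀ ^ 2 + b z₀ ^ 2) :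
    ∃ (Ω' : Set E2) (C S r : E2 → ℝ), IsOpen Ω' ∧ z₀ ∈ Ω' ∧ Ω' ⊆ Ω ∧ ContDiffOn ℝ ∞ C Ω' ∧
      ContDiffOn ℝ ∞ S Ω' ∧ ContDiffOn ℝ ∞ r Ω' ∧ ∀ z ∈ Ω', 0 < r z ∧ C z ^ 2 + S z ^ 2 = 1 ∧
        a z = r z * (C z ^ 2 - S z ^ 2) ∧ b z = r z * (2 * C z * S z) := by
  set w : ℂ := ⟨a z₀, b z₀⟩ with hw
  set r₀ := ‖w‖ with hr₀
  set C₀ := Real.cos (w.arg / 2)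
  set S₀ := Real.sin (w.arg / 2)
  have hCS : C₀ ^ 2 + S₀ ^ 2 = 1 := Real.cos_sq_add_sin_sq _
  have hr₀sq : r₀ ^ 2 = a z₀ ^ 2 + b z₀ ^ 2 := by
    rw [hr₀, Complex.sq_norm, Complex.normSq_apply]; simp [hw]; ring
  have hr₀pos : 0 < r₀ := by
    have : 0 ≤ r₀ := norm_nonneg w
    exact lt_of_le_of_ne this fun h => by rw [← h] at hr₀sq; norm_num at hr₀sq; linarith
  have ha₀ : a z₀ = r₀ * (C₀ ^ 2 - S₀ ^ 2) := by
    have h1 := Complex.norm_mul_cos_arg w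
    rw [show w.arg = 2 * (w.arg / 2) by ring, Real.cos_two_mul'] at h1
    exact h1.symm
  have hb₀ : b z₀ = r₀ * (2 * S₀ * C₀) := by
    have h1 := Complex.norm_mul_sin_arg w
    rw [show w.arg = 2 * (w.arg / 2) by ring, Real.sin_two_mul] at h1
    exact h1.symm
  have hn : ContDiffOn ℝ ∞ (fun z => a z ^ 2 + b z ^ 2) Ω := (ha.pow 2).add (hb.pow 2)
  set Ω₁ : Set E2 := Ω ∩ (fun z => a z ^ 2 + b z ^ 2) ⁻¹' Ioi 0 with hΩ₁
  have hΩ₁o : IsOpen Ω₁ := hn.continuousOn.isOpen_inter_preimage hΩ isOpen_Ioi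
  set r : E2 → ℝ := fun z => √(a z ^ 2 + b z ^ 2) with hr
  have hrs : ContDiffOn ℝ ∞ r Ω₁ := (hn.mono inter_subset_left).sqrt fun z hz => ne_of_gt hz.2
  have ha₁ := ha.mono (inter_subset_left : Ω₁ ⊆ Ω)
  have hb₁ := hb.mono (inter_subset_left : Ω₁ ⊆ Ω)
  -- with `ζ₀ = C₀ + i S₀`, a multiple of the square root is `X + i Y = r ζ₀ + (a + i b) conj ζ₀`
  set X : E2 → ℝ := fun z => r z * C₀ + a z * C₀ + b z * S₀ with hX
  set Y : E2 → ℝ := fun z => r z * S₀ + b z * C₀ - a z * S₀ with hY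
  have hXs : ContDiffOn ℝ ∞ X Ω₁ :=
    ((hrs.mul contDiffOn_const).add (ha₁.mul contDiffOn_const)).add (hb₁.mul contDiffOn_const)
  have hYs : ContDiffOn ℝ ∞ Y Ω₁ :=
    ((hrs.mul contDiffOn_const).add (hb₁.mul contDiffOn_const)).sub (ha₁.mul contDiffOn_const)
  have hm : ContDiffOn ℝ ∞ (fun z => X z ^ 2 + Y z ^ 2) Ω₁ := (hXs.pow 2).add (hYs.pow 2)
  set Ω₂ : Set E2 := Ω₁ ∩ (fun z => X z ^ 2 + Y z ^ 2) ⁻¹' Ioi 0 with hΩ₂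
  have hΩ₂o : IsOpen Ω₂ := hm.continuousOn.isOpen_inter_preimage hΩ₁o isOpen_Ioi
  have hms : ContDiffOn ℝ ∞ (fun z => √(X z ^ 2 + Y z ^ 2)) Ω₂ :=
    (hm.mono inter_subset_left).sqrt fun z hz => ne_of_gt hz.2
  have hmne : ∀ z ∈ Ω₂, √(X z ^ 2 + Y z ^ 2) ≠ 0 := fun z hz => (Real.sqrt_pos.2 hz.2).ne'
  refine ⟨Ω₂, fun z => X z / √(X z ^ 2 + Y z ^ 2), fun z => Y z / √(X z ^ 2 + Y z ^ 2), r, hΩ₂o,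
    ⟨⟨hz₀, hne⟩, ?_⟩, inter_subset_left.trans inter_subset_left,
    (hXs.mono inter_subset_left).div hms hmne, (hYs.mono inter_subset_left).div hms hmne,
    hrs.mono inter_subset_left, ?_⟩
  · have hrz : r z₀ = r₀ := by
      rw [hr]; simp only; rw [← hr₀sq, Real.sqrt_sq hr₀pos.le]
    have hXz : X z₀ = 2 * r₀ * C₀ := by
      simp only [hX, hrz]; rw [ha₀, hb₀]; linear_combination (r₀ * C₀) * hCS
    have hYz : Y z₀ = 2 * r₀ * S₀ := by
      simp only [hY, hrz]; rw [ha₀, hb₀]; linear_combination (r₀ * S₀) * hCS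
    show 0 < X z₀ ^ 2 + Y z₀ ^ 2
    have : X z₀ ^ 2 + Y z₀ ^ 2 = 4 * r₀ ^ 2 := by
      rw [hXz, hYz]; linear_combination (4 * r₀ ^ 2) * hCS
    rw [this]; positivity
  · intro z hz
    have hpos : 0 < X z ^ 2 + Y z ^ 2 := hz.2
    have hq : 0 < a z ^ 2 + b z ^ 2 := hz.1.2
    have hsq := Real.sq_sqrt hpos.le
    have hrr : r z ^ 2 = a z ^ 2 + b z ^ 2 := Real.sq_sqrt hq.le
    refine ⟨Real.sqrt_pos.2 hq, ?_, ?_, ?_⟩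
    · simp only [div_pow, hsq]; rw [← add_div, div_self hpos.ne']
    · simp only [div_pow, hsq]
      rw [← sub_div, mul_div_assoc', eq_div_iff hpos.ne']
      simp only [hX, hY]
      linear_combination (-(r z * (C₀ ^ 2 - S₀ ^ 2) + a z * (C₀ ^ 2 + S₀ ^ 2))) * hrr
    · have : 2 * (X z / √(X z ^ 2 + Y z ^ 2)) * (Y z / √(X z ^ 2 + Y z ^ 2))
          = 2 * X z * Y z / (X z ^ 2 + Y z ^ 2) := by
        rw [show 2 * (X z / √(X z ^ 2 + Y z ^ 2)) * (Y z / √(X z ^ 2 + Y z ^ 2))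
          = 2 * X z * Y z / √(X z ^ 2 + Y z ^ 2) ^ 2 by ring, hsq]
      rw [this, mul_div_assoc', eq_div_iff hpos.ne']
      simp only [hX, hY]
      linear_combination (-(r z * (2 * C₀ * S₀) + b z * (C₀ ^ 2 + S₀ ^ 2))) * hrr

section

variable {c : Fin 4 → Mink} (hc : IsNullBasis c)

/-- The middle frame over the middle position: `(C, S)` is the direction of a square root of
`a + i b`, the conjugate of `4 ∂_z² s`, and `r` its modulus, and `K`, `L` are the components along
`N` that make the second and the third vector tangent to the middle position. -/
noncomputable def nullFrame (c : Fin 4 → Mink) (C S r K L : E2 → ℝ) (i : Fin 4) (z : E2) : Mink :=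
  let a₁ : Mink := -K z • nulPt c z + (C z / √2) • nulX c z + (S z / √2) • nulY c z
  let a₂ : Mink := -L z • nulPt c z - (S z / √2) • nulX c z + (C z / √2) • nulY c z
  ![(r z / 4) • nulPt c z, a₁, a₂,
    (4 / r z) • (c 3 - K z • a₁ - L z • a₂ - ((K z ^ 2 + L z ^ 2) / 2) • nulPt c z)] i

include hc

lemma gram_nullFrame {C S r K L : E2 → ℝ} {z : E2} (hr : 0 < r z) (hCS : C z ^ 2 + S z ^ 2 = 1)
    (i j : Fin 4) : mink (nullFrame c C S r K L i z) (nullFrame c C S r K L j z) = gram i j := by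
  obtain ⟨g00, g01, g02, g03, g11, g12, g13, g22, g23, g33⟩ := gram_values
  have h2 : (√2 : ℝ) ^ 2 = 2 := Real.sq_sqrt (by norm_num)
  have key : ∀ i j : Fin 4, i ≤ j →
      mink (nullFrame c C S r K L i z) (nullFrame c C S r K L j z) = gram i j := by
    intro i j hij
    fin_cases i <;> fin_cases j <;> first
    | (exfalso; revert hij; decide)
    | (simp only [nullFrame, Fin.zero_eta, Fin.mk_one, Fin.reduceFinMk, Matrix.cons_val, g00, g01,
        g02, g03, g11, g12, g13, g22, g23, g33, mink_add_left,
        mink_add_right, mink_sub_left, mink_sub_right, mink_smul_left, mink_smul_right, hc.mink_pp,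
        hc.mink_px, hc.mink_py, hc.mink_pz, hc.mink_xp, hc.mink_xx, hc.mink_xy, hc.mink_xz,
        hc.mink_yp, hc.mink_yx, hc.mink_yy, hc.mink_yz, hc.mink_zp, hc.mink_zx, hc.mink_zy, hc.c33]
       field_simp
       first
       | ring1
       | linear_combination 2 * hCS - h2
       | linear_combination hCS - (1 / 2) * h2
       | linear_combination (2 : ℝ) * hCS - (1 : ℝ) * h2
       | (rw [h2]; linear_combination 2 * hCS)
       | (ring_nf; linear_combination (8 * K z) * h2 - (16 * K z) * hCS)
       | (ring_nf; linear_combination (8 * L z) * h2 - (16 * L z) * hCS)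
       | (ring_nf; linear_combination (128 * (K z ^ 2 + L z ^ 2)) * hCS -
          (64 * (K z ^ 2 + L z ^ 2)) * h2))
  rcases le_total i j with h | h
  · exact key i j h
  · rw [mink_comm, gram_comm]; exact key j i h

lemma oriented_nullFrame {C S r K L : E2 → ℝ} {z : E2} (hr : 0 < r z)
    (hCS : C z ^ 2 + S z ^ 2 = 1) :
    0 < (Matrix.of fun i j => nullFrame c C S r K L i z j).det := by
  have h2 : (√2 : ℝ) ^ 2 = 2 := Real.sq_sqrt (by norm_num)
  let U : Matrix (Fin 4) (Fin 4) ℝ := !![1, z 0, z 1, z 0 ^ 2 + z 1 ^ 2; 0, 1, 0, 2 * z 0;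
    0, 0, 1, 2 * z 1; 0, 0, 0, 1]
  let k : ℝ := (4 / r z)
  let B : Matrix (Fin 4) (Fin 4) ℝ := !![r z / 4, 0, 0, 0; -K z, C z / √2, S z / √2, 0;
    -L z, -(S z / √2), C z / √2, 0;
    k * (K z ^ 2 + L z ^ 2 - (K z ^ 2 + L z ^ 2) / 2), k * (L z * (S z / √2) - K z * (C z / √2)),
    k * (-(K z * (S z / √2)) - L z * (C z / √2)), k]
  have hB : B.det = 1 / 2 := by
    simp only [B, k, Matrix.det_succ_row_zero, Fin.sum_univ_succ]
    simp [Fin.succAbove]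
    field_simp
    rw [h2]
    linear_combination 2 * hCS
  have hU : U.det = 1 := by
    simp [U, Matrix.det_succ_row_zero, Fin.sum_univ_succ, Fin.succAbove]
  have hA : ∀ i, nullFrame c C S r K L i z = ∑ l, (B * U) i l • c l := by
    intro i
    fin_cases i <;>
    simp [nullFrame, B, U, k, Matrix.mul_apply, Fin.sum_univ_four, nulPt, nulX, nulY] <;> module
  simp only [hA]
  rw [hc.det_combination, Matrix.det_mul, hB, hU]
  norm_num

end

/-! ### A middle frame over the middle position -/

lemma contDiffOn_nullFrame {Ω : Set E2} (c : Fin 4 → Mink) {C S r K L : E2 → ℝ}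
    (hC : ContDiffOn ℝ ∞ C Ω) (hS : ContDiffOn ℝ ∞ S Ω) (hr : ContDiffOn ℝ ∞ r Ω)
    (hK : ContDiffOn ℝ ∞ K Ω) (hL : ContDiffOn ℝ ∞ L Ω) (hr0 : ∀ z ∈ Ω, r z ≠ 0) (i : Fin 4) :
    ContDiffOn ℝ ∞ (nullFrame c C S r K L i) Ω := by
  have hN := (contDiff_nulPt c).contDiffOn (s := Ω)
  have hX := (contDiff_nulX c).contDiffOn (s := Ω)
  have hY := (contDiff_nulY c).contDiffOn (s := Ω)
  have h1 : ContDiffOn ℝ ∞ (fun z => -K z • nulPt c z + (C z / √2) • nulX c z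
      + (S z / √2) • nulY c z) Ω :=
    ((hK.neg.smul hN).add ((hC.div_const _).smul hX)).add ((hS.div_const _).smul hY)
  have h2 : ContDiffOn ℝ ∞ (fun z => -L z • nulPt c z - (S z / √2) • nulX c z
      + (C z / √2) • nulY c z) Ω :=
    ((hL.neg.smul hN).sub ((hS.div_const _).smul hX)).add ((hC.div_const _).smul hY)
  fin_cases i
  · exact (hr.div_const _).smul hN
  · exact h1
  · exact h2
  · exact (contDiffOn_const.div hr hr0).smul
      (((contDiffOn_const.sub (hK.smul h1)).sub (hL.smul h2)).sub
        ((((hK.pow 2).add (hL.pow 2)).div_const _).smul hN))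

section

variable {c : Fin 4 → Mink} (hc : IsNullBasis c) {C S r K L : E2 → ℝ} (z : E2)

include hc

lemma mink_nulX_nullFrame_one : mink (nulX c z) (nullFrame c C S r K L 1 z) = √2 * C z := by
  have h2 : (√2 : ℝ) ^ 2 = 2 := Real.sq_sqrt (by norm_num)
  simp only [nullFrame, Matrix.cons_val, mink_add_right, mink_smul_right, hc.mink_xp, hc.mink_xx,
    hc.mink_xy]
  field_simp
  linear_combination (-C z) * h2

lemma mink_nulY_nullFrame_one : mink (nulY c z) (nullFrame c C S r K L 1 z) = √2 * S z := by
  have h2 : (√2 : ℝ) ^ 2 = 2 := Real.sq_sqrt (by norm_num)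
  simp only [nullFrame, Matrix.cons_val, mink_add_right, mink_smul_right, hc.mink_yp, hc.mink_yx,
    hc.mink_yy]
  field_simp
  linear_combination (-S z) * h2

lemma mink_nulX_nullFrame_two : mink (nulX c z) (nullFrame c C S r K L 2 z) = -(√2 * S z) := by
  have h2 : (√2 : ℝ) ^ 2 = 2 := Real.sq_sqrt (by norm_num)
  simp only [nullFrame, Matrix.cons_val, mink_add_right, mink_sub_right, mink_smul_right,
    hc.mink_xp, hc.mink_xx, hc.mink_xy]
  field_simp
  linear_combination (S z) * h2

lemma mink_nulY_nullFrame_two : mink (nulY c z) (nullFrame c C S r K L 2 z) = √2 * C z := by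
  have h2 : (√2 : ℝ) ^ 2 = 2 := Real.sq_sqrt (by norm_num)
  simp only [nullFrame, Matrix.cons_val, mink_add_right, mink_sub_right, mink_smul_right,
    hc.mink_yp, hc.mink_yx, hc.mink_yy]
  field_simp
  linear_combination (-C z) * h2

lemma mink_nulPt_nullFrame_one : mink (nulPt c z) (nullFrame c C S r K L 1 z) = 0 := by
  simp [nullFrame, mink_add_right, mink_neg_right, mink_smul_right, hc.mink_pp, hc.mink_px,
    hc.mink_py]

lemma mink_nulPt_nullFrame_two : mink (nulPt c z) (nullFrame c C S r K L 2 z) = 0 := by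
  simp [nullFrame, mink_add_right, mink_sub_right, mink_neg_right, mink_smul_right, hc.mink_pp,
    hc.mink_px, hc.mink_py]

end

lemma mink_nullFrame_three {c : Fin 4 → Mink} {C S r K L : E2 → ℝ} (z : E2)
    {v : Mink} (hv : mink v (nulPt c z) = 0) :
    mink v (nullFrame c C S r K L 3 z) = (4 / r z) * (mink v (c 3)
      - K z * mink v (nullFrame c C S r K L 1 z) - L z * mink v (nullFrame c C S r K L 2 z)) := by
  have h : nullFrame c C S r K L 3 z = (4 / r z) • (c 3 - K z • nullFrame c C S r K L 1 z
      - L z • nullFrame c C S r K L 2 z - ((K z ^ 2 + L z ^ 2) / 2) • nulPt c z) := rfl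
  rw [h]
  simp only [mink_sub_right, mink_smul_right, hv]
  ring

section

variable {Ω : Set E2} (hΩ : IsOpen Ω) {s : E2 → ℝ} (hs : ContDiffOn ℝ ∞ s Ω) {z : E2} (hz : z ∈ Ω)
  {c : Fin 4 → Mink} (hc : IsNullBasis c)

include hΩ hs hz hc

lemma mink_pd_middlePos_nulPt (i : Fin 2) : mink (pd i (middlePos c s) z) (nulPt c z) = 0 := by
  fin_cases i
  · simp [pd_zero_middlePos hΩ hs hz, mink_add_left, mink_neg_left, mink_smul_left, hc.mink_pp,
      hc.mink_xp, hc.mink_yp]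
  · simp [pd_one_middlePos hΩ hs hz, mink_add_left, mink_sub_left, mink_neg_left, mink_smul_left,
      hc.mink_pp, hc.mink_xp, hc.mink_yp]

lemma mink_pd_middlePos_c3 (i : Fin 2) :
    mink (pd i (middlePos c s) z) (c 3) = pd i (quarterLap s) z := by
  fin_cases i
  · simp [pd_zero_middlePos hΩ hs hz, mink_add_left, mink_neg_left, mink_smul_left, hc.mink_pz,
      hc.mink_xz, hc.mink_yz]
  · simp [pd_one_middlePos hΩ hs hz, mink_add_left, mink_sub_left, mink_neg_left, mink_smul_left,
      hc.mink_pz, hc.mink_xz, hc.mink_yz]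

end

/-- Over the middle position of a function `s` without umbilics there is a frame field that
satisfies the equations of a middle frame. -/
lemma exists_isPlaneFrame_middlePos {Ω : Set E2} (hΩ : IsOpen Ω) {s : E2 → ℝ}
    (hs : ContDiffOn ℝ ∞ s Ω) {c : Fin 4 → Mink} (hc : IsNullBasis c) {z₀ : E2} (hz₀ : z₀ ∈ Ω)
    (hne : 0 < hessDiff s z₀ ^ 2 + hessMix s z₀ ^ 2) :
    ∃ (Ω' : Set E2) (a : Fin 4 → E2 → Mink), IsOpen Ω' ∧ z₀ ∈ Ω' ∧ Ω' ⊆ Ω ∧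
      IsPlaneFrame Ω' (middlePos c s) a ∧ (∀ z ∈ Ω', ∃ ρ : ℝ, 0 < ρ ∧ a 0 z = ρ • nulPt c z) ∧
      ∃ p₁ p₂ p₃ q₁ q₂ : E2 → ℝ, ContDiffOn ℝ ∞ p₁ Ω' ∧ ContDiffOn ℝ ∞ p₂ Ω' ∧
      ContDiffOn ℝ ∞ p₃ Ω' ∧ ContDiffOn ℝ ∞ q₁ Ω' ∧ ContDiffOn ℝ ∞ q₂ Ω' ∧
      ∀ z ∈ Ω', ∀ i : Fin 2,
      let α : ℝ := mink (pd i (middlePos c s) z) (a 1 z)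
      let β : ℝ := mink (pd i (middlePos c s) z) (a 2 z)
      pd i (middlePos c s) z = α • a 1 z + β • a 2 z ∧
      pd i (a 0) z = (2 * q₂ z * α - 2 * q₁ z * β) • a 0 z + α • a 1 z - β • a 2 z ∧
      pd i (a 1) z = (p₁ z * α + p₂ z * β) • a 0 z + (q₁ z * α + q₂ z * β) • a 2 z + α • a 3 z ∧
      pd i (a 2) z = (p₂ z * α + p₃ z * β) • a 0 z - (q₁ z * α + q₂ z * β) • a 1 z - β • a 3 z ∧
      pd i (a 3) z = (p₁ z * α + p₂ z * β) • a 1 z + (p₂ z * α + p₃ z * β) • a 2 z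
        - (2 * q₂ z * α - 2 * q₁ z * β) • a 3 z := by
  have h2 : (√2 : ℝ) ^ 2 = 2 := Real.sq_sqrt (by norm_num)
  obtain ⟨Ω', C, S, r, hΩ', hz', hsub, hC, hS, hr, hCSr⟩ :=
    exists_half_angle hΩ (contDiffOn_hessDiff hΩ hs) (contDiffOn_hessMix hΩ hs) hz₀ hne
  have hs' := hs.mono hsub
  have hD := fun i => contDiffOn_pd hΩ' (contDiffOn_quarterLap hΩ' hs') i
  have hr0 : ∀ z ∈ Ω', r z ≠ 0 := fun z hz => (hCSr z hz).1.ne'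
  set K : E2 → ℝ := fun z =>
    2 * √2 / r z * (C z * pd 0 (quarterLap s) z + S z * pd 1 (quarterLap s) z) with hK
  set L : E2 → ℝ := fun z =>
    2 * √2 / r z * (S z * pd 0 (quarterLap s) z - C z * pd 1 (quarterLap s) z) with hL
  have hKs : ContDiffOn ℝ ∞ K Ω' :=
    (contDiffOn_const.div hr hr0).mul ((hC.mul (hD 0)).add (hS.mul (hD 1)))
  have hLs : ContDiffOn ℝ ∞ L Ω' :=
    (contDiffOn_const.div hr hr0).mul ((hS.mul (hD 0)).sub (hC.mul (hD 1)))
  have hframe : IsPlaneFrame Ω' (middlePos c s) (nullFrame c C S r K L) :=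
    { smooth_x := contDiffOn_middlePos hΩ' hs' c
      smooth_a := contDiffOn_nullFrame c hC hS hr hKs hLs hr0
      gram_eq := fun z hz => gram_nullFrame hc (hCSr z hz).1 (hCSr z hz).2.1
      oriented := fun z hz => oriented_nullFrame hc (hCSr z hz).1 (hCSr z hz).2.1 }
  have hα0 : ∀ z ∈ Ω', mink (pd 0 (middlePos c s) z) (nullFrame c C S r K L 1 z)
      = √2 * r z * C z / 4 := by
    intro z hz
    obtain ⟨-, hcs, ha, hb⟩ := hCSr z hz
    simp only [pd_zero_middlePos hΩ' hs' hz, mink_add_left, mink_smul_left,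
      mink_nulPt_nullFrame_one hc, mink_nulX_nullFrame_one hc, mink_nulY_nullFrame_one hc, ha, hb]
    linear_combination (√2 * r z * C z / 4) * hcs
  have hβ0 : ∀ z ∈ Ω', mink (pd 0 (middlePos c s) z) (nullFrame c C S r K L 2 z)
      = √2 * r z * S z / 4 := by
    intro z hz
    obtain ⟨-, hcs, ha, hb⟩ := hCSr z hz
    simp only [pd_zero_middlePos hΩ' hs' hz, mink_add_left, mink_smul_left,
      mink_nulPt_nullFrame_two hc, mink_nulX_nullFrame_two hc, mink_nulY_nullFrame_two hc, ha, hb]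
    linear_combination (√2 * r z * S z / 4) * hcs
  have hα1 : ∀ z ∈ Ω', mink (pd 1 (middlePos c s) z) (nullFrame c C S r K L 1 z)
      = √2 * r z * S z / 4 := by
    intro z hz
    obtain ⟨-, hcs, ha, hb⟩ := hCSr z hz
    simp only [pd_one_middlePos hΩ' hs' hz, mink_add_left, mink_sub_left, mink_smul_left,
      mink_nulPt_nullFrame_one hc, mink_nulX_nullFrame_one hc, mink_nulY_nullFrame_one hc, ha, hb]
    linear_combination (√2 * r z * S z / 4) * hcs
  have hβ1 : ∀ z ∈ Ω', mink (pd 1 (middlePos c s) z) (nullFrame c C S r K L 2 z)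
      = -(√2 * r z * C z / 4) := by
    intro z hz
    obtain ⟨-, hcs, ha, hb⟩ := hCSr z hz
    simp only [pd_one_middlePos hΩ' hs' hz, mink_add_left, mink_sub_left, mink_smul_left,
      mink_nulPt_nullFrame_two hc, mink_nulX_nullFrame_two hc, mink_nulY_nullFrame_two hc, ha, hb]
    linear_combination (-(√2 * r z * C z / 4)) * hcs
  have hp : ∀ i, ∀ z ∈ Ω', mink (pd i (middlePos c s) z) (nulPt c z) = 0 := fun i z hz =>
    mink_pd_middlePos_nulPt hΩ' hs' hz hc i
  have hd : ∀ i, ∀ z ∈ Ω', pd i (nullFrame c C S r K L 0) z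
      = pd i (fun y => r y / 4) z • nulPt c z + (r z / 4) • pd i (nulPt c) z := fun i z hz =>
    pd_smul ((hr.div_const 4).diffAt hΩ' hz) (differentiableAt_nulPt c z) i
  refine ⟨Ω', nullFrame c C S r K L, hΩ', hz', hsub, hframe, fun z hz =>
    ⟨r z / 4, by have := (hCSr z hz).1; positivity, rfl⟩,
    hframe.exists_structure_functions hΩ' ?_ ?_ ?_ ?_ ?_⟩
  · intro i z hz
    simp only [nullFrame, Matrix.cons_val, mink_smul_right, hp i z hz, mul_zero]
  · intro i z hz
    obtain ⟨hrz, hcs, -, -⟩ := hCSr z hz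
    rw [mink_nullFrame_three z (hp i z hz)]
    fin_cases i
    · have h3 := mink_pd_middlePos_c3 hΩ' hs' hz hc 0
      simp only [Fin.zero_eta, hα0 z hz, hβ0 z hz, h3]
      simp only [hK, hL]
      field_simp
      linear_combination (-2 * pd 0 (quarterLap s) z * (C z ^ 2 + S z ^ 2)) * h2
        - 4 * pd 0 (quarterLap s) z * hcs
    · have h3 := mink_pd_middlePos_c3 hΩ' hs' hz hc 1
      simp only [Fin.mk_one, hα1 z hz, hβ1 z hz, h3]
      simp only [hK, hL]
      field_simp
      linear_combination (-2 * pd 1 (quarterLap s) z * (C z ^ 2 + S z ^ 2)) * h2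
        - 4 * pd 1 (quarterLap s) z * hcs
  · intro i z hz
    rw [hd i z hz, mink_add_left, mink_smul_left, mink_smul_left, mink_nulPt_nullFrame_one hc]
    fin_cases i
    · simp only [Fin.zero_eta, pd_zero_nulPt, mink_nulX_nullFrame_one hc, hα0 z hz]; ring
    · simp only [Fin.mk_one, pd_one_nulPt, mink_nulY_nullFrame_one hc, hα1 z hz]; ring
  · intro i z hz
    rw [hd i z hz, mink_add_left, mink_smul_left, mink_smul_left, mink_nulPt_nullFrame_two hc]
    fin_cases i
    · simp only [Fin.zero_eta, pd_zero_nulPt, mink_nulX_nullFrame_two hc, hβ0 z hz]; ring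
    · simp only [Fin.mk_one, pd_one_nulPt, mink_nulY_nullFrame_two hc, hβ1 z hz]; ring
  · intro z hz
    obtain ⟨hrz, hcs, -, -⟩ := hCSr z hz
    rw [hα0 z hz, hβ0 z hz, hα1 z hz, hβ1 z hz]
    have : √2 * r z * C z / 4 * -(√2 * r z * C z / 4) - √2 * r z * S z / 4 * (√2 * r z * S z / 4)
        = -(r z ^ 2 / 8) := by
      linear_combination (-(r z ^ 2 / 16) * (C z ^ 2 + S z ^ 2)) * h2 - (r z ^ 2 / 8) * hcs
    rw [this]
    have := pow_pos hrz 2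
    linarith

/-! ### Middle frames of Legendre immersions and the L-Gauss map -/

lemma planeVec_mem_posCone {n : E3} (hn : ‖n‖ = 1) : planeVec n ∈ posCone := by
  have h1 : n 0 ^ 2 + n 1 ^ 2 + n 2 ^ 2 = 1 := by
    have h := EuclideanSpace.norm_sq_eq n
    rw [hn, Fin.sum_univ_three] at h
    simpa [Real.norm_eq_abs, sq_abs] using h.symm
  have h2 : (√2 : ℝ) ^ 2 = 2 := Real.sq_sqrt (by norm_num)
  constructor
  · simp only [mink, planeVec, Matrix.cons_val]
    field_simp
    rw [h2]
    linear_combination 4 * h1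
  · simp only [mink, planeVec, Matrix.cons_val]
    linarith

lemma smul_mem_posCone {v : Mink} (hv : v ∈ posCone) {t : ℝ} (ht : 0 < t) : t • v ∈ posCone := by
  obtain ⟨h1, h2⟩ := hv
  exact ⟨by rw [mink_smul_left, mink_smul_right, h1]; ring,
    by rw [mink_smul_left]; exact mul_neg_of_pos_of_neg ht h2⟩

lemma ne_zero_of_mem_posCone {v : Mink} (hv : v ∈ posCone) : v ≠ 0 := by
  rintro rfl
  have := hv.2
  rw [mink_zero_left] at this
  exact lt_irrefl _ this

lemma line_eq_line {x y v w : Mink} {t k : ℝ} (hx : x = y + t • v) (hw : w = k • v) (hk : k ≠ 0) :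
    line x w = line y v := by
  subst hx hw
  ext p
  constructor
  · rintro ⟨r, rfl⟩
    exact ⟨t + r * k, by module⟩
  · rintro ⟨r, rfl⟩
    refine ⟨(r - t) / k, ?_⟩
    rw [smul_smul, div_mul_cancel₀ _ hk]
    module

lemma exists_of_line_eq_line {x y v w : Mink} (h : line x w = line y v) (hv : v ≠ 0) :
    ∃ t k : ℝ, y = x + t • w ∧ v = k • w ∧ k ≠ 0 := by
  obtain ⟨t, ht⟩ : y ∈ line x w := h ▸ ⟨0, by simp⟩
  obtain ⟨r, hr⟩ : y + v ∈ line x w := h ▸ ⟨1, by simp⟩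
  have h1 : v = (r - t) • w := by
    rw [ht] at hr
    have : v = x + r • w - (x + t • w) := by rw [← hr]; simp
    rw [this]
    module
  refine ⟨t, r - t, ht, h1, fun h0 => hv ?_⟩
  rw [h1, h0, zero_smul]

section

variable {M : Type*} [TopologicalSpace M] [ChartedSpace E2 M]

lemma LegendreImmersion.IsMiddleFrameOn.mono {F : LegendreImmersion M} {U V : Set M}
    {A : FrameField M} (h : F.IsMiddleFrameOn U A) (hV : V ⊆ U) : F.IsMiddleFrameOn V A := by
  obtain ⟨hA, p₁, p₂, p₃, q₁, q₂, h1, h2, h3, h4, h5, h6⟩ := h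
  exact ⟨⟨hA.smooth_x.mono hV, fun i => (hA.smooth_a i).mono hV, fun p hp => hA.gram_eq p (hV hp),
    fun p hp => hA.oriented p (hV hp), fun p hp => hA.first_mem p (hV hp),
    fun p hp => hA.last_mem p (hV hp), fun p hp => hA.along p (hV hp)⟩, p₁, p₂, p₃, q₁, q₂,
    h1.mono hV, h2.mono hV, h3.mono hV, h4.mono hV, h5.mono hV, fun p hp => h6 p (hV hp)⟩

variable {F : LegendreImmersion M} {c : Fin 4 → Mink}
  {e : OpenPartialHomeomorph M E2}

namespace IsStereoChart

variable (h : IsStereoChart F c e)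

include h

/-- The middle position lies on the isotropic line of the contact element, since both have the
pairings `s`, `∂₀ s`, `∂₁ s` with the null paraboloid and its derivatives. -/
lemma middlePos_eq {z : E2} (hz : z ∈ e.target) : ∃ t : ℝ,
    middlePos c (support F c e) z = centerL (F.f (e.symm z)) + t • nulPt c z := by
  have hc := h.basis
  have h0 := h.pd_support hz 0
  have h1 := h.pd_support hz 1
  rw [pd_zero_nulPt] at h0
  rw [pd_one_nulPt] at h1
  have hd := hc.expand_moved (middlePos c (support F c e) z - centerL (F.f (e.symm z))) z
  refine ⟨-mink (middlePos c (support F c e) z - centerL (F.f (e.symm z))) (c 3), ?_⟩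
  have e1 : mink (middlePos c (support F c e) z - centerL (F.f (e.symm z))) (nulPt c z) = 0 := by
    rw [mink_sub_left, mink_middlePos_nulPt hc, support, sub_self]
  have e2 : mink (middlePos c (support F c e) z - centerL (F.f (e.symm z))) (nulX c z) = 0 := by
    rw [mink_sub_left, mink_middlePos_nulX hc, h0, sub_self]
  have e3 : mink (middlePos c (support F c e) z - centerL (F.f (e.symm z))) (nulY c z) = 0 := by
    rw [mink_sub_left, mink_middlePos_nulY hc, h1, sub_self]
  rw [e1, e2, e3] at hd
  rw [← sub_eq_iff_eq_add']
  refine hd.trans ?_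
  module

lemma nulPt_eq {z : E2} (hz : z ∈ e.target) :
    nulPt c z = (1 + z 0 ^ 2 + z 1 ^ 2) • planeVec (F.n (e.symm z)) := by
  rw [h.plane_eq z hz, smul_smul, mul_inv_cancel₀ (one_add_sq_pos z).ne', one_smul]

lemma nulPt_mem_posCone {z : E2} (hz : z ∈ e.target) : nulPt c z ∈ posCone := by
  rw [h.nulPt_eq hz]
  exact smul_mem_posCone (planeVec_mem_posCone (F.norm_n _)) (one_add_sq_pos z)

lemma exists_isMiddleFrameOn (hF : F.Nondegenerate) {p : M} (hp : p ∈ e.source) :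
    ∃ (U : Set M) (A : FrameField M), IsOpen U ∧ p ∈ U ∧ F.IsMiddleFrameOn U A := by
  have he := h.mem_atlas
  have hs := h.contDiffOn_support
  have hz₀ := e.map_source hp
  obtain ⟨Ω, a, hΩ, hpΩ, hsub, hframe, hρ, p₁, p₂, p₃, q₁, q₂, hp₁, hp₂, hp₃, hq₁, hq₂, heq⟩ :=
    exists_isPlaneFrame_middlePos e.open_target hs h.basis hz₀ (h.hess_ne_zero hz₀ hF)
  have hfirst : ∀ z ∈ Ω, a 0 z ∈ posCone := by
    intro z hz
    obtain ⟨ρ, hρ0, hρz⟩ := hρ z hz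
    rw [hρz]
    exact smul_mem_posCone (h.nulPt_mem_posCone (hsub hz)) hρ0
  have hmaps : MapsTo e (e.source ∩ e ⁻¹' Ω) Ω := fun q hq => hq.2
  have sm : ∀ {u : E2 → ℝ}, ContDiffOn ℝ ∞ u Ω →
      ContMDiffOn (𝓡 2) 𝓘(ℝ, ℝ) ∞ (u ∘ e) (e.source ∩ e ⁻¹' Ω) := fun hu =>
    contMDiffOn_of_chart he hu inter_subset_left hmaps fun q _ => rfl
  refine ⟨e.source ∩ e ⁻¹' Ω, ⟨middlePos c (support F c e) ∘ e, fun i => a i ∘ e⟩,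
    e.isOpen_inter_preimage hΩ, ⟨hp, hpΩ⟩, ?_, p₁ ∘ e, p₂ ∘ e, p₃ ∘ e, q₁ ∘ e, q₂ ∘ e, sm hp₁,
    sm hp₂, sm hp₃, sm hq₁, sm hq₂, ?_⟩
  · refine ⟨contMDiffOn_of_chart he hframe.smooth_x inter_subset_left hmaps fun q _ => rfl,
      fun i => contMDiffOn_of_chart he (hframe.smooth_a i) inter_subset_left hmaps fun q _ => rfl,
      fun q hq => hframe.gram_eq _ hq.2, fun q hq => hframe.oriented _ hq.2,
      fun q hq => hfirst _ hq.2, fun q hq => ?_, fun q hq => ?_⟩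
    · refine mem_posCone_of_mink_neg (hfirst _ hq.2) ?_ ?_
      · exact (hframe.gram_eq _ hq.2 3 3).trans gram_values.2.2.2.2.2.2.2.2.2
      · show mink (a 3 (e q)) (a 0 (e q)) < 0
        rw [hframe.gram_eq _ hq.2 3 0, gram_comm, gram_values.2.2.2.1]
        norm_num
    · obtain ⟨ρ, hρ0, hρz⟩ := hρ _ hq.2
      obtain ⟨t, ht⟩ := h.middlePos_eq (e.map_source hq.1)
      have hN := h.nulPt_eq (e.map_source hq.1)
      rw [e.left_inv hq.1] at ht hN
      rw [hN, smul_smul] at ht hρz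
      exact line_eq_line ht hρz (mul_pos hρ0 (one_add_sq_pos _)).ne'
  · intro q hq X
    have hdx := mfderiv_eq_fderiv_of_chart he hq.1 (u := middlePos c (support F c e) ∘ e)
      Filter.EventuallyEq.rfl (hframe.smooth_x.diffAt hΩ hq.2) X
    have hda := fun i => mfderiv_eq_fderiv_of_chart he hq.1 (u := a i ∘ e)
      Filter.EventuallyEq.rfl ((hframe.smooth_a i).diffAt hΩ hq.2) X
    intro dx da α₂ α₃
    have hdx' : dx = _ := hdx
    have hda' : ∀ i, da i = _ := hda
    rw [fderiv_eq_pd] at hdx'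
    simp only [fderiv_eq_pd] at hda'
    have e0 := heq _ hq.2 0
    have e1 := heq _ hq.2 1
    have hα₂ : α₂ = mink dx (a 1 (e q)) := rfl
    have hα₃ : α₃ = mink dx (a 2 (e q)) := rfl
    rw [hdx', mink_add_left, mink_smul_left, mink_smul_left] at hα₂ hα₃
    simp only at e0 e1
    clear_value dx da α₂ α₃
    generalize mink (pd 0 (middlePos c (support F c e)) (e q)) (a 1 (e q)) = α0 at *
    generalize mink (pd 1 (middlePos c (support F c e)) (e q)) (a 1 (e q)) = α1 at *
    generalize mink (pd 0 (middlePos c (support F c e)) (e q)) (a 2 (e q)) = β0 at *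
    generalize mink (pd 1 (middlePos c (support F c e)) (e q)) (a 2 (e q)) = β1 at *
    obtain ⟨e00, e01, e02, e03, e04⟩ := e0
    obtain ⟨e10, e11, e12, e13, e14⟩ := e1
    rw [hdx', hda', hda', hda', hda', e00, e01, e02, e03, e04, e10, e11, e12, e13, e14, hα₂, hα₃]
    simp only [Function.comp_apply]
    refine ⟨?_, ?_, ?_, ?_, ?_⟩ <;> module

/-- The position vector of a middle frame is the middle position of the support function. -/
lemma eq_middlePos_of_isMiddleFrameOn {U : Set M} (hU : IsOpen U) {A : FrameField M}
    (hA : F.IsMiddleFrameOn U A) {q : M} (hqU : q ∈ U) (hq : q ∈ e.source) :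
    A.x q = middlePos c (support F c e) (e q) ∧ ∃ ρ : ℝ, A.a 0 q = ρ • nulPt c (e q) := by
  obtain ⟨g00, g01, g02, g03, g11, g12, g13, g22, g23, g33⟩ := gram_values
  have hc := h.basis
  have he := h.mem_atlas
  obtain ⟨hA, p₁, p₂, p₃, q₁, q₂, -, -, -, -, -, heq⟩ := hA
  set Ω := e.target ∩ e.symm ⁻¹' U with hΩdef
  have hΩ : IsOpen Ω := e.isOpen_inter_preimage_symm hU
  have hs := h.contDiffOn_support.mono (inter_subset_left : Ω ⊆ e.target)
  set s := support F c e with hsdef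
  set x := A.x ∘ e.symm with hx
  set a₀ := A.a 0 ∘ e.symm with ha₀
  have hxs : ContDiffOn ℝ ∞ x Ω := contDiffOn_chart he hA.smooth_x
  have has : ContDiffOn ℝ ∞ a₀ Ω := contDiffOn_chart he (hA.smooth_a 0)
  have hNs := (contDiff_nulPt c).contDiffOn (s := Ω)
  -- the direction of the line
  have hline : ∀ z ∈ Ω, a₀ z = -mink (a₀ z) (c 3) • nulPt c z ∧ mink (a₀ z) (c 3) ≠ 0 ∧
      mink (x z) (nulPt c z) = s z := by
    intro z hz
    obtain ⟨t, k, ht, hk, hk0⟩ := exists_of_line_eq_line (hA.along _ hz.2)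
      (ne_zero_of_mem_posCone (planeVec_mem_posCone (F.norm_n _)))
    have h1 : nulPt c z = ((1 + z 0 ^ 2 + z 1 ^ 2) * k) • a₀ z := by
      rw [h.nulPt_eq hz.1, hk, smul_smul]; rfl
    have hm : (1 + z 0 ^ 2 + z 1 ^ 2) * k ≠ 0 := mul_ne_zero (one_add_sq_pos z).ne' hk0
    have h2 : a₀ z = ((1 + z 0 ^ 2 + z 1 ^ 2) * k)⁻¹ • nulPt c z := by
      rw [h1, smul_smul, inv_mul_cancel₀ hm, one_smul]
    have h3 : mink (a₀ z) (c 3) = -((1 + z 0 ^ 2 + z 1 ^ 2) * k)⁻¹ := by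
      conv_lhs => rw [h2, mink_smul_left, hc.mink_pz]
      ring
    refine ⟨by rw [h3, neg_neg]; exact h2, by rw [h3]; exact neg_ne_zero.2 (inv_ne_zero hm), ?_⟩
    have h4 : s z = mink (sphereVec (F.f (e.symm z)) 0) (nulPt c z) := rfl
    have h5 : mink (A.a 0 (e.symm z)) (nulPt c z) = 0 := by
      change mink (a₀ z) (nulPt c z) = 0
      rw [h2, mink_smul_left, hc.mink_pp, mul_zero]
    rw [h4, ht, mink_add_left, mink_smul_left, h5, mul_zero, add_zero]
    rfl
  -- the equations of the frame, in the chart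
  have hfr : ∀ z ∈ Ω, ∀ i, ∃ α β κ : ℝ, pd i x z = α • A.a 1 (e.symm z) + β • A.a 2 (e.symm z) ∧
      pd i a₀ z = κ • a₀ z + α • A.a 1 (e.symm z) - β • A.a 2 (e.symm z) := by
    intro z hz i
    have hq' := e.map_target hz.1
    have hez := e.right_inv hz.1
    obtain ⟨X, hX⟩ := (chartDeriv_bijective he hq').2 (EuclideanSpace.single i 1)
    obtain ⟨h1, h2, -⟩ := heq _ hz.2 X
    have h3 : mfderiv (𝓡 2) 𝓘(ℝ, Mink) A.x (e.symm z) X = pd i x z := by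
      rw [mfderiv_eq_fderiv_chart he hq' (by rw [hez]; exact hxs.diffAt hΩ hz), hX, hez]
      rfl
    have h4 : mfderiv (𝓡 2) 𝓘(ℝ, Mink) (A.a 0) (e.symm z) X = pd i a₀ z := by
      rw [mfderiv_eq_fderiv_chart he hq' (by rw [hez]; exact has.diffAt hΩ hz), hX, hez]
      rfl
    exact ⟨_, _, _, h3.symm.trans h1, h4.symm.trans h2⟩
  have hx0 : ∀ z ∈ Ω, ∀ i, mink (pd i x z) (nulPt c z) = 0 := by
    intro z hz i
    obtain ⟨α, β, κ, h1, -⟩ := hfr z hz i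
    obtain ⟨h2, h3, -⟩ := hline z hz
    have h4 : mink (pd i x z) (a₀ z) = 0 := by
      have e1 : mink (A.a 1 (e.symm z)) (a₀ z) = 0 := by
        exact (hA.gram_eq _ hz.2 1 0).trans ((gram_comm _ _).trans g01)
      have e2 : mink (A.a 2 (e.symm z)) (a₀ z) = 0 := by
        exact (hA.gram_eq _ hz.2 2 0).trans ((gram_comm _ _).trans g02)
      rw [h1, mink_add_left, mink_smul_left, mink_smul_left, e1, e2]
      ring
    rw [h2, mink_smul_right] at h4
    exact (mul_eq_zero.1 h4).resolve_left (neg_ne_zero.2 h3)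
  have hx1 : ∀ i, ∀ z ∈ Ω, mink (x z) (pd i (nulPt c) z) = pd i s z := by
    intro i z hz
    have h1 := pd_congr_on hΩ (u := fun y => mink (x y) (nulPt c y)) (fun y hy => (hline y hy).2.2)
      hz i
    rw [pd_mink (hxs.diffAt hΩ hz) (differentiableAt_nulPt c z), hx0 z hz, zero_add] at h1
    exact h1
  have hzΩ : e q ∈ Ω := ⟨e.map_source hq, by simpa [e.left_inv hq] using hqU⟩
  set z := e q with hz
  have hezq : e.symm z = q := e.left_inv hq
  have hx2 : ∀ i, mink (pd i x z) (pd i (nulPt c) z) + mink (x z) (pd i (pd i (nulPt c)) z)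
      = pd i (pd i s) z := by
    intro i
    have h1 := pd_congr_on hΩ (u := fun y => mink (x y) (pd i (nulPt c) y)) (hx1 i) hzΩ i
    rwa [pd_mink (hxs.diffAt hΩ hzΩ) ((contDiffOn_pd hΩ hNs i).diffAt hΩ hzΩ)] at h1
  obtain ⟨hl1, hl2, hl3⟩ := hline z hzΩ
  obtain ⟨α0, β0, κ0, hx00, ha00⟩ := hfr z hzΩ 0
  obtain ⟨α1, β1, κ1, hx01, ha01⟩ := hfr z hzΩ 1
  -- the derivatives of `a₀ = ρ N`
  set ρ := fun y => -mink (a₀ y) (c 3) with hρ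
  have hρs : ContDiffOn ℝ ∞ ρ Ω := (has.mink contDiffOn_const).neg
  have hρN : ∀ i, pd i a₀ z = pd i ρ z • nulPt c z + ρ z • pd i (nulPt c) z := by
    intro i
    rw [pd_congr_on hΩ (fun y hy => (hline y hy).1) hzΩ i]
    exact pd_smul (hρs.diffAt hΩ hzΩ) (differentiableAt_nulPt c z) i
  have hρ0 : ρ z ≠ 0 := neg_ne_zero.2 hl2
  have G : ∀ i j, mink (A.a i (e.symm z)) (A.a j (e.symm z)) = gram i j := hA.gram_eq _ hzΩ.2
  have G' : ∀ i, mink (A.a i (e.symm z)) (a₀ z) = gram i 0 := fun i => G i 0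
  have G'' : ∀ i, mink (a₀ z) (A.a i (e.symm z)) = gram 0 i := fun i => G 0 i
  have G00 : mink (a₀ z) (a₀ z) = 0 := (G 0 0).trans g00
  have g10 : gram 1 0 = 0 := (gram_comm _ _).trans g01
  have g20 : gram 2 0 = 0 := (gram_comm _ _).trans g02
  have g21 : gram 2 1 = 0 := (gram_comm _ _).trans g12
  have N0 := hρN 0
  have N1 := hρN 1
  rw [pd_zero_nulPt] at N0
  rw [pd_one_nulPt] at N1
  have k00 : 2 * ρ z ^ 2 = α0 ^ 2 + β0 ^ 2 := by
    have e1 : mink (pd 0 a₀ z) (pd 0 a₀ z) = 2 * ρ z ^ 2 := by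
      rw [N0]
      simp only [mink_add_left, mink_add_right, mink_smul_left, mink_smul_right, hc.mink_pp,
        hc.mink_px, hc.mink_xp, hc.mink_xx]
      ring
    rw [← e1, ha00]
    simp only [mink_add_left, mink_add_right, mink_sub_left, mink_sub_right, mink_smul_left,
      mink_smul_right, G, G', G'', G00, g01, g02, g10, g20, g11, g22, g12, g21]
    ring
  have k11 : 2 * ρ z ^ 2 = α1 ^ 2 + β1 ^ 2 := by
    have e1 : mink (pd 1 a₀ z) (pd 1 a₀ z) = 2 * ρ z ^ 2 := by
      rw [N1]
      simp only [mink_add_left, mink_add_right, mink_smul_left, mink_smul_right, hc.mink_pp,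
        hc.mink_py, hc.mink_yp, hc.mink_yy]
      ring
    rw [← e1, ha01]
    simp only [mink_add_left, mink_add_right, mink_sub_left, mink_sub_right, mink_smul_left,
      mink_smul_right, G, G', G'', G00, g01, g02, g10, g20, g11, g22, g12, g21]
    ring
  have k01 : 0 = α0 * α1 + β0 * β1 := by
    have e1 : mink (pd 0 a₀ z) (pd 1 a₀ z) = 0 := by
      rw [N0, N1]
      simp only [mink_add_left, mink_add_right, mink_smul_left, mink_smul_right, hc.mink_pp,
        hc.mink_py, hc.mink_xp, hc.mink_xy]
      ring
    rw [← e1, ha00, ha01]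
    simp only [mink_add_left, mink_add_right, mink_sub_left, mink_sub_right, mink_smul_left,
      mink_smul_right, G, G', G'', G00, g01, g02, g10, g20, g11, g22, g12, g21]
    ring
  have m0 : ρ z * mink (pd 0 x z) (nulX c z) = α0 ^ 2 - β0 ^ 2 := by
    have e1 : mink (pd 0 x z) (pd 0 a₀ z) = ρ z * mink (pd 0 x z) (nulX c z) := by
      rw [N0, mink_add_right, mink_smul_right, mink_smul_right, hx0 z hzΩ]; ring
    rw [← e1, hx00, ha00]
    simp only [mink_add_left, mink_add_right, mink_sub_right, mink_smul_left,
      mink_smul_right, G, G', g10, g20, g11, g22, g12, g21]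
    ring
  have m1 : ρ z * mink (pd 1 x z) (nulY c z) = α1 ^ 2 - β1 ^ 2 := by
    have e1 : mink (pd 1 x z) (pd 1 a₀ z) = ρ z * mink (pd 1 x z) (nulY c z) := by
      rw [N1, mink_add_right, mink_smul_right, mink_smul_right, hx0 z hzΩ]; ring
    rw [← e1, hx01, ha01]
    simp only [mink_add_left, mink_add_right, mink_sub_right, mink_smul_left,
      mink_smul_right, G, G', g10, g20, g11, g22, g12, g21]
    ring
  -- the rows of the matrix of `α`, `β` are orthogonal of the same length, hence so are the columns
  have hrows : α0 ^ 2 - β0 ^ 2 + (α1 ^ 2 - β1 ^ 2) = 0 := by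
    have hk : 2 * ρ z ^ 2 ≠ 0 := by positivity
    have e1 : (2 * ρ z ^ 2) * (α0 ^ 2 - β1 ^ 2) = 0 := by
      linear_combination α0 ^ 2 * k11 - β1 ^ 2 * k00 - (α0 * α1 - β0 * β1) * k01
    have e2 : (2 * ρ z ^ 2) * (β0 ^ 2 - α1 ^ 2) = 0 := by
      linear_combination β0 ^ 2 * k11 - α1 ^ 2 * k00 + (α0 * α1 - β0 * β1) * k01
    linear_combination (mul_eq_zero.1 e1).resolve_left hk - (mul_eq_zero.1 e2).resolve_left hk
  have htr : mink (pd 0 x z) (nulX c z) + mink (pd 1 x z) (nulY c z) = 0 := by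
    refine (mul_eq_zero.1 (?_ : ρ z * _ = 0)).resolve_left hρ0
    linear_combination m0 + m1 + hrows
  have y0 := hx2 0
  have y1 := hx2 1
  have n0 : pd 0 (pd 0 (nulPt c)) z = (2 : ℝ) • c 3 := by
    rw [funext (pd_zero_nulPt c), pd_zero_nulX]
  have n1 : pd 1 (pd 1 (nulPt c)) z = (2 : ℝ) • c 3 := by
    rw [funext (pd_one_nulPt c), pd_one_nulY]
  rw [n0, mink_smul_right, pd_zero_nulPt] at y0
  rw [n1, mink_smul_right, pd_one_nulPt] at y1
  have hxq : x z = A.x q := congrArg A.x hezq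
  refine ⟨?_, ρ z, ?_⟩
  · rw [← hxq]
    refine eq_middlePos hc hl3 ?_ ?_ ?_
    · rw [← pd_zero_nulPt]; exact hx1 0 z hzΩ
    · rw [← pd_one_nulPt]; exact hx1 1 z hzΩ
    · rw [quarterLap]; linear_combination (y0 + y1 - htr) / 4
  · rw [← hezq]; exact hl1

lemma lGaussMap_eq (hF : F.Nondegenerate) {q : M} (hq : q ∈ e.source) :
    F.lGaussMap q = middlePos c (support F c e) (e q) := by
  obtain ⟨U, A, hU, hqU, hA⟩ := h.exists_isMiddleFrameOn hF hq
  obtain ⟨U', A', hU', hqU', hA', hx⟩ := Classical.epsilon_spec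
    (p := fun y : Mink => ∃ (U : Set M) (A : FrameField M), IsOpen U ∧ q ∈ U ∧
      F.IsMiddleFrameOn U A ∧ A.x q = y) ⟨A.x q, U, A, hU, hqU, hA, rfl⟩
  rw [← (h.eq_middlePos_of_isMiddleFrameOn hU' hA' hqU' hq).1, hx]
  rfl

end IsStereoChart

end

/-! ### Vectors orthogonal to the middle position -/

/-- The pairing of `v` with the null paraboloid, which is the support function of the constant
middle position `v`. -/
noncomputable def pairing (c : Fin 4 → Mink) (v : Mink) (z : E2) : ℝ := mink (nulPt c z) v

lemma contDiff_pairing (c : Fin 4 → Mink) (v : Mink) : ContDiff ℝ ∞ (pairing c v) := by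
  rw [← contDiffOn_univ]
  exact (contDiff_nulPt c).contDiffOn.mink contDiffOn_const

lemma pd_pairing (c : Fin 4 → Mink) (v : Mink) (i : Fin 2) (z : E2) :
    pd i (pairing c v) z = mink (pd i (nulPt c) z) v := by
  unfold pairing
  rw [pd_mink (differentiableAt_nulPt c z) (differentiableAt_const v), pd_const, mink_zero_right,
    add_zero]

lemma pd_zero_pairing (c : Fin 4 → Mink) (v : Mink) :
    pd 0 (pairing c v) = fun z => mink (nulX c z) v :=
  funext fun z => by rw [pd_pairing, pd_zero_nulPt]

lemma pd_one_pairing (c : Fin 4 → Mink) (v : Mink) :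
    pd 1 (pairing c v) = fun z => mink (nulY c z) v :=
  funext fun z => by rw [pd_pairing, pd_one_nulPt]

lemma pd_zero_pd_zero_pairing (c : Fin 4 → Mink) (v : Mink) (z : E2) :
    pd 0 (pd 0 (pairing c v)) z = 2 * mink (c 3) v := by
  rw [pd_zero_pairing, pd_mink (differentiableAt_nulX c z) (differentiableAt_const v), pd_const,
    mink_zero_right, pd_zero_nulX, mink_smul_left, add_zero]

lemma pd_zero_pd_one_pairing (c : Fin 4 → Mink) (v : Mink) (z : E2) :
    pd 0 (pd 1 (pairing c v)) z = 0 := by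
  rw [pd_one_pairing, pd_mink (differentiableAt_nulY c z) (differentiableAt_const v), pd_const,
    mink_zero_right, pd_zero_nulY, mink_zero_left, add_zero]

lemma pd_mul_add_mul {f u g w : E2 → ℝ} {z : E2} (hf : DifferentiableAt ℝ f z)
    (hu : DifferentiableAt ℝ u z) (hg : DifferentiableAt ℝ g z) (hw : DifferentiableAt ℝ w z)
    (i : Fin 2) : pd i (fun y => f y * u y + g y * w y) z
      = pd i f z * u z + f z * pd i u z + (pd i g z * w z + g z * pd i w z) := by
  rw [pd_add (hf.fun_mul hu) (hg.fun_mul hw), pd_mul hf hu, pd_mul hg hw]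

section

variable {Ω : Set E2} (hΩ : IsOpen Ω) {s : E2 → ℝ} (hs : ContDiffOn ℝ ∞ s Ω) {c : Fin 4 → Mink}

section

variable {z : E2} (hz : z ∈ Ω)

include hΩ hs hz

lemma four_mul_mink_pd_zero_middlePos (v : Mink) : 4 * mink (pd 0 (middlePos c s) z) v
    = hessDiff s z * pd 0 (pairing c v) z + hessMix s z * pd 1 (pairing c v) z
      - 4 * (pd 0 (quarterLap s) z * pairing c v z) := by
  rw [pd_zero_middlePos hΩ hs hz, pd_zero_pairing, pd_one_pairing, pairing]
  simp only [mink_add_left, mink_smul_left]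
  ring

lemma four_mul_mink_pd_one_middlePos (v : Mink) : 4 * mink (pd 1 (middlePos c s) z) v
    = hessMix s z * pd 0 (pairing c v) z - hessDiff s z * pd 1 (pairing c v) z
      - 4 * (pd 1 (quarterLap s) z * pairing c v z) := by
  rw [pd_one_middlePos hΩ hs hz, pd_zero_pairing, pd_one_pairing, pairing]
  simp only [mink_add_left, mink_sub_left, mink_smul_left]
  ring

end

include hΩ hs

/-- A vector that is orthogonal to the tangent planes of the middle position and, at one point,
to the normal direction `N` vanishes: the first derivatives of `⟨v, N⟩` vanish at this point by
orthogonality, the second ones by differentiating the orthogonality relations once. -/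
lemma eq_zero_of_orthogonal_middlePos (hc : IsNullBasis c) {v : Mink}
    (hv : ∀ z ∈ Ω, ∀ i, mink (pd i (middlePos c s) z) v = 0) {z₀ : E2} (hz₀ : z₀ ∈ Ω)
    (hne : 0 < hessDiff s z₀ ^ 2 + hessMix s z₀ ^ 2) (h0 : pairing c v z₀ = 0) : v = 0 := by
  have hR := (contDiff_pairing c v).contDiffOn (s := Ω)
  have dR := hR.diffAt hΩ hz₀
  have dRi := fun i => (contDiffOn_pd hΩ hR i).diffAt hΩ hz₀
  have da := (contDiffOn_hessDiff hΩ hs).diffAt hΩ hz₀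
  have db := (contDiffOn_hessMix hΩ hs).diffAt hΩ hz₀
  have dD := fun i => (contDiffOn_pd hΩ (contDiffOn_quarterLap hΩ hs) i).diffAt hΩ hz₀
  have E0 : ∀ z ∈ Ω, hessDiff s z * pd 0 (pairing c v) z + hessMix s z * pd 1 (pairing c v) z
      = 4 * (pd 0 (quarterLap s) z * pairing c v z) := fun z hz => by
    have := four_mul_mink_pd_zero_middlePos (c := c) hΩ hs hz v
    rw [hv z hz] at this
    linarith
  have E1 : ∀ z ∈ Ω, hessMix s z * pd 0 (pairing c v) z + -hessDiff s z * pd 1 (pairing c v) z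
      = 4 * (pd 1 (quarterLap s) z * pairing c v z) := fun z hz => by
    have := four_mul_mink_pd_one_middlePos (c := c) hΩ hs hz v
    rw [hv z hz] at this
    linarith
  have e0 := E0 z₀ hz₀
  have e1 := E1 z₀ hz₀
  rw [h0] at e0 e1
  have hx : pd 0 (pairing c v) z₀ = 0 := by
    refine (mul_eq_zero.1 (?_ : (hessDiff s z₀ ^ 2 + hessMix s z₀ ^ 2) * _ = 0)).resolve_left
      hne.ne'
    linear_combination hessDiff s z₀ * e0 + hessMix s z₀ * e1
  have hy : pd 1 (pairing c v) z₀ = 0 := by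
    refine (mul_eq_zero.1 (?_ : (hessDiff s z₀ ^ 2 + hessMix s z₀ ^ 2) * _ = 0)).resolve_left
      hne.ne'
    linear_combination hessMix s z₀ * e0 - hessDiff s z₀ * e1
  have f0 := pd_congr_on hΩ E0 hz₀ 0
  have f1 := pd_congr_on hΩ E1 hz₀ 0
  rw [pd_mul_add_mul da (dRi 0) db (dRi 1), pd_const_mul ((dD 0).fun_mul dR), pd_mul (dD 0) dR,
    hx, hy, h0, pd_zero_pd_zero_pairing, pd_zero_pd_one_pairing] at f0
  rw [pd_mul_add_mul db (dRi 0) da.fun_neg (dRi 1), pd_const_mul ((dD 1).fun_mul dR),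
    pd_mul (dD 1) dR, hx, hy, h0, pd_zero_pd_zero_pairing, pd_zero_pd_one_pairing] at f1
  have h3 : mink (c 3) v = 0 := by
    refine (mul_eq_zero.1 (?_ : (hessDiff s z₀ ^ 2 + hessMix s z₀ ^ 2) * _ = 0)).resolve_left
      hne.ne'
    linear_combination hessDiff s z₀ / 2 * f0 + hessMix s z₀ / 2 * f1
  rw [pd_zero_pairing] at hx
  rw [pd_one_pairing] at hy
  rw [pairing] at h0
  rw [mink_comm] at h0 h3
  exact eq_zero_of_pairings hc (z := z₀) h0 ((mink_comm _ _).trans hx) ((mink_comm _ _).trans hy) h3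

end

/-- A smooth map of the plane with vanishing partial derivatives is locally constant. -/
lemma eventually_eq_of_pd_eq_zero {V : Type*} [NormedAddCommGroup V] [NormedSpace ℝ V]
    {Ω : Set E2} (hΩ : IsOpen Ω) {u : E2 → V} (hu : ContDiffOn ℝ ∞ u Ω)
    (h : ∀ z ∈ Ω, ∀ i, pd i u z = 0) {z₀ : E2} (hz₀ : z₀ ∈ Ω) : ∀ᶠ z in 𝓝 z₀, u z = u z₀ := by
  obtain ⟨ε, hε, hb⟩ := Metric.isOpen_iff.1 hΩ z₀ hz₀
  filter_upwards [Metric.ball_mem_nhds z₀ hε] with z hz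
  refine Metric.isOpen_ball.is_const_of_fderiv_eq_zero (convex_ball z₀ ε).isPreconnected
    (fun y hy => (hu.diffAt hΩ (hb hy)).differentiableWithinAt) (fun y hy => ?_) hz
    (Metric.mem_ball_self hε)
  ext ξ
  rw [fderiv_eq_pd, h y (hb hy), h y (hb hy)]
  simp

/-- When `4 ∂_z² s`, for a biharmonic function `s`, is a real multiple `l` of the holomorphic
function `(2 ∂_z w)²` given by a harmonic function `w`, then
`0 = ∂_z̄² (4 ∂_z² s) = (2 ∂_z w)² ∂_z̄² l`. So `l` is the pairing of `N` with a constant vector,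
and this vector is orthogonal to the tangent planes of the middle position. -/
lemma exists_orthogonal_of_harmonic {Ω : Set E2} (hΩ : IsOpen Ω) {s : E2 → ℝ}
    (hs : ContDiffOn ℝ ∞ s Ω) {c : Fin 4 → Mink} (hc : IsNullBasis c)
    (hbi : ∀ z ∈ Ω, hessDiff (hessDiff s) z + hessMix (hessMix s) z = 0)
    (hne : ∀ z ∈ Ω, 0 < hessDiff s z ^ 2 + hessMix s z ^ 2)
    {w : E2 → ℝ} (hw : ContDiffOn ℝ ∞ w Ω) (hharm : ∀ z ∈ Ω, pd 0 (pd 0 w) z + pd 1 (pd 1 w) z = 0)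
    (hl : ∀ z ∈ Ω, ∃ l : ℝ, hessDiff s z = l * (pd 0 w z ^ 2 - pd 1 w z ^ 2) ∧
      hessMix s z = l * (2 * pd 0 w z * pd 1 w z)) {z₀ : E2} (hz₀ : z₀ ∈ Ω) :
    ∃ v : Mink, v ≠ 0 ∧ ∀ᶠ z in 𝓝 z₀, ∀ i, mink (pd i (middlePos c s) z) v = 0 := by
  set a := hessDiff s
  set b := hessMix s
  set P := pd 0 w with hP
  set T := pd 1 w with hT
  have hPs : ContDiffOn ℝ ∞ P Ω := contDiffOn_pd hΩ hw 0
  have hTs : ContDiffOn ℝ ∞ T Ω := contDiffOn_pd hΩ hw 1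
  have has : ContDiffOn ℝ ∞ a Ω := contDiffOn_hessDiff hΩ hs
  have hbs : ContDiffOn ℝ ∞ b Ω := contDiffOn_hessMix hΩ hs
  set α : E2 → ℝ := fun z => P z * P z + -T z * T z with hα
  set β : E2 → ℝ := fun z => P z * T z + T z * P z with hβ
  have hαs : ContDiffOn ℝ ∞ α Ω := (hPs.mul hPs).add (hTs.neg.mul hTs)
  have hβs : ContDiffOn ℝ ∞ β Ω := (hPs.mul hTs).add (hTs.mul hPs)
  -- the factor `l` is smooth since `α - i β = (2 ∂_z w)²` has no zeros
  set l : E2 → ℝ := fun z => (a z * α z + b z * β z) / (α z ^ 2 + β z ^ 2) with hldef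
  have hpos : ∀ z ∈ Ω, α z ^ 2 + β z ^ 2 ≠ 0 := by
    intro z hz h0
    obtain ⟨k, h1, h2⟩ := hl z hz
    have h3 : a z ^ 2 + b z ^ 2 = k ^ 2 * (α z ^ 2 + β z ^ 2) := by
      rw [h1, h2]; simp only [hα, hβ]; ring
    have := hne z hz
    rw [h0, mul_zero] at h3
    linarith
  have hls : ContDiffOn ℝ ∞ l Ω :=
    ((has.mul hαs).add (hbs.mul hβs)).div ((hαs.pow 2).add (hβs.pow 2)) hpos
  have hal : ∀ z ∈ Ω, a z = l z * α z ∧ b z = l z * β z := by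
    intro z hz
    obtain ⟨k, h1, h2⟩ := hl z hz
    have hk : l z = k := by
      have e1 : a z = k * α z := by rw [h1]; simp only [hα]; ring
      have e2 : b z = k * β z := by rw [h2]; simp only [hβ]; ring
      rw [hldef]
      simp only
      rw [div_eq_iff (hpos z hz), e1, e2]
      ring
    rw [hk, h1, h2]
    simp only [hα, hβ]
    constructor <;> ring
  -- the Cauchy-Riemann equations of `α - i β`
  have hPT : ∀ z ∈ Ω, pd 1 P z = pd 0 T z := fun z hz => pd_comm hΩ hw hz 1 0
  have hdα : ∀ z ∈ Ω, ∀ i, pd i α z = 2 * (P z * pd i P z - T z * pd i T z) := by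
    intro z hz i
    have dP := hPs.diffAt hΩ hz
    have dT := hTs.diffAt hΩ hz
    rw [hα, pd_mul_add_mul dP dP dT.fun_neg dT, pd_neg]
    ring
  have hdβ : ∀ z ∈ Ω, ∀ i, pd i β z = 2 * (P z * pd i T z + T z * pd i P z) := by
    intro z hz i
    have dP := hPs.diffAt hΩ hz
    have dT := hTs.diffAt hΩ hz
    rw [hβ, pd_mul_add_mul dP dT dT dP]
    ring
  have hCR0 : ∀ z ∈ Ω, pd 0 α z + pd 1 β z = 0 := fun z hz => by
    rw [hdα z hz, hdβ z hz, hPT z hz]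
    linear_combination 2 * P z * hharm z hz
  have hCR1 : ∀ z ∈ Ω, pd 0 β z - pd 1 α z = 0 := fun z hz => by
    rw [hdα z hz, hdβ z hz, hPT z hz]
    linear_combination 2 * T z * hharm z hz
  have hda : ∀ z ∈ Ω, ∀ i, pd i a z = pd i l z * α z + l z * pd i α z := fun z hz i => by
    rw [pd_congr_on hΩ (fun y hy => (hal y hy).1) hz,
      pd_mul (hls.diffAt hΩ hz) (hαs.diffAt hΩ hz)]
  have hdb : ∀ z ∈ Ω, ∀ i, pd i b z = pd i l z * β z + l z * pd i β z := fun z hz i => by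
    rw [pd_congr_on hΩ (fun y hy => (hal y hy).2) hz,
      pd_mul (hls.diffAt hΩ hz) (hβs.diffAt hΩ hz)]
  have hDs := contDiffOn_quarterLap hΩ hs
  have E0 : ∀ z ∈ Ω, 4 * pd 0 (quarterLap s) z = α z * pd 0 l z + β z * pd 1 l z := fun z hz => by
    rw [pd_zero_quarterLap hΩ hs hz]
    change 4 * ((pd 0 a z + pd 1 b z) / 4) = _
    rw [hda z hz, hdb z hz]
    linear_combination l z * hCR0 z hz
  have E1 : ∀ z ∈ Ω, 4 * pd 1 (quarterLap s) z = β z * pd 0 l z + -α z * pd 1 l z :=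
    fun z hz => by
    rw [pd_one_quarterLap hΩ hs hz]
    change 4 * ((pd 0 b z - pd 1 a z) / 4) = _
    rw [hda z hz, hdb z hz]
    linear_combination l z * hCR1 z hz
  -- the traceless Hessian of the factor vanishes
  have hAB : ∀ z ∈ Ω, hessDiff l z = 0 ∧ hessMix l z = 0 := by
    intro z hz
    have dα := hαs.diffAt hΩ hz
    have dβ := hβs.diffAt hΩ hz
    have dl := fun i => (contDiffOn_pd hΩ hls i).diffAt hΩ hz
    have dD := fun i => (contDiffOn_pd hΩ hDs i).diffAt hΩ hz
    have F : ∀ i, 4 * pd i (pd 0 (quarterLap s)) z = pd i α z * pd 0 l z + α z * pd i (pd 0 l) z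
        + (pd i β z * pd 1 l z + β z * pd i (pd 1 l) z) := fun i => by
      rw [← pd_const_mul (dD 0), pd_congr_on hΩ E0 hz, pd_mul_add_mul dα (dl 0) dβ (dl 1)]
    have G : ∀ i, 4 * pd i (pd 1 (quarterLap s)) z = pd i β z * pd 0 l z + β z * pd i (pd 0 l) z
        + (-pd i α z * pd 1 l z + -α z * pd i (pd 1 l) z) := fun i => by
      rw [← pd_const_mul (dD 1), pd_congr_on hΩ E1 hz, pd_mul_add_mul dβ (dl 0) dα.fun_neg (dl 1),
        pd_neg]
    have hlap := laplacian_quarterLap hΩ hs hz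
    rw [hbi z hz] at hlap
    have hsw := pd_comm hΩ hDs hz 1 0
    have hlsw := pd_comm hΩ hls hz 1 0
    have u1 : α z * hessDiff l z + β z * hessMix l z = 0 := by
      rw [hessDiff, hessMix]
      linear_combination 4 * hlap - F 0 - G 1 - pd 0 l z * hCR0 z hz - pd 1 l z * hCR1 z hz
        - β z * hlsw
    have u2 : α z * hessMix l z - β z * hessDiff l z = 0 := by
      rw [hessDiff, hessMix]
      linear_combination 4 * hsw - F 1 + G 0 + pd 0 l z * hCR1 z hz - pd 1 l z * hCR0 z hz
        - α z * hlsw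
    constructor
    · refine (mul_eq_zero.1 (?_ : (α z ^ 2 + β z ^ 2) * _ = 0)).resolve_left (hpos z hz)
      linear_combination α z * u1 - β z * u2
    · refine (mul_eq_zero.1 (?_ : (α z ^ 2 + β z ^ 2) * _ = 0)).resolve_left (hpos z hz)
      linear_combination β z * u1 + α z * u2
  -- so its middle position is constant
  have hconst : ∀ z ∈ Ω, ∀ i, pd i (middlePos c l) z = 0 := by
    intro z hz i
    have hA : EqOn (hessDiff l) (fun _ => 0) Ω := fun y hy => (hAB y hy).1
    have hB : EqOn (hessMix l) (fun _ => 0) Ω := fun y hy => (hAB y hy).2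
    fin_cases i
    · simp only [Fin.zero_eta]
      rw [pd_zero_middlePos hΩ hls hz, pd_zero_quarterLap hΩ hls hz, pd_congr_on hΩ hA hz,
        pd_congr_on hΩ hB hz, hA hz, hB hz, pd_const, pd_const]
      simp
    · simp only [Fin.mk_one]
      rw [pd_one_middlePos hΩ hls hz, pd_one_quarterLap hΩ hls hz, pd_congr_on hΩ hA hz,
        pd_congr_on hΩ hB hz, hA hz, hB hz, pd_const, pd_const]
      simp
  set v := middlePos c l z₀ with hv
  have hev := eventually_eq_of_pd_eq_zero hΩ (contDiffOn_middlePos hΩ hls c) hconst hz₀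
  have hRl : ∀ᶠ z in 𝓝 z₀, pairing c v z = l z := by
    filter_upwards [hev] with z hz
    rw [pairing, mink_comm, hv, ← hz, mink_middlePos_nulPt hc]
  refine ⟨v, fun h0 => ?_, ?_⟩
  · have h1 := hRl.self_of_nhds
    rw [h0, pairing, mink_zero_right] at h1
    have h2 := hne z₀ hz₀
    have h3 := hal z₀ hz₀
    rw [← h1] at h3
    rw [h3.1, h3.2] at h2
    norm_num at h2
  · filter_upwards [hRl.eventually_nhds, hΩ.mem_nhds hz₀] with z hz hzΩ i
    have h0 := hz.self_of_nhds
    have hx := pd_congr hz 0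
    have hy := pd_congr hz 1
    obtain ⟨ha, hb⟩ := hal z hzΩ
    have e0 := four_mul_mink_pd_zero_middlePos (c := c) hΩ hs hzΩ v
    have e1 := four_mul_mink_pd_one_middlePos (c := c) hΩ hs hzΩ v
    rw [h0, hx, hy] at e0 e1
    fin_cases i
    · simp only [Fin.zero_eta]
      linear_combination (1 / 4) * e0 + (1 / 4) * pd 0 l z * ha + (1 / 4) * pd 1 l z * hb
        - (1 / 4) * l z * E0 z hzΩ
    · simp only [Fin.mk_one]
      linear_combination (1 / 4) * e1 + (1 / 4) * pd 0 l z * hb - (1 / 4) * pd 1 l z * ha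
        - (1 / 4) * l z * E1 z hzΩ

/-! ### L-isothermic coordinates are harmonic -/

section

variable {Ω : Set E2} (hΩ : IsOpen Ω) {s : E2 → ℝ} (hs : ContDiffOn ℝ ∞ s Ω) {c : Fin 4 → Mink}
  (hc : IsNullBasis c) {z : E2} (hz : z ∈ Ω)

include hΩ hs hc hz

lemma minkCoeff_middlePos_zero_zero : minkCoeff (middlePos c s) (middlePos c s) 0 0 z
    = (hessDiff s z ^ 2 + hessMix s z ^ 2) / 8 := by
  rw [minkCoeff, pd_zero_middlePos hΩ hs hz]
  simp only [mink_add_left, mink_add_right, mink_smul_left, mink_smul_right, hc.mink_pp, hc.mink_px,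
    hc.mink_py, hc.mink_xp, hc.mink_xx, hc.mink_xy, hc.mink_yp, hc.mink_yx, hc.mink_yy]
  ring

lemma minkCoeff_middlePos_one_one : minkCoeff (middlePos c s) (middlePos c s) 1 1 z
    = (hessDiff s z ^ 2 + hessMix s z ^ 2) / 8 := by
  rw [minkCoeff, pd_one_middlePos hΩ hs hz]
  simp only [mink_add_left, mink_add_right, mink_sub_left, mink_sub_right, mink_smul_left,
    mink_smul_right, hc.mink_pp, hc.mink_px,
    hc.mink_py, hc.mink_xp, hc.mink_xx, hc.mink_xy, hc.mink_yp, hc.mink_yx, hc.mink_yy]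
  ring

lemma minkCoeff_middlePos_zero_one : minkCoeff (middlePos c s) (middlePos c s) 0 1 z = 0 := by
  rw [minkCoeff, pd_zero_middlePos hΩ hs hz, pd_one_middlePos hΩ hs hz]
  simp only [mink_add_left, mink_add_right, mink_sub_right, mink_smul_left,
    mink_smul_right, hc.mink_pp, hc.mink_px,
    hc.mink_py, hc.mink_xp, hc.mink_xx, hc.mink_xy, hc.mink_yp, hc.mink_yx, hc.mink_yy]
  ring

lemma mink_pd_middlePos_nulX (i : Fin 2) : mink (pd i (middlePos c s) z) (nulX c z)
    = (if i = 0 then hessDiff s z else hessMix s z) / 2 := by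
  fin_cases i
  · simp only [Fin.zero_eta, pd_zero_middlePos hΩ hs hz, mink_add_left, mink_smul_left, hc.mink_px,
      hc.mink_xx, hc.mink_yx, if_true]
    ring
  · simp only [Fin.mk_one, pd_one_middlePos hΩ hs hz, mink_add_left, mink_sub_left, mink_smul_left,
      hc.mink_px, hc.mink_xx, hc.mink_yx, one_ne_zero, if_false]
    ring

lemma mink_pd_middlePos_nulY (i : Fin 2) : mink (pd i (middlePos c s) z) (nulY c z)
    = (if i = 0 then hessMix s z else -hessDiff s z) / 2 := by
  fin_cases i
  · simp only [Fin.zero_eta, pd_zero_middlePos hΩ hs hz, mink_add_left, mink_smul_left, hc.mink_py,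
      hc.mink_xy, hc.mink_yy, if_true]
    ring
  · simp only [Fin.mk_one, pd_one_middlePos hΩ hs hz, mink_add_left, mink_sub_left, mink_smul_left,
      hc.mink_py, hc.mink_xy, hc.mink_yy, one_ne_zero, if_false]
    ring

lemma minkCoeff_middlePos_smul {ρ : E2 → ℝ} (hρ : DifferentiableAt ℝ ρ z) (i j : Fin 2) :
    minkCoeff (middlePos c s) (fun y => ρ y • nulPt c y) i j z
      = ρ z * mink (pd i (middlePos c s) z) (pd j (nulPt c) z) := by
  rw [minkCoeff, pd_smul hρ (differentiableAt_nulPt c z), mink_add_right, mink_smul_right,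
    mink_smul_right, mink_pd_middlePos_nulPt hΩ hs hz hc]
  ring

end

lemma pd_apply {W : E2 → E2} {z : E2} (hW : DifferentiableAt ℝ W z) (i k : Fin 2) :
    pd i (fun y => W y k) z = (pd i W z) k :=
  pd_clm (EuclideanSpace.proj k : E2 →L[ℝ] ℝ) hW i

lemma minkCoeff_comp {W : E2 → E2} {u w : E2 → Mink} {z : E2} (hu : DifferentiableAt ℝ u (W z))
    (hw : DifferentiableAt ℝ w (W z)) (hW : DifferentiableAt ℝ W z) (i j : Fin 2) :
    minkCoeff (u ∘ W) (w ∘ W) i j z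
      = (pd i W z) 0 * (pd j W z) 0 * minkCoeff u w 0 0 (W z)
        + (pd i W z) 0 * (pd j W z) 1 * minkCoeff u w 0 1 (W z)
        + (pd i W z) 1 * (pd j W z) 0 * minkCoeff u w 1 0 (W z)
        + (pd i W z) 1 * (pd j W z) 1 * minkCoeff u w 1 1 (W z) := by
  simp only [minkCoeff]
  rw [pd_comp hu hW, pd_comp hw hW]
  simp only [mink_add_left, mink_add_right, mink_smul_left, mink_smul_right]
  ring

lemma minkCoeff_congr_on {Ω : Set E2} (hΩ : IsOpen Ω) {u u' w w' : E2 → Mink} (hu : EqOn u u' Ω)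
    (hw : EqOn w w' Ω) {z : E2} (hz : z ∈ Ω) (i j : Fin 2) :
    minkCoeff u w i j z = minkCoeff u' w' i j z := by
  rw [minkCoeff, minkCoeff, pd_congr_on hΩ hu hz, pd_congr_on hΩ hw hz]

lemma minkCoeff_swap (u : E2 → Mink) (i j : Fin 2) (z : E2) :
    minkCoeff u u i j z = minkCoeff u u j i z := mink_comm _ _

/-- A `2 × 2` matrix with orthogonal columns of equal length is a similarity. -/
lemma similarity_of_columns {P T Q R ε : ℝ} (h1 : P ^ 2 + Q ^ 2 = T ^ 2 + R ^ 2)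
    (h2 : P * T + Q * R = 0) (hk : 0 < P ^ 2 + Q ^ 2) (hε : ε ^ 2 = 1)
    (hdet : 0 < ε * (P * R - T * Q)) : Q = -ε * T ∧ R = ε * P := by
  have e1 : (P ^ 2 + Q ^ 2) * R = P * (P * R - T * Q) := by linear_combination Q * h2
  have e2 : (P ^ 2 + Q ^ 2) * Q = -T * (P * R - T * Q) := by
    linear_combination Q * h1 + R * h2
  have e3 : (P * R - T * Q) ^ 2 = (P ^ 2 + Q ^ 2) ^ 2 := by
    linear_combination -(P ^ 2 + Q ^ 2) * h1 - (P * T + Q * R) * h2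
  have e4 : P * R - T * Q = ε * (P ^ 2 + Q ^ 2) := by
    have h3 : ε * (P * R - T * Q) + (P ^ 2 + Q ^ 2) ≠ 0 := by positivity
    have h4 : ε * (P * R - T * Q) - (P ^ 2 + Q ^ 2) = 0 := by
      refine (mul_eq_zero.1 (?_ : _ * (ε * (P * R - T * Q) + (P ^ 2 + Q ^ 2)) = 0)).resolve_right h3
      linear_combination (P * R - T * Q) ^ 2 * hε + e3
    linear_combination ε * h4 - (P * R - T * Q) * hε
  rw [e4] at e1 e2
  constructor
  · refine mul_left_cancel₀ hk.ne' (e2.trans ?_); ring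
  · refine mul_left_cancel₀ hk.ne' (e1.trans ?_); ring

section

variable {M : Type*} [TopologicalSpace M] [ChartedSpace E2 M]

variable {F : LegendreImmersion M} {c : Fin 4 → Mink} {e : OpenPartialHomeomorph M E2}

namespace IsStereoChart

variable (h : IsStereoChart F c e)

include h

/-- The first vector of a middle frame is a smooth multiple of the null paraboloid. -/
lemma exists_factor {U : Set M} (hU : IsOpen U) {A : FrameField M} (hA : F.IsMiddleFrameOn U A) :
    ∃ ρ : E2 → ℝ, ContDiffOn ℝ ∞ ρ (e.target ∩ e.symm ⁻¹' U) ∧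
      ∀ z ∈ e.target ∩ e.symm ⁻¹' U, A.a 0 (e.symm z) = ρ z • nulPt c z ∧ ρ z ≠ 0 := by
  have hc := h.basis
  have hs : ContDiffOn ℝ ∞ (A.a 0 ∘ e.symm) (e.target ∩ e.symm ⁻¹' U) :=
    contDiffOn_chart h.mem_atlas (hA.1.smooth_a 0)
  refine ⟨fun z => -mink (A.a 0 (e.symm z)) (c 3), (hs.mink contDiffOn_const).neg,
    fun z hz => ?_⟩
  obtain ⟨-, ρ, hρ⟩ := h.eq_middlePos_of_isMiddleFrameOn hU hA hz.2 (e.map_target hz.1)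
  rw [e.right_inv hz.1] at hρ
  have h1 : -mink (A.a 0 (e.symm z)) (c 3) = ρ := by
    rw [hρ, mink_smul_left, hc.mink_pz]; ring
  beta_reduce
  rw [h1]
  refine ⟨hρ, fun h0 => ?_⟩
  rw [h0, zero_smul] at hρ
  exact ne_zero_of_mem_posCone (hA.1.first_mem _ hz.2) hρ

/-- An L-isothermic coordinate `w` is a harmonic function of the stereographic coordinate, since
both coordinates are isothermal for the middle position; that it diagonalizes `⟨da₀, da₁⟩` says that
`4 ∂_z² s` is a real multiple of `(2 ∂_z w)²`. -/
lemma exists_orthogonal_of_isothermic (hF : F.Nondegenerate)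
    (hbi : ∀ z ∈ e.target, hessDiff (hessDiff (support F c e)) z
      + hessMix (hessMix (support F c e)) z = 0)
    {e₁ : OpenPartialHomeomorph M E2} (he₁ : e₁ ∈ IsManifold.maximalAtlas (𝓡 2) ∞ M)
    {A : FrameField M} (hA : F.IsMiddleFrameOn e₁.source A)
    (hiso : ∀ z ∈ e₁.target,
        minkCoeff (A.x ∘ e₁.symm) (A.x ∘ e₁.symm) 0 0 z
          = minkCoeff (A.x ∘ e₁.symm) (A.x ∘ e₁.symm) 1 1 z ∧
        minkCoeff (A.x ∘ e₁.symm) (A.x ∘ e₁.symm) 0 1 z = 0 ∧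
        minkCoeff (A.x ∘ e₁.symm) (A.a 0 ∘ e₁.symm) 0 1 z = 0 ∧
        minkCoeff (A.x ∘ e₁.symm) (A.a 0 ∘ e₁.symm) 1 0 z = 0)
    {p : M} (hp : p ∈ e.source) (hp₁ : p ∈ e₁.source) :
    ∃ v : Mink, v ≠ 0 ∧
      ∀ᶠ z in 𝓝 (e p), ∀ i, mink (pd i (middlePos c (support F c e)) z) v = 0 := by
  have hc := h.basis
  have he := h.mem_atlas
  set s := support F c e
  set Ω := e.target ∩ e.symm ⁻¹' e₁.source with hΩdef
  have hΩ : IsOpen Ω := e.isOpen_inter_preimage_symm e₁.open_source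
  have hs : ContDiffOn ℝ ∞ s Ω := h.contDiffOn_support.mono inter_subset_left
  have hpΩ : e p ∈ Ω := ⟨e.map_source hp, by simpa [e.left_inv hp] using hp₁⟩
  set W : E2 → E2 := e₁ ∘ e.symm with hW
  have hWs : ContDiffOn ℝ ∞ W Ω := contDiffOn_chart he (contMDiffOn_of_mem_maximalAtlas he₁)
  have hWt : ∀ z ∈ Ω, W z ∈ e₁.target := fun z hz => e₁.map_source hz.2
  have hxs : ContDiffOn ℝ ∞ (A.x ∘ e₁.symm) e₁.target :=
    (contDiffOn_chart he₁ hA.1.smooth_x).mono fun z hz => ⟨hz, e₁.map_target hz⟩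
  have has : ContDiffOn ℝ ∞ (A.a 0 ∘ e₁.symm) e₁.target :=
    (contDiffOn_chart he₁ (hA.1.smooth_a 0)).mono fun z hz => ⟨hz, e₁.map_target hz⟩
  obtain ⟨ρ, hρs, hρ⟩ := h.exists_factor e₁.open_source hA
  have hxW : EqOn (middlePos c s) ((A.x ∘ e₁.symm) ∘ W) Ω := by
    intro z hz
    have h1 := (h.eq_middlePos_of_isMiddleFrameOn e₁.open_source hA hz.2 (e.map_target hz.1)).1
    rw [e.right_inv hz.1] at h1
    simp only [hW, Function.comp_apply]
    rw [e₁.left_inv hz.2]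
    exact h1.symm
  have haW : EqOn (fun z => ρ z • nulPt c z) ((A.a 0 ∘ e₁.symm) ∘ W) Ω := by
    intro z hz
    simp only [hW, Function.comp_apply]
    rw [e₁.left_inv hz.2]
    exact (hρ z hz).1.symm
  -- the transition map is conformal; near `p` its Jacobian determinant has a constant sign `ε`
  set J : E2 → ℝ := fun z => (pd 0 W z) 0 * (pd 1 W z) 1 - (pd 1 W z) 0 * (pd 0 W z) 1 with hJ
  have hJc : ContDiffOn ℝ ∞ J Ω := by
    have hd : ∀ i k, ContDiffOn ℝ ∞ (fun z => (pd i W z) k) Ω := fun i k =>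
      (contDiff_coord k).comp_contDiffOn (contDiffOn_pd hΩ hWs i)
    exact ((hd 0 0).mul (hd 1 1)).sub ((hd 1 0).mul (hd 0 1))
  have hcols : ∀ z ∈ Ω, (pd 0 W z) 0 ^ 2 + (pd 0 W z) 1 ^ 2 = (pd 1 W z) 0 ^ 2 + (pd 1 W z) 1 ^ 2 ∧
      (pd 0 W z) 0 * (pd 1 W z) 0 + (pd 0 W z) 1 * (pd 1 W z) 1 = 0 ∧
      0 < (pd 0 W z) 0 ^ 2 + (pd 0 W z) 1 ^ 2 := by
    intro z hz
    have dx := hxs.diffAt e₁.open_target (hWt z hz)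
    have dW := hWs.diffAt hΩ hz
    obtain ⟨i1, i2, -, -⟩ := hiso (W z) (hWt z hz)
    have c00 := minkCoeff_comp dx dx dW 0 0
    have c11 := minkCoeff_comp dx dx dW 1 1
    have c01 := minkCoeff_comp dx dx dW 0 1
    rw [← minkCoeff_congr_on hΩ hxW hxW hz] at c00 c11 c01
    rw [minkCoeff_middlePos_zero_zero hΩ hs hc hz, minkCoeff_swap _ 1 0, i2, ← i1] at c00
    rw [minkCoeff_middlePos_one_one hΩ hs hc hz, minkCoeff_swap _ 1 0, i2, ← i1] at c11
    rw [minkCoeff_middlePos_zero_one hΩ hs hc hz, minkCoeff_swap _ 1 0, i2, ← i1] at c01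
    have hpos := h.hess_ne_zero hz.1 hF
    generalize minkCoeff (A.x ∘ e₁.symm) (A.x ∘ e₁.symm) 0 0 (W z) = μ at *
    have h3 : μ * ((pd 0 W z) 0 ^ 2 + (pd 0 W z) 1 ^ 2)
        = (hessDiff s z ^ 2 + hessMix s z ^ 2) / 8 := by linear_combination -c00
    have h4 : μ * ((pd 0 W z) 0 ^ 2 + (pd 0 W z) 1 ^ 2) ≠ 0 := by
      rw [h3]; exact (div_pos hpos (by norm_num)).ne'
    have hμ : μ ≠ 0 := left_ne_zero_of_mul h4
    refine ⟨mul_left_cancel₀ hμ ?_, mul_left_cancel₀ hμ ?_,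
      lt_of_le_of_ne (by positivity) (right_ne_zero_of_mul h4).symm⟩
    · linear_combination c11 - c00
    · linear_combination -c01
  have hJne : J (e p) ≠ 0 := by
    obtain ⟨h1, h2, h3⟩ := hcols _ hpΩ
    intro h0
    have h4 : J (e p) ^ 2 = ((pd 0 W (e p)) 0 ^ 2 + (pd 0 W (e p)) 1 ^ 2) ^ 2 := by
      simp only [hJ]
      linear_combination -((pd 0 W (e p)) 0 ^ 2 + (pd 0 W (e p)) 1 ^ 2) * h1
        - ((pd 0 W (e p)) 0 * (pd 1 W (e p)) 0 + (pd 0 W (e p)) 1 * (pd 1 W (e p)) 1) * h2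
    rw [h0] at h4
    have := pow_pos h3 2
    norm_num at h4
    linarith
  obtain ⟨ε, hε, hεJ⟩ : ∃ ε : ℝ, ε ^ 2 = 1 ∧ 0 < ε * J (e p) := by
    rcases lt_or_gt_of_ne hJne with h1 | h1
    · exact ⟨-1, by norm_num, by linarith⟩
    · exact ⟨1, by norm_num, by linarith⟩
  set Ω' := Ω ∩ (fun z => ε * J z) ⁻¹' Ioi 0 with hΩ'def
  have hΩ' : IsOpen Ω' :=
    (contDiffOn_const.mul hJc).continuousOn.isOpen_inter_preimage hΩ isOpen_Ioi
  have hsub : Ω' ⊆ Ω := inter_subset_left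
  have hWs' := hWs.mono hsub
  have hsim : ∀ z ∈ Ω', (pd 0 W z) 1 = -ε * (pd 1 W z) 0 ∧ (pd 1 W z) 1 = ε * (pd 0 W z) 0 := by
    intro z hz
    obtain ⟨h1, h2, h3⟩ := hcols z hz.1
    exact similarity_of_columns h1 h2 h3 hε hz.2
  have hcomp : ∀ i k, ∀ z ∈ Ω', pd i (fun y => W y k) z = (pd i W z) k := fun i k z hz =>
    pd_apply (hWs'.diffAt hΩ' hz) i k
  have hWk : ∀ k, ContDiffOn ℝ ∞ (fun z => W z k) Ω' := fun k =>
    (contDiff_coord k).comp_contDiffOn hWs'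
  refine exists_orthogonal_of_harmonic hΩ' (hs.mono hsub) hc (fun z hz => hbi z hz.1.1)
    (fun z hz => h.hess_ne_zero hz.1.1 hF) (hWk 0) ?_ ?_ ⟨hpΩ, hεJ⟩
  · -- the first coordinate is harmonic since the second one is its conjugate up to sign
    intro z hz
    have h1 := pd_comm hΩ' (hWk 1) hz 1 0
    have d := fun i => (contDiffOn_pd hΩ' (hWk 0) i).diffAt hΩ' hz
    rw [pd_congr_on hΩ' (u := pd 0 fun y => W y 1) (w := fun y => -ε * pd 1 (fun y => W y 0) y)
        (fun y hy => by
          beta_reduce; rw [hcomp 0 1 y hy, (hsim y hy).1, hcomp 1 0 y hy]) hz,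
      pd_congr_on hΩ' (u := pd 1 fun y => W y 1) (w := fun y => ε * pd 0 (fun y => W y 0) y)
        (fun y hy => by
          beta_reduce; rw [hcomp 1 1 y hy, (hsim y hy).2, hcomp 0 0 y hy]) hz,
      pd_const_mul (d 1), pd_const_mul (d 0)] at h1
    linear_combination (-(pd 0 (pd 0 fun y => W y 0) z + pd 1 (pd 1 fun y => W y 0) z)) * hε
      - ε * h1
  · intro z hz
    obtain ⟨hs1, hs2⟩ := hsim z hz
    have dx := hxs.diffAt e₁.open_target (hWt z hz.1)
    have da := has.diffAt e₁.open_target (hWt z hz.1)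
    have dW := hWs.diffAt hΩ hz.1
    have dρ := hρs.diffAt hΩ hz.1
    obtain ⟨-, -, i3, i4⟩ := hiso (W z) (hWt z hz.1)
    have c00 := minkCoeff_comp dx da dW 0 0
    have c11 := minkCoeff_comp dx da dW 1 1
    have c01 := minkCoeff_comp dx da dW 0 1
    rw [← minkCoeff_congr_on hΩ hxW haW hz.1, minkCoeff_middlePos_smul hΩ hs hc hz.1 dρ, i3, i4,
      hs1] at c00
    rw [← minkCoeff_congr_on hΩ hxW haW hz.1, minkCoeff_middlePos_smul hΩ hs hc hz.1 dρ, i3, i4,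
      hs2] at c11
    rw [← minkCoeff_congr_on hΩ hxW haW hz.1, minkCoeff_middlePos_smul hΩ hs hc hz.1 dρ, i3, i4,
      hs1, hs2] at c01
    rw [pd_zero_nulPt, mink_pd_middlePos_nulX hΩ hs hc hz.1, if_pos rfl] at c00
    rw [pd_one_nulPt, mink_pd_middlePos_nulY hΩ hs hc hz.1, if_neg one_ne_zero] at c11
    rw [pd_one_nulPt, mink_pd_middlePos_nulY hΩ hs hc hz.1, if_pos rfl] at c01
    obtain ⟨-, -, hk⟩ := hcols z hz.1
    have hρ0 := (hρ z hz.1).2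
    rw [hcomp 0 0 z hz, hcomp 1 0 z hz]
    rw [hs1] at hk
    generalize minkCoeff (A.x ∘ e₁.symm) (A.a 0 ∘ e₁.symm) 0 0 (W z) = m0 at *
    generalize minkCoeff (A.x ∘ e₁.symm) (A.a 0 ∘ e₁.symm) 1 1 (W z) = m1 at *
    generalize (pd 0 W z) 0 = P at *
    generalize (pd 1 W z) 0 = T at *
    have hm : m0 + m1 = 0 := by
      refine (mul_eq_zero.1 (?_ : (P ^ 2 + (-ε * T) ^ 2) * _ = 0)).resolve_left hk.ne'
      linear_combination -c00 - c11 + (m0 * T ^ 2 - m1 * P ^ 2) * hε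
    refine ⟨2 * m0 / ρ z, ?_, ?_⟩
    · rw [div_mul_eq_mul_div, eq_div_iff hρ0]
      linear_combination 2 * c00 + 2 * T ^ 2 * m1 * hε + 2 * T ^ 2 * hm
    · rw [div_mul_eq_mul_div, eq_div_iff hρ0]
      linear_combination 2 * c01 - 2 * P * T * m1 * hε - 2 * P * T * hm

end IsStereoChart

end

/-! ### Continuation over a connected surface -/

section

variable {M : Type*} [TopologicalSpace M] [ChartedSpace E2 M]

variable {F : LegendreImmersion M} {c : Fin 4 → Mink} {e : OpenPartialHomeomorph M E2}

namespace IsStereoChart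

variable (h : IsStereoChart F c e)

include h

lemma pd_mink_middlePos {z : E2} (hz : z ∈ e.target) (v : Mink) (i : Fin 2) :
    pd i (fun y => mink (middlePos c (support F c e) y) v) z
      = mink (pd i (middlePos c (support F c e)) z) v := by
  rw [pd_mink ((contDiffOn_middlePos e.open_target h.contDiffOn_support c).diffAt e.open_target hz)
    (differentiableAt_const v), pd_const, mink_zero_right, add_zero]

lemma eventually_mink_lGaussMap_iff (hF : F.Nondegenerate) {p : M} (hp : p ∈ e.source) (v : Mink) :
    (∀ᶠ q in 𝓝 p, mink (F.lGaussMap q) v = mink (F.lGaussMap p) v) ↔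
      ∀ᶠ z in 𝓝 (e p), ∀ i, mink (pd i (middlePos c (support F c e)) z) v = 0 := by
  have hs := h.contDiffOn_support
  have hz₀ := e.map_source hp
  constructor
  · intro hv
    have h1 : ∀ᶠ z in 𝓝 (e p), mink (middlePos c (support F c e) z) v = mink (F.lGaussMap p) v := by
      have ht : Filter.Tendsto e.symm (𝓝 (e p)) (𝓝 p) := by
        have := e.symm.continuousAt hz₀
        rwa [ContinuousAt, e.left_inv hp] at this
      filter_upwards [ht.eventually hv, e.open_target.mem_nhds hz₀] with z hz hzt
      rw [← hz, h.lGaussMap_eq hF (e.map_target hzt), e.right_inv hzt]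
    filter_upwards [h1.eventually_nhds, e.open_target.mem_nhds hz₀] with z hz hzt i
    rw [← h.pd_mink_middlePos hzt, pd_congr hz i, pd_const]
  · intro hv
    obtain ⟨Ω, hΩv, hΩ, hpΩ⟩ :=
      eventually_nhds_iff.1 (hv.and (e.open_target.mem_nhds hz₀))
    have h1 := eventually_eq_of_pd_eq_zero hΩ
      (u := fun z => mink (middlePos c (support F c e) z) v)
      (((contDiffOn_middlePos e.open_target hs c).mink contDiffOn_const).mono
        fun z hz => (hΩv z hz).2)
      (fun z hz i => by rw [h.pd_mink_middlePos (hΩv z hz).2]; exact (hΩv z hz).1 i) hpΩ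
    filter_upwards [(e.continuousAt hp).eventually h1, e.open_source.mem_nhds hp] with q hq hqs
    rw [h.lGaussMap_eq hF hqs, h.lGaussMap_eq hF hp]
    exact hq

/-- Locally, the vectors orthogonal to the L-Gauss map span at most a line. -/
lemma eq_smul_of_orthogonal (hF : F.Nondegenerate) {p : M} (hp : p ∈ e.source) {v w : Mink}
    (hv : ∀ᶠ q in 𝓝 p, mink (F.lGaussMap q) v = mink (F.lGaussMap p) v)
    (hw : ∀ᶠ q in 𝓝 p, mink (F.lGaussMap q) w = mink (F.lGaussMap p) w) (hw0 : w ≠ 0) :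
    ∃ k : ℝ, v = k • w := by
  rw [h.eventually_mink_lGaussMap_iff hF hp] at hv hw
  have hz₀ := e.map_source hp
  obtain ⟨Ω, hΩv, hΩ, hpΩ⟩ :=
    eventually_nhds_iff.1 ((hv.and hw).and (e.open_target.mem_nhds hz₀))
  have hs := h.contDiffOn_support.mono (fun z hz => (hΩv z hz).2 : Ω ⊆ e.target)
  have hne := h.hess_ne_zero hz₀ hF
  have hRw : pairing c w (e p) ≠ 0 := fun h0 =>
    hw0 (eq_zero_of_orthogonal_middlePos hΩ hs h.basis (fun z hz => (hΩv z hz).1.2) hpΩ hne h0)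
  refine ⟨pairing c v (e p) / pairing c w (e p), ?_⟩
  rw [← sub_eq_zero]
  refine eq_zero_of_orthogonal_middlePos hΩ hs h.basis (fun z hz i => ?_) hpΩ hne ?_
  · rw [mink_sub_right, mink_smul_right, (hΩv z hz).1.1 i, (hΩv z hz).1.2 i]
    ring
  · have : pairing c (v - (pairing c v (e p) / pairing c w (e p)) • w) (e p)
        = pairing c v (e p) - pairing c v (e p) / pairing c w (e p) * pairing c w (e p) := by
      rw [pairing, mink_sub_right, mink_smul_right]; rfl
    rw [this, div_mul_cancel₀ _ hRw, sub_self]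

end IsStereoChart

/-- The vector that is locally orthogonal to the L-Gauss map is unique up to a factor, so that it
can be continued along a connected surface. -/
lemma exists_hyperplane_of_isLIsothermic [T2Space M] [ConnectedSpace M] [IsManifold (𝓡 2) ∞ M]
    (hF : F.Nondegenerate) (hmin : F.IsLMinimal) (hiso : F.IsLIsothermic) :
    ∃ O v : Mink, v ≠ 0 ∧ ∀ p : M, mink (F.lGaussMap p - O) v = 0 := by
  have hlocal : ∀ p : M, ∃ v : Mink, v ≠ 0 ∧
      ∀ᶠ q in 𝓝 p, mink (F.lGaussMap q) v = mink (F.lGaussMap p) v := by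
    intro p
    obtain ⟨c, e, h, hp⟩ := exists_isStereoChart F p
    obtain ⟨e₁, he₁, hp₁, A, hA, hco⟩ := hiso p
    obtain ⟨v, hv0, hv⟩ := h.exists_orthogonal_of_isothermic hF
      (fun z hz => h.biharmonic_support hmin hz) he₁ hA hco hp hp₁
    exact ⟨v, hv0, (h.eventually_mink_lGaussMap_iff hF hp v).2 hv⟩
  obtain ⟨p₀⟩ : Nonempty M := inferInstance
  obtain ⟨v, hv0, hv⟩ := hlocal p₀
  set S : Set M := {p | ∀ᶠ q in 𝓝 p, mink (F.lGaussMap q) v = mink (F.lGaussMap p) v} with hS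
  have hopen : IsOpen S := by
    rw [isOpen_iff_mem_nhds]
    intro p hp
    filter_upwards [hp.eventually_nhds] with q hq
    show ∀ᶠ q' in 𝓝 q, _
    rw [hq.self_of_nhds]
    exact hq
  have hclosed : IsClosed S := by
    rw [isClosed_iff_frequently]
    intro p hp
    obtain ⟨w, hw0, hw⟩ := hlocal p
    have hw' : ∀ᶠ q in 𝓝 p, ∀ᶠ q' in 𝓝 q, mink (F.lGaussMap q') w = mink (F.lGaussMap q) w := by
      filter_upwards [hw.eventually_nhds] with q hq
      rw [hq.self_of_nhds]
      exact hq
    obtain ⟨q, hq, hqw⟩ := (hp.and_eventually hw').exists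
    obtain ⟨c, e, h, hqe⟩ := exists_isStereoChart F q
    obtain ⟨k, rfl⟩ := h.eq_smul_of_orthogonal hF hqe hq hqw hw0
    show ∀ᶠ q' in 𝓝 p, _
    filter_upwards [hw] with q' hq'
    rw [mink_smul_right, mink_smul_right, hq']
  have huniv : S = univ := IsClopen.eq_univ ⟨hclosed, hopen⟩ ⟨p₀, hv⟩
  have hconst : IsLocallyConstant fun p => mink (F.lGaussMap p) v :=
    (IsLocallyConstant.iff_eventually_eq _).2 fun p => (huniv ▸ mem_univ p : p ∈ S)
  refine ⟨F.lGaussMap p₀, v, hv0, fun p => ?_⟩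
  rw [mink_sub_left, hconst.apply_eq_of_preconnectedSpace p p₀, sub_self]

end

/-! ### L-isothermic coordinates from a holomorphic primitive -/

/-- The rotation of the coordinate plane by a right angle. -/
noncomputable def quarterTurn : E2 →L[ℝ] E2 :=
  LinearMap.toContinuousLinearMap
    { toFun := fun ξ => !₂[-ξ 1, ξ 0]
      map_add' := by
        intro ξ η
        ext i
        fin_cases i <;> simp
        ring
      map_smul' := by
        intro t ξ
        ext i
        fin_cases i <;> simp }

lemma quarterTurn_zero (ξ : E2) : quarterTurn ξ 0 = -ξ 1 := rfl

lemma quarterTurn_one (ξ : E2) : quarterTurn ξ 1 = ξ 0 := rfl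

/-- A holomorphic function `P + i T`, given by the Cauchy-Riemann equations, has a primitive. -/
lemma exists_holomorphic_primitive {P T : E2 → ℝ} {B : Set E2} (hB : IsOpen B) (hconv : Convex ℝ B)
    (hP : ContDiffOn ℝ ∞ P B) (hT : ContDiffOn ℝ ∞ T B)
    (h0 : ∀ z ∈ B, pd 0 P z = pd 1 T z) (h1 : ∀ z ∈ B, pd 1 P z = -pd 0 T z) :
    ∃ W : E2 → E2, ContDiffOn ℝ ∞ W B ∧ ∀ z ∈ B, ∀ ξ,
      fderiv ℝ W z ξ 0 = P z * ξ 0 - T z * ξ 1 ∧ fderiv ℝ W z ξ 1 = T z * ξ 0 + P z * ξ 1 := by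
  set η : E2 → E2 →L[ℝ] E2 := fun z => P z • ContinuousLinearMap.id ℝ E2 + T z • quarterTurn with hη
  have hηs : ContDiffOn ℝ ∞ η B := (hP.smul contDiffOn_const).add (hT.smul contDiffOn_const)
  have hdη : ∀ z ∈ B, ∀ ξ ζ, fderiv ℝ η z ξ ζ
      = fderiv ℝ P z ξ • ζ + fderiv ℝ T z ξ • quarterTurn ζ := by
    intro z hz ξ ζ
    have h := (((hP.diffAt hB hz).hasFDerivAt.smul_const (ContinuousLinearMap.id ℝ E2)).add
      ((hT.diffAt hB hz).hasFDerivAt.smul_const quarterTurn)).fderiv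
    have h' : fderiv ℝ η z = _ := h
    rw [h']
    simp
  obtain ⟨W, hW⟩ := hconv.exists_forall_hasFDerivAt_of_fderiv_symmetric hB
    (fun z hz => (hηs.diffAt hB hz).differentiableWithinAt) (fun z hz ξ ζ => by
      rw [hdη z hz, hdη z hz]
      simp only [fderiv_eq_pd, h0 z hz, h1 z hz]
      ext i
      fin_cases i
      · simp [quarterTurn_zero]; ring
      · simp [quarterTurn_one]; ring)
  refine ⟨W, ?_, fun z hz ξ => ?_⟩
  · rw [contDiffOn_infty_iff_fderiv_of_isOpen hB]
    exact ⟨fun z hz => (hW z hz).differentiableAt.differentiableWithinAt,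
      hηs.congr fun z hz => (hW z hz).fderiv⟩
  · rw [(hW z hz).fderiv]
    simp [hη, quarterTurn_zero, quarterTurn_one]
    constructor <;> ring

section

variable {M : Type*} [TopologicalSpace M] [ChartedSpace E2 M]

variable {F : LegendreImmersion M} {c : Fin 4 → Mink} {e : OpenPartialHomeomorph M E2}

namespace IsStereoChart

variable (h : IsStereoChart F c e)

include h

/-- When the middle position lies in a hyperplane with normal vector `v`, the quotient of `4 ∂_z² s`
by the pairing `R = ⟨N, v⟩`, which has no zeros, is holomorphic, hence locally the square of a
holomorphic function `P + i T`. -/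
lemma exists_holomorphic_root (hF : F.Nondegenerate) {v : Mink} (hv0 : v ≠ 0)
    (hv : ∀ z ∈ e.target, ∀ i, mink (pd i (middlePos c (support F c e)) z) v = 0) {z₀ : E2}
    (hz₀ : z₀ ∈ e.target) : ∃ (B : Set E2) (P T R : E2 → ℝ), IsOpen B ∧ Convex ℝ B ∧ z₀ ∈ B ∧
      B ⊆ e.target ∧ ContDiffOn ℝ ∞ P B ∧ ContDiffOn ℝ ∞ T B ∧ ∀ z ∈ B,
        pd 0 P z = pd 1 T z ∧ pd 1 P z = -pd 0 T z ∧ 0 < P z ^ 2 + T z ^ 2 ∧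
        hessDiff (support F c e) z = R z * (P z ^ 2 - T z ^ 2) ∧
        hessMix (support F c e) z = -(R z * (2 * P z * T z)) := by
  have hc := h.basis
  set s := support F c e
  have hs : ContDiffOn ℝ ∞ s e.target := h.contDiffOn_support
  have hΩ := e.open_target
  have has : ContDiffOn ℝ ∞ (hessDiff s) e.target := contDiffOn_hessDiff hΩ hs
  have hbs : ContDiffOn ℝ ∞ (hessMix s) e.target := contDiffOn_hessMix hΩ hs
  set R := pairing c v
  have hR : ContDiffOn ℝ ∞ R e.target := (contDiff_pairing c v).contDiffOn
  have hR0 : ∀ z ∈ e.target, R z ≠ 0 := fun z hz h0 =>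
    hv0 (eq_zero_of_orthogonal_middlePos hΩ hs hc hv hz (h.hess_ne_zero hz hF) h0)
  have hαs : ContDiffOn ℝ ∞ (fun z => hessDiff s z / R z) e.target := has.div hR hR0
  have hβs : ContDiffOn ℝ ∞ (fun z => -hessMix s z / R z) e.target := hbs.neg.div hR hR0
  have hpos : ∀ z ∈ e.target, 0 < (hessDiff s z / R z) ^ 2 + (-hessMix s z / R z) ^ 2 := by
    intro z hz
    have h1 := h.hess_ne_zero hz hF
    have h2 := hR0 z hz
    rw [div_pow, div_pow, ← add_div, neg_sq]
    exact div_pos h1 (by positivity)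
  obtain ⟨Ω, C, S, r, hΩo, hzΩ, hsub, hC, hS, hr, hCSr⟩ := exists_half_angle hΩ hαs hβs hz₀
    (hpos z₀ hz₀)
  obtain ⟨δ, hδ, hball⟩ := Metric.isOpen_iff.1 hΩo z₀ hzΩ
  set P : E2 → ℝ := fun z => √(r z) * C z with hP
  set T : E2 → ℝ := fun z => √(r z) * S z with hT
  have hsq : ContDiffOn ℝ ∞ (fun z => √(r z)) Ω := hr.sqrt fun z hz => (hCSr z hz).1.ne'
  have hPs : ContDiffOn ℝ ∞ P Ω := hsq.mul hC
  have hTs : ContDiffOn ℝ ∞ T Ω := hsq.mul hS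
  have hPT : ∀ z ∈ Ω, P z ^ 2 + T z ^ 2 = r z ∧ hessDiff s z = R z * (P z * P z + -T z * T z) ∧
      -hessMix s z = R z * (P z * T z + T z * P z) := by
    intro z hz
    obtain ⟨h1, h2, h3, h4⟩ := hCSr z hz
    have h5 : √(r z) ^ 2 = r z := Real.sq_sqrt h1.le
    have h6 := hR0 z (hsub hz)
    rw [div_eq_iff h6] at h3 h4
    refine ⟨?_, ?_, ?_⟩
    · simp only [hP, hT]; linear_combination (C z ^ 2 + S z ^ 2) * h5 + r z * h2
    · simp only [hP, hT]; linear_combination h3 - R z * (C z ^ 2 - S z ^ 2) * h5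
    · simp only [hP, hT]; linear_combination h4 - R z * (2 * C z * S z) * h5
  refine ⟨Metric.ball z₀ δ, P, T, R, Metric.isOpen_ball, convex_ball _ _, Metric.mem_ball_self hδ,
    hball.trans hsub, hPs.mono hball, hTs.mono hball, fun z hzB => ?_⟩
  have hz := hball hzB
  have hzt := hsub hz
  obtain ⟨k1, k2, k3⟩ := hPT z hz
  have hk : 0 < P z ^ 2 + T z ^ 2 := k1 ▸ (hCSr z hz).1
  have dP := hPs.diffAt hΩo hz
  have dT := hTs.diffAt hΩo hz
  have dR := hR.diffAt hΩ hzt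
  have hda : ∀ i, pd i (hessDiff s) z = pd i R z * (P z * P z + -T z * T z)
      + R z * (2 * (P z * pd i P z - T z * pd i T z)) := by
    intro i
    rw [pd_congr_on hΩo (fun y hy => (hPT y hy).2.1) hz,
      pd_mul dR ((dP.fun_mul dP).fun_add (dT.fun_neg.fun_mul dT)),
      pd_mul_add_mul dP dP dT.fun_neg dT, pd_neg]
    ring
  have hdb : ∀ i, -pd i (hessMix s) z = pd i R z * (P z * T z + T z * P z)
      + R z * (2 * (P z * pd i T z + T z * pd i P z)) := by
    intro i
    rw [← pd_neg, pd_congr_on hΩo (fun y hy => (hPT y hy).2.2) hz,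
      pd_mul dR ((dP.fun_mul dT).fun_add (dT.fun_mul dP)), pd_mul_add_mul dP dT dT dP]
    ring
  have E0 := four_mul_mink_pd_zero_middlePos (c := c) hΩ hs hzt v
  have E1 := four_mul_mink_pd_one_middlePos (c := c) hΩ hs hzt v
  rw [hv z hzt, pd_zero_quarterLap hΩ hs hzt] at E0
  rw [hv z hzt, pd_one_quarterLap hΩ hs hzt] at E1
  have hR2 : R z ^ 2 ≠ 0 := pow_ne_zero 2 (hR0 z hzt)
  -- the equations say that the square of `P + i T` is holomorphic
  have u1 : P z * (pd 0 P z - pd 1 T z) - T z * (pd 1 P z + pd 0 T z) = 0 := by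
    refine (mul_eq_zero.1 (?_ : 2 * R z ^ 2 * _ = 0)).resolve_left (mul_ne_zero two_ne_zero hR2)
    linear_combination E0 - R z * hda 0 + R z * hdb 1 + pd 0 R z * k2 - pd 1 R z * k3
  have u2 : P z * (pd 1 P z + pd 0 T z) + T z * (pd 0 P z - pd 1 T z) = 0 := by
    refine (mul_eq_zero.1 (?_ : 2 * R z ^ 2 * _ = 0)).resolve_left (mul_ne_zero two_ne_zero hR2)
    linear_combination -E1 - R z * hda 1 - R z * hdb 0 + pd 0 R z * k3 + pd 1 R z * k2
  have w1 : pd 0 P z - pd 1 T z = 0 := by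
    refine (mul_eq_zero.1 (?_ : (P z ^ 2 + T z ^ 2) * _ = 0)).resolve_left hk.ne'
    linear_combination P z * u1 + T z * u2
  have w2 : pd 1 P z + pd 0 T z = 0 := by
    refine (mul_eq_zero.1 (?_ : (P z ^ 2 + T z ^ 2) * _ = 0)).resolve_left hk.ne'
    linear_combination P z * u2 - T z * u1
  exact ⟨by linarith, by linarith, hk, by rw [k2]; ring, by linear_combination -k3⟩

end IsStereoChart

/-- The real and imaginary parts of a primitive of the square root of `4 ∂_z² s / ⟨N, v⟩` are
L-isothermic coordinates. -/
lemma isLIsothermic_of_hyperplane [IsManifold (𝓡 2) ∞ M] (hF : F.Nondegenerate) {O v : Mink}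
    (hv0 : v ≠ 0) (hO : ∀ p : M, mink (F.lGaussMap p - O) v = 0) : F.IsLIsothermic := by
  intro p
  obtain ⟨c, e, h, hp⟩ := exists_isStereoChart F p
  have hc := h.basis
  have he := h.mem_atlas
  have hv : ∀ z ∈ e.target, ∀ i, mink (pd i (middlePos c (support F c e)) z) v = 0 := by
    intro z hz i
    rw [← h.pd_mink_middlePos hz, pd_congr_on (w := fun _ => mink O v) e.open_target ?_ hz,
      pd_const]
    intro y hy
    have := hO (e.symm y)
    rw [mink_sub_left, h.lGaussMap_eq hF (e.map_target hy), e.right_inv hy] at this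
    exact sub_eq_zero.1 this
  obtain ⟨B, P, T, R, hB, hconv, hpB, hBe, hP, hT, hPT⟩ :=
    h.exists_holomorphic_root hF hv0 hv (e.map_source hp)
  obtain ⟨W, hW, hdW⟩ := exists_holomorphic_primitive hB hconv hP hT (fun z hz => (hPT z hz).1)
    (fun z hz => (hPT z hz).2.1)
  obtain ⟨U, A, hU, hpU, hA⟩ := h.exists_isMiddleFrameOn hF hp
  obtain ⟨e₁, he₁, hp₁, hsub, hsubB, heW⟩ := exists_chart_of_injective_fderiv he hp hB hW hpB
    (fun ξ hξ => by
      obtain ⟨d0, d1⟩ := hdW _ hpB ξ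
      have hk := (hPT _ hpB).2.2.1
      rw [hξ] at d0 d1
      simp only [PiLp.zero_apply] at d0 d1
      ext i
      fin_cases i
      · refine (mul_eq_zero.1 (?_ : (P (e p) ^ 2 + T (e p) ^ 2) * _ = 0)).resolve_left hk.ne'
        simp only [Fin.zero_eta]
        linear_combination -P (e p) * d0 - T (e p) * d1
      · refine (mul_eq_zero.1 (?_ : (P (e p) ^ 2 + T (e p) ^ 2) * _ = 0)).resolve_left hk.ne'
        simp only [Fin.mk_one]
        linear_combination T (e p) * d0 - P (e p) * d1) hU hpU
  have hA₁ := hA.mono (fun q hq => (hsub hq).2 : e₁.source ⊆ U)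
  refine ⟨e₁, he₁, hp₁, A, hA₁, fun y hy => ?_⟩
  set s := support F c e
  set Ω := e.target ∩ e.symm ⁻¹' e₁.source
  have hΩ : IsOpen Ω := e.isOpen_inter_preimage_symm e₁.open_source
  have hs : ContDiffOn ℝ ∞ s Ω := h.contDiffOn_support.mono inter_subset_left
  have hxs : ContDiffOn ℝ ∞ (A.x ∘ e₁.symm) e₁.target :=
    (contDiffOn_chart he₁ hA₁.1.smooth_x).mono fun z hz => ⟨hz, e₁.map_target hz⟩
  have has : ContDiffOn ℝ ∞ (A.a 0 ∘ e₁.symm) e₁.target :=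
    (contDiffOn_chart he₁ (hA₁.1.smooth_a 0)).mono fun z hz => ⟨hz, e₁.map_target hz⟩
  obtain ⟨ρ, hρs, hρ⟩ := h.exists_factor e₁.open_source hA₁
  have hWe : ∀ z ∈ Ω, W z = e₁ (e.symm z) := fun z hz => by
    rw [heW _ hz.2, e.right_inv hz.1]
  have hxW : EqOn (middlePos c s) ((A.x ∘ e₁.symm) ∘ W) Ω := by
    intro z hz
    have h1 := (h.eq_middlePos_of_isMiddleFrameOn e₁.open_source hA₁ hz.2 (e.map_target hz.1)).1
    rw [e.right_inv hz.1] at h1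
    simp only [Function.comp_apply]
    rw [hWe z hz, e₁.left_inv hz.2]
    exact h1.symm
  have haW : EqOn (fun z => ρ z • nulPt c z) ((A.a 0 ∘ e₁.symm) ∘ W) Ω := by
    intro z hz
    simp only [Function.comp_apply]
    rw [hWe z hz, e₁.left_inv hz.2]
    exact (hρ z hz).1.symm
  set z := e (e₁.symm y) with hzdef
  have hqe₁ := e₁.map_target hy
  have hqe := (hsub hqe₁).1
  have hz : z ∈ Ω := ⟨e.map_source hqe, by
    show e.symm (e (e₁.symm y)) ∈ e₁.source
    rw [e.left_inv hqe]; exact hqe₁⟩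
  have hzB : z ∈ B := hsubB _ hqe₁
  have hWz : W z = y := by rw [hWe z hz, hzdef, e.left_inv hqe, e₁.right_inv hy]
  have dx : DifferentiableAt ℝ (A.x ∘ e₁.symm) (W z) := hWz ▸ hxs.diffAt e₁.open_target hy
  have da : DifferentiableAt ℝ (A.a 0 ∘ e₁.symm) (W z) := hWz ▸ has.diffAt e₁.open_target hy
  have dW := hW.diffAt hB hzB
  have dρ := hρs.diffAt hΩ hz
  have J00 : (pd 0 W z) 0 = P z := by rw [pd, (hdW z hzB _).1]; simp
  have J10 : (pd 0 W z) 1 = T z := by rw [pd, (hdW z hzB _).2]; simp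
  have J01 : (pd 1 W z) 0 = -T z := by rw [pd, (hdW z hzB _).1]; simp
  have J11 : (pd 1 W z) 1 = P z := by rw [pd, (hdW z hzB _).2]; simp
  obtain ⟨-, -, hk, hab, hbb⟩ := hPT z hzB
  have b00 := minkCoeff_comp dx dx dW 0 0
  have b11 := minkCoeff_comp dx dx dW 1 1
  have b01 := minkCoeff_comp dx dx dW 0 1
  have c00 := minkCoeff_comp dx da dW 0 0
  have c11 := minkCoeff_comp dx da dW 1 1
  have c01 := minkCoeff_comp dx da dW 0 1
  have c10 := minkCoeff_comp dx da dW 1 0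
  rw [← minkCoeff_congr_on hΩ hxW hxW hz, minkCoeff_middlePos_zero_zero hΩ hs hc hz,
    minkCoeff_swap _ 1 0, hWz, J00, J10] at b00
  rw [← minkCoeff_congr_on hΩ hxW hxW hz, minkCoeff_middlePos_one_one hΩ hs hc hz,
    minkCoeff_swap _ 1 0, hWz, J01, J11] at b11
  rw [← minkCoeff_congr_on hΩ hxW hxW hz, minkCoeff_middlePos_zero_one hΩ hs hc hz,
    minkCoeff_swap _ 1 0, hWz, J00, J10, J01, J11] at b01
  rw [← minkCoeff_congr_on hΩ hxW haW hz, minkCoeff_middlePos_smul hΩ hs hc hz dρ, pd_zero_nulPt,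
    mink_pd_middlePos_nulX hΩ hs hc hz, if_pos rfl, hWz, J00, J10, hab] at c00
  rw [← minkCoeff_congr_on hΩ hxW haW hz, minkCoeff_middlePos_smul hΩ hs hc hz dρ, pd_one_nulPt,
    mink_pd_middlePos_nulY hΩ hs hc hz, if_neg one_ne_zero, hWz, J01, J11, hab] at c11
  rw [← minkCoeff_congr_on hΩ hxW haW hz, minkCoeff_middlePos_smul hΩ hs hc hz dρ, pd_one_nulPt,
    mink_pd_middlePos_nulY hΩ hs hc hz, if_pos rfl, hWz, J00, J10, J01, J11, hbb] at c01
  rw [← minkCoeff_congr_on hΩ hxW haW hz, minkCoeff_middlePos_smul hΩ hs hc hz dρ, pd_zero_nulPt,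
    mink_pd_middlePos_nulX hΩ hs hc hz, if_neg one_ne_zero, hWz, J00, J10, J01, J11, hbb] at c10
  generalize minkCoeff (A.x ∘ e₁.symm) (A.x ∘ e₁.symm) 0 0 y = u00 at *
  generalize minkCoeff (A.x ∘ e₁.symm) (A.x ∘ e₁.symm) 0 1 y = u01 at *
  generalize minkCoeff (A.x ∘ e₁.symm) (A.x ∘ e₁.symm) 1 1 y = u11 at *
  generalize minkCoeff (A.x ∘ e₁.symm) (A.a 0 ∘ e₁.symm) 0 0 y = m00 at *
  generalize minkCoeff (A.x ∘ e₁.symm) (A.a 0 ∘ e₁.symm) 0 1 y = m01 at *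
  generalize minkCoeff (A.x ∘ e₁.symm) (A.a 0 ∘ e₁.symm) 1 0 y = m10 at *
  generalize minkCoeff (A.x ∘ e₁.symm) (A.a 0 ∘ e₁.symm) 1 1 y = m11 at *
  generalize P z = P at *
  generalize T z = T at *
  have hk2 : (P ^ 2 + T ^ 2) ^ 2 ≠ 0 := pow_ne_zero 2 hk.ne'
  have hm : m01 - m10 = 0 := by
    refine (mul_eq_zero.1 (?_ : (P ^ 2 + T ^ 2) * _ = 0)).resolve_left hk.ne'
    linear_combination c10 - c01
  have hm' : m00 + m11 = 0 := by
    refine (mul_eq_zero.1 (?_ : (P ^ 2 + T ^ 2) * _ = 0)).resolve_left hk.ne'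
    linear_combination -c00 - c11
  have hm01 : m01 = 0 := by
    refine (mul_eq_zero.1 (?_ : (P ^ 2 + T ^ 2) ^ 2 * _ = 0)).resolve_left hk2
    linear_combination -(2 * P * T) * c00 - (P ^ 2 - T ^ 2) * c01
      + (2 * P * T * P * T - (P ^ 2 - T ^ 2) * T ^ 2) * hm
      + (-2 * P * T * T ^ 2 - (P ^ 2 - T ^ 2) * P * T) * hm'
  refine ⟨?_, ?_, hm01, by linarith⟩
  · rw [← sub_eq_zero]
    refine (mul_eq_zero.1 (?_ : (P ^ 2 + T ^ 2) ^ 2 * _ = 0)).resolve_left hk2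
    linear_combination (P ^ 2 - T ^ 2) * (b11 - b00) + 4 * P * T * b01
  · refine (mul_eq_zero.1 (?_ : (P ^ 2 + T ^ 2) ^ 2 * _ = 0)).resolve_left hk2
    linear_combination P * T * (b11 - b00) - (P ^ 2 - T ^ 2) * b01

end

/-! ### Mean curvature of the L-Gauss map -/

/-- The trace, with respect to the induced metric, of the second derivative of a conformal harmonic
map `u` vanishes; after a change `W` of the parameters it is tangential. The trace is multiplied by
the determinant of the metric. -/
lemma trace_comp_mem_span {Ω Ω' : Set E2} (hΩ : IsOpen Ω) (hΩ' : IsOpen Ω') {W : E2 → E2}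
    (hW : ContDiffOn ℝ ∞ W Ω) (hmaps : MapsTo W Ω Ω') {u : E2 → Mink} (hu : ContDiffOn ℝ ∞ u Ω')
    {z : E2} (hz : z ∈ Ω) (h01 : minkCoeff u u 0 1 (W z) = 0)
    (h00 : minkCoeff u u 0 0 (W z) = minkCoeff u u 1 1 (W z))
    (hlap : pd 0 (pd 0 u) (W z) + pd 1 (pd 1 u) (W z) = 0)
    (hdet : (pd 0 W z) 0 * (pd 1 W z) 1 - (pd 1 W z) 0 * (pd 0 W z) 1 ≠ 0) :
    minkCoeff (u ∘ W) (u ∘ W) 1 1 z • pd 0 (pd 0 (u ∘ W)) z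
        - (2 * minkCoeff (u ∘ W) (u ∘ W) 0 1 z) • pd 0 (pd 1 (u ∘ W)) z
        + minkCoeff (u ∘ W) (u ∘ W) 0 0 z • pd 1 (pd 1 (u ∘ W)) z
      ∈ Submodule.span ℝ {pd 0 (u ∘ W) z, pd 1 (u ∘ W) z} := by
  have hWz := hmaps hz
  have dW := hW.diffAt hΩ hz
  have du := hu.diffAt hΩ' hWz
  have dui := fun i => (contDiffOn_pd hΩ' hu i).diffAt hΩ' hWz
  have hJ : ∀ i k, DifferentiableAt ℝ (fun y => (pd i W y) k) z := fun i k =>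
    ((contDiff_coord k).comp_contDiffOn (contDiffOn_pd hΩ hW i)).diffAt hΩ hz
  have hcomp : ∀ k, DifferentiableAt ℝ (pd k u ∘ W) z := fun k => (dui k).comp z dW
  have first : ∀ i, pd i (u ∘ W) z = (pd i W z) 0 • pd 0 u (W z) + (pd i W z) 1 • pd 1 u (W z) :=
    fun i => pd_comp du dW i
  have second : ∀ j i, pd j (pd i (u ∘ W)) z
      = (pd j (fun y => (pd i W y) 0) z • pd 0 u (W z)
          + (pd i W z) 0 • ((pd j W z) 0 • pd 0 (pd 0 u) (W z)
            + (pd j W z) 1 • pd 1 (pd 0 u) (W z)))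
        + (pd j (fun y => (pd i W y) 1) z • pd 1 u (W z)
          + (pd i W z) 1 • ((pd j W z) 0 • pd 0 (pd 1 u) (W z)
            + (pd j W z) 1 • pd 1 (pd 1 u) (W z))) := by
    intro j i
    rw [pd_congr_on hΩ (w := fun y => (pd i W y) 0 • (pd 0 u ∘ W) y + (pd i W y) 1 • (pd 1 u ∘ W) y)
        (fun y hy => pd_comp (hu.diffAt hΩ' (hmaps hy)) (hW.diffAt hΩ hy) i) hz,
      pd_add ((hJ i 0).fun_smul (hcomp 0)) ((hJ i 1).fun_smul (hcomp 1)),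
      pd_smul (hJ i 0) (hcomp 0), pd_smul (hJ i 1) (hcomp 1), pd_comp (dui 0) dW,
      pd_comp (dui 1) dW]
    rfl
  have hsw : pd 1 (pd 0 u) (W z) = pd 0 (pd 1 u) (W z) := pd_comm hΩ' hu hWz 1 0
  have hlap' : pd 1 (pd 1 u) (W z) = -pd 0 (pd 0 u) (W z) := (neg_eq_of_add_eq_zero_right hlap).symm
  rw [minkCoeff_comp du du dW, minkCoeff_comp du du dW, minkCoeff_comp du du dW,
    minkCoeff_swap u 1 0, h01, ← h00]
  -- the differential of `u` at `W z` in terms of that of the composite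
  have t0 : pd 0 u (W z) ∈ Submodule.span ℝ {pd 0 (u ∘ W) z, pd 1 (u ∘ W) z} := by
    refine Submodule.mem_span_pair.2
      ⟨(pd 1 W z) 1 / ((pd 0 W z) 0 * (pd 1 W z) 1 - (pd 1 W z) 0 * (pd 0 W z) 1),
        -(pd 0 W z) 1 / ((pd 0 W z) 0 * (pd 1 W z) 1 - (pd 1 W z) 0 * (pd 0 W z) 1), ?_⟩
    rw [first, first]
    generalize (pd 0 W z) 0 = a at *
    generalize (pd 0 W z) 1 = b at *
    generalize (pd 1 W z) 0 = a' at *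
    generalize (pd 1 W z) 1 = b' at *
    match_scalars
    · linear_combination mul_inv_cancel₀ hdet
    · ring
  have t1 : pd 1 u (W z) ∈ Submodule.span ℝ {pd 0 (u ∘ W) z, pd 1 (u ∘ W) z} := by
    refine Submodule.mem_span_pair.2
      ⟨-(pd 1 W z) 0 / ((pd 0 W z) 0 * (pd 1 W z) 1 - (pd 1 W z) 0 * (pd 0 W z) 1),
        (pd 0 W z) 0 / ((pd 0 W z) 0 * (pd 1 W z) 1 - (pd 1 W z) 0 * (pd 0 W z) 1), ?_⟩
    rw [first, first]
    generalize (pd 0 W z) 0 = a at *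
    generalize (pd 0 W z) 1 = b at *
    generalize (pd 1 W z) 0 = a' at *
    generalize (pd 1 W z) 1 = b' at *
    match_scalars
    · field_simp; ring
    · field_simp; ring
  have key : ∀ k l : ℝ, k • pd 0 u (W z) + l • pd 1 u (W z)
      ∈ Submodule.span ℝ {pd 0 (u ∘ W) z, pd 1 (u ∘ W) z} := fun k l =>
    Submodule.add_mem _ (Submodule.smul_mem _ _ t0) (Submodule.smul_mem _ _ t1)
  generalize minkCoeff u u 0 0 (W z) = μ
  rw [second 0 0, second 0 1, second 1 1, hsw, hlap']
  convert key
    (μ * (((pd 1 W z) 0 ^ 2 + (pd 1 W z) 1 ^ 2) * pd 0 (fun y => (pd 0 W y) 0) z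
      - 2 * ((pd 0 W z) 0 * (pd 1 W z) 0 + (pd 0 W z) 1 * (pd 1 W z) 1)
        * pd 0 (fun y => (pd 1 W y) 0) z
      + ((pd 0 W z) 0 ^ 2 + (pd 0 W z) 1 ^ 2) * pd 1 (fun y => (pd 1 W y) 0) z))
    (μ * (((pd 1 W z) 0 ^ 2 + (pd 1 W z) 1 ^ 2) * pd 0 (fun y => (pd 0 W y) 1) z
      - 2 * ((pd 0 W z) 0 * (pd 1 W z) 0 + (pd 0 W z) 1 * (pd 1 W z) 1)
        * pd 0 (fun y => (pd 1 W y) 1) z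
      + ((pd 0 W z) 0 ^ 2 + (pd 0 W z) 1 ^ 2) * pd 1 (fun y => (pd 1 W y) 1) z)) using 1
  module

section

variable {M : Type*} [TopologicalSpace M] [ChartedSpace E2 M]

lemma hyperplane_trichotomy (O : Mink) {v : Mink} (hv : v ≠ 0) :
    IsSpacelikeHyperplane (hyperplane O v) ∨ IsTimelikeHyperplane (hyperplane O v) ∨
      IsIsotropicHyperplane (hyperplane O v) := by
  rcases lt_trichotomy (mink v v) 0 with h | h | h
  · exact Or.inl ⟨O, v, h, rfl⟩
  · exact Or.inr (Or.inr ⟨O, v, ⟨h, hv⟩, rfl⟩)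
  · exact Or.inr (Or.inl ⟨O, v, h, rfl⟩)

/-- The transition map between two charts has an invertible Jacobian. -/
lemma transition_det_ne_zero {e e' : OpenPartialHomeomorph M E2}
    (he : e ∈ IsManifold.maximalAtlas (𝓡 2) ∞ M) (he' : e' ∈ IsManifold.maximalAtlas (𝓡 2) ∞ M)
    {z : E2} (hz : z ∈ e'.target) (hze : e'.symm z ∈ e.source) :
    (pd 0 (e ∘ e'.symm) z) 0 * (pd 1 (e ∘ e'.symm) z) 1
      - (pd 1 (e ∘ e'.symm) z) 0 * (pd 0 (e ∘ e'.symm) z) 1 ≠ 0 := by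
  have hΩ : IsOpen (e'.target ∩ e'.symm ⁻¹' e.source) := e'.isOpen_inter_preimage_symm e.open_source
  have hW : ContDiffOn ℝ ∞ (e ∘ e'.symm) (e'.target ∩ e'.symm ⁻¹' e.source) :=
    contDiffOn_chart he' (contMDiffOn_of_mem_maximalAtlas he)
  have dW := hW.diffAt hΩ ⟨hz, hze⟩
  have hq := e'.map_target hz
  have hinj : ∀ ξ, fderiv ℝ (e ∘ e'.symm) z ξ = 0 → ξ = 0 := by
    intro ξ hξ
    obtain ⟨X, hX⟩ := (chartDeriv_bijective he' hq).2 ξ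
    have h1 : chartDeriv e (e'.symm z) X
        = fderiv ℝ (e ∘ e'.symm) (e' (e'.symm z)) (chartDeriv e' (e'.symm z) X) :=
      mfderiv_eq_fderiv_chart he' hq (u := e) (by rw [e'.right_inv hz]; exact dW) X
    rw [e'.right_inv hz, hX, hξ, chartDeriv_eq_zero_iff he hze] at h1
    rw [← hX, h1]
    exact (chartDeriv_eq_zero_iff he' hq 0).2 rfl
  have hker : ∀ x y : ℝ, x • pd 0 (e ∘ e'.symm) z + y • pd 1 (e ∘ e'.symm) z = 0 →
      x = 0 ∧ y = 0 := by
    intro x y hxy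
    have h1 := hinj (!₂[x, y]) (by rw [fderiv_eq_pd]; simpa using hxy)
    exact ⟨by simpa using congrArg (fun w : E2 => w 0) h1,
      by simpa using congrArg (fun w : E2 => w 1) h1⟩
  intro h0
  generalize pd 0 (e ∘ e'.symm) z = J₀ at *
  generalize pd 1 (e ∘ e'.symm) z = J₁ at *
  have k1 := hker (J₁ 1) (-J₀ 1) (by
    ext i
    fin_cases i
    · simp; linear_combination h0
    · simp; ring)
  have k0 := hker (J₁ 0) (-J₀ 0) (by
    ext i
    fin_cases i
    · simp; ring
    · simp; linear_combination -h0)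
  have hJ₀ : J₀ = 0 := by
    ext i
    fin_cases i
    · simpa using k0.2
    · simpa using k1.2
  have := (hker 1 0 (by rw [hJ₀]; simp)).1
  norm_num at this

variable [IsManifold (𝓡 2) ∞ M] {F : LegendreImmersion M}

lemma isSpacelikeImmersion_lGaussMap (hF : F.Nondegenerate) :
    IsSpacelikeImmersion F.lGaussMap := by
  constructor
  · intro p
    obtain ⟨c, e, h, hp⟩ := exists_isStereoChart F p
    exact (contMDiffOn_of_chart h.mem_atlas
      (contDiffOn_middlePos e.open_target h.contDiffOn_support c) subset_rfl
      (fun q hq => e.map_source hq) (fun q hq => h.lGaussMap_eq hF hq)).contMDiffAt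
      (e.open_source.mem_nhds hp)
  · intro p X hX
    obtain ⟨c, e, h, hp⟩ := exists_isStereoChart F p
    have hs := h.contDiffOn_support
    have hz := e.map_source hp
    have hev : F.lGaussMap =ᶠ[𝓝 p] middlePos c (support F c e) ∘ e := by
      filter_upwards [e.open_source.mem_nhds hp] with q hq using h.lGaussMap_eq hF hq
    have hd := mfderiv_eq_fderiv_of_chart h.mem_atlas hp hev
      ((contDiffOn_middlePos e.open_target hs c).diffAt e.open_target hz) X
    have hξ : chartDeriv e p X ≠ 0 := fun h0 => hX ((chartDeriv_eq_zero_iff h.mem_atlas hp X).1 h0)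
    rw [hd, fderiv_eq_pd]
    generalize chartDeriv e p X = ξ at hξ
    have b00 := minkCoeff_middlePos_zero_zero e.open_target hs h.basis hz
    have b11 := minkCoeff_middlePos_one_one e.open_target hs h.basis hz
    have b01 := minkCoeff_middlePos_zero_one e.open_target hs h.basis hz
    rw [minkCoeff] at b00 b11 b01
    have b10 := (mink_comm _ _).trans b01
    simp only [mink_add_left, mink_add_right, mink_smul_left, mink_smul_right, b00, b11, b01, b10]
    have hne := h.hess_ne_zero hz hF
    have hξ2 : 0 < ξ 0 ^ 2 + ξ 1 ^ 2 := by
      refine lt_of_le_of_ne (by positivity) fun h0 => hξ ?_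
      ext i
      fin_cases i
      · simp only [Fin.zero_eta, PiLp.zero_apply]
        nlinarith [sq_nonneg (ξ 0), sq_nonneg (ξ 1)]
      · simp only [Fin.mk_one, PiLp.zero_apply]
        nlinarith [sq_nonneg (ξ 0), sq_nonneg (ξ 1)]
    have := mul_pos hne hξ2
    nlinarith

lemma trace_lGaussMap_mem_span [T2Space M] (hF : F.Nondegenerate) (hmin : F.IsLMinimal)
    {e' : OpenPartialHomeomorph M E2} (he' : e' ∈ IsManifold.maximalAtlas (𝓡 2) ∞ M) {z : E2}
    (hz : z ∈ e'.target) :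
    let s : E2 → Mink := F.lGaussMap ∘ e'.symm
    minkCoeff s s 1 1 z • pd 0 (pd 0 s) z - (2 * minkCoeff s s 0 1 z) • pd 0 (pd 1 s) z
        + minkCoeff s s 0 0 z • pd 1 (pd 1 s) z
      ∈ Submodule.span ℝ {pd 0 s z, pd 1 s z} := by
  intro σ
  obtain ⟨c, e, h, hq⟩ := exists_isStereoChart F (e'.symm z)
  have hs := h.contDiffOn_support
  set Ω := e'.target ∩ e'.symm ⁻¹' e.source
  have hΩ : IsOpen Ω := e'.isOpen_inter_preimage_symm e.open_source
  have hW : ContDiffOn ℝ ∞ (e ∘ e'.symm) Ω :=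
    contDiffOn_chart he' (contMDiffOn_of_mem_maximalAtlas h.mem_atlas)
  have hmaps : MapsTo (e ∘ e'.symm) Ω e.target := fun y hy => e.map_source hy.2
  have hzΩ : z ∈ Ω := ⟨hz, hq⟩
  have hσ : EqOn σ (middlePos c (support F c e) ∘ (e ∘ e'.symm)) Ω := fun y hy =>
    h.lGaussMap_eq hF hy.2
  have hσi := fun i => eqOn_pd hΩ hσ i
  have hWz := hmaps hzΩ
  rw [minkCoeff_congr_on hΩ hσ hσ hzΩ, minkCoeff_congr_on hΩ hσ hσ hzΩ,
    minkCoeff_congr_on hΩ hσ hσ hzΩ, pd_congr_on hΩ (hσi 0) hzΩ, pd_congr_on hΩ (hσi 1) hzΩ,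
    pd_congr_on hΩ (hσi 1) hzΩ, hσi 0 hzΩ, hσi 1 hzΩ]
  refine trace_comp_mem_span hΩ e.open_target hW hmaps
    (contDiffOn_middlePos e.open_target hs c) hzΩ
    (minkCoeff_middlePos_zero_one e.open_target hs h.basis hWz) ?_ ?_
    (transition_det_ne_zero h.mem_atlas he' hz hq)
  · rw [minkCoeff_middlePos_zero_zero e.open_target hs h.basis hWz,
      minkCoeff_middlePos_one_one e.open_target hs h.basis hWz]
  · rw [laplacian_middlePos e.open_target hs hWz, h.biharmonic_support hmin hWz]
    simp

end

end Laguerre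

/-! ### L-isothermic L-minimal immersions -/

theorem proposition4p1 {M : Type*} [TopologicalSpace M] [T2Space M] [ConnectedSpace M]
    [ChartedSpace Laguerre.E2 M] [IsManifold (𝓡 2) ∞ M]
    (F : Laguerre.LegendreImmersion M) (hF : F.Nondegenerate) (hmin : F.IsLMinimal) :
    (F.IsLIsothermic ↔
      ∃ O v : Laguerre.Mink, v ≠ 0 ∧ ∀ p : M, Laguerre.mink (F.lGaussMap p - O) v = 0) ∧
    (F.IsLIsothermic →
      ∃ P : Set Laguerre.Mink,
        (Laguerre.IsSpacelikeHyperplane P ∨ Laguerre.IsTimelikeHyperplane P ∨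
          Laguerre.IsIsotropicHyperplane P) ∧
        Laguerre.HasZeroMeanCurvatureIn P F.lGaussMap) := by
  refine ⟨⟨fun h => Laguerre.exists_hyperplane_of_isLIsothermic hF hmin h, fun ⟨O, v, hv, hO⟩ =>
    Laguerre.isLIsothermic_of_hyperplane hF hv hO⟩, fun h => ?_⟩
  obtain ⟨O, v, hv, hO⟩ := Laguerre.exists_hyperplane_of_isLIsothermic hF hmin h
  exact ⟨Laguerre.hyperplane O v, Laguerre.hyperplane_trichotomy O hv, hO,
    Laguerre.isSpacelikeImmersion_lGaussMap hF, fun e he z hz =>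
      Laguerre.trace_lGaussMap_mem_span hF hmin he hz⟩
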